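/- Let $n\ge 1$, let $W=\mathbb C^{2n}$ have the basis $w_1,\dots,w_{2n}$ and the symplectic form with $\langle w_k,w_{2n+1-k}\rangle=1$ for $1\le k\le n$ and $\langle w_k,w_l\rangle=0$ for $k+l\ne 2n+1$. Let $pr_k:W\to W$ be the projection along $w_k$ (it replaces the coefficient of $w_k$ by $0$), and let $W_{i,j}$ be the span of $w_1,\dots,w_i,w_{j+1},\dots,w_{2n}$. Let $SpR_{2n}$ be the variety of collections of subspaces $V_{i,j}\subset W$, $1\le i\le j\le 2n$, $i+j\le 2n$, such that (whenever the indices are admissible) $$\dim V_{i,j}=i,\quad V_{i,j}\subset W_{i,j},\quad V_{i,j}\subset V_{i+1,j},\quad pr_{j+1}V_{i,j}\subset V_{i,j+1},\quad V_{i,2n-i}\text{ is isotropic for } i=1,\dots,n.$$ Order the $n^2$ index pairs $(i,j)$ into a sequence $\beta_1,\dots,\beta_{n^2}$ by decreasing $j-i$, and by decreasing $i$ where $j-i$ is constant: $$(1,2n-1),\ (1,2n-2),\ (2,2n-2),\ (1,2n-3),\ (2,2n-3),\ (1,2n-4),\ (3,2n-3),\dots,(n,n),(n-1,n-1),\dots,(1,1).$$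 For $0\le l\le n^2$ let $SpR_{2n}(l)$ be the image of $SpR_{2n}$ under $(V_{\beta_k})_{k\le n^2}\mapsto(V_{\beta_k})_{k\le l}$. Let $Sp\mathcal F^a_{2n}$ be the degenerate symplectic flag variety, i.e. the variety of collections $(V_i)_{i=1}^n$ of subspaces $V_i\subset W$ with $\dim V_i=i$ such that the image of $V_i$ under the projection that replaces the coefficients of $w_{i+1},\dots,w_{2n-i}$ by $0$ is isotropic ($1\le i\le n$), and $pr_{i+1}V_i\subset V_{i+1}$ ($1\le i<n$). Then: 1. $SpR_{2n}$, all $SpR_{2n}(l)$, and $Sp\mathcal F^a_{2n}$ are Zariski closed in the respective products of Grassmannians. $SpR_{2n}(0)$ is a point, for every $l=1,\dots,n^2$ the projection $SpR_{2n}(l)\to SpR_{2n}(l-1)$ is a (Zariski locally trivial) $\mathbb P^1$-fibration, and $SpR_{2n}\to SpR_{2n}(n^2)$ is an isomorphism. So $SpR_{2n}$ is a tower of successive $\mathbb P^1$-fibrations. 2. $SpR_{2n}$ is smooth. 3. The map $\pi_{2n}:SpR_{2n}\to Sp\mathcal F^a_{2n}$, $(V_{i,j})\mapsto (V_{i,i})_{i=1}^n$,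 is a well-defined surjective birational morphism. 4. $Sp\mathcal F^a_{2n}$ is irreducible. Consequently it is the closure of the orbit of the highest weight point $(\langle w_1\rangle,\langle w_1,w_2\rangle,\dots,\langle w_1,\dots,w_n\rangle)$ under the degenerate group: the closure of the set of the points $(V_i(\gamma))_{i=1}^n$, where $\gamma$ runs over the strictly lower triangular matrices in $\mathfrak{sp}_{2n}$ and $V_i(\gamma)$ is the span of $w_t+\sum_{s>i}\gamma_{s,t}w_s$, $1\le t\le i$. -/

import Mathlib

open Topology

noncomputable section

/-! ### Products of Grassmannians as algebraic varieties over `ℂ` -/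

/-- The points of `∏ α, Gr (d α) (ℂ ^ (m α))`, for a (finite) index type `ι`. -/
@[ext]
structure MultiGr {ι : Type} (m d : ι → ℕ) where
  space : (α : ι) → Submodule ℂ (Fin (m α) → ℂ)
  finrank_eq : ∀ α, Module.finrank ℂ (space α) = d α

/-- The entries of a family of matrices, the one with index `α` being of size `m α × d α`. -/
abbrev FrameIdx {ι : Type} (m d : ι → ℕ) : Type := Σ α : ι, Fin (m α) × Fin (d α)

/-- A frame: a family of matrices with linearly independent columns. -/
structure Frame {ι : Type} (m d : ι → ℕ) where
  entry : FrameIdx m d → ℂ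
  linInd : ∀ α, LinearIndependent ℂ
    (fun (s : Fin (d α)) (r : Fin (m α)) => entry ⟨α, r, s⟩)

namespace MultiGr

variable {ι : Type} {m d : ι → ℕ}

/-- The point of the product of Grassmannians given by the column spans of a frame. -/
def ofFrame (A : Frame m d) : MultiGr m d where
  space α := Submodule.span ℂ
    (Set.range fun (s : Fin (d α)) (r : Fin (m α)) => A.entry ⟨α, r, s⟩)
  finrank_eq α := by
    rw [finrank_span_eq_card (A.linInd α), Fintype.card_fin]

end MultiGr

/-- The Zariski topology on frames, a subset of an affine space. -/
instance Frame.zariski {ι : Type} {m d : ι → ℕ} : TopologicalSpace (Frame m d) :=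
  TopologicalSpace.induced
    (fun A => (MvPolynomial.pointToPoint A.entry :
      PrimeSpectrum (MvPolynomial (FrameIdx m d) ℂ))) inferInstance

/-- The Zariski topology on a product of Grassmannians, which is the geometric quotient of the
variety of frames by the product of the groups `GL (d α)`: a subset is closed iff the frames
spanning its points are cut out, among all frames, by polynomials in the matrix entries. -/
instance MultiGr.zariski {ι : Type} {m d : ι → ℕ} : TopologicalSpace (MultiGr m d) :=
  TopologicalSpace.coinduced MultiGr.ofFrame Frame.zariski

/-! ### Regular functions, regular maps, local rings

Varieties are (locally closed) subsets `Z` of products of Grassmannians, with the induced Zariski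
topology; `f` and `F` below matter only on `Z`. -/

section Regular

variable {ι ι' : Type} {m d : ι → ℕ} {m' d' : ι' → ℕ}

/-- `f` restricts to a regular function on `Z`: locally on `Z`, it is a quotient of two polynomials
in the entries of a frame. (As its value depends on the point only and not on the frame, it is
then locally a quotient of multihomogeneous polynomials in the Plücker coordinates.) -/
def IsRegularOn (f : MultiGr m d → ℂ) (Z : Set (MultiGr m d)) : Prop :=
  ∀ x ∈ Z, ∃ U : Set (MultiGr m d), IsOpen U ∧ x ∈ U ∧
    ∃ P Q : MvPolynomial (FrameIdx m d) ℂ, ∀ A : Frame m d, MultiGr.ofFrame A ∈ Z ∩ U →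
      MvPolynomial.eval A.entry Q ≠ 0 ∧
        f (MultiGr.ofFrame A) = MvPolynomial.eval A.entry P / MvPolynomial.eval A.entry Q

/-- `F` restricts to a morphism of varieties `Z → Z'`: it is continuous and pulls back regular
functions on open subsets to regular functions. -/
def IsRegularMapOn (F : MultiGr m d → MultiGr m' d')
    (Z : Set (MultiGr m d)) (Z' : Set (MultiGr m' d')) : Prop :=
  Set.MapsTo F Z Z' ∧ ContinuousOn F Z ∧
    ∀ U' : Set (MultiGr m' d'), IsOpen U' → ∀ g : MultiGr m' d' → ℂ,
      IsRegularOn g (Z' ∩ U') → IsRegularOn (g ∘ F) (Z ∩ F ⁻¹' U')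

/-- `F` and `G` restrict to mutually inverse isomorphisms of varieties between `Z` and `Z'`. -/
def IsIsoOn (F : MultiGr m d → MultiGr m' d') (G : MultiGr m' d' → MultiGr m d)
    (Z : Set (MultiGr m d)) (Z' : Set (MultiGr m' d')) : Prop :=
  IsRegularMapOn F Z Z' ∧ IsRegularMapOn G Z' Z ∧ Set.InvOn G F Z Z'

/-- The morphism `F : Z → Z'` is birational: it restricts to an isomorphism between dense open
subsets. -/
def IsBirationalOn (F : MultiGr m d → MultiGr m' d')
    (Z : Set (MultiGr m d)) (Z' : Set (MultiGr m' d')) : Prop :=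
  IsRegularMapOn F Z Z' ∧
    ∃ (U : Set (MultiGr m d)) (U' : Set (MultiGr m' d')), IsOpen U ∧ IsOpen U' ∧
      Z ⊆ closure (Z ∩ U) ∧ Z' ⊆ closure (Z' ∩ U') ∧
      ∃ G : MultiGr m' d' → MultiGr m d, IsIsoOn F G (Z ∩ U) (Z' ∩ U')

/-- The product of `ℙ¹ = Gr 1 (ℂ ^ 2)` (the factor with index `none`) with a product of
Grassmannians. -/
abbrev P1Prod (m d : ι → ℕ) : Type :=
  MultiGr (ι := Option ι) (fun o => o.elim 2 m) (fun o => o.elim 1 d)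

/-- The projection of the product with `ℙ¹` to the other factors. -/
def P1Prod.base (y : P1Prod m d) : MultiGr m d where
  space α := y.space (some α)
  finrank_eq α := y.finrank_eq (some α)

/-- The morphism `p : E → B` is a (Zariski locally trivial) `ℙ¹`-fibration: `B` is covered by open
subsets `U` such that `p ⁻¹ U` is isomorphic to `U × ℙ¹` over `U`. -/
def IsP1Fibration (p : MultiGr m d → MultiGr m' d')
    (E : Set (MultiGr m d)) (B : Set (MultiGr m' d')) : Prop :=
  IsRegularMapOn p E B ∧
    ∀ b ∈ B, ∃ U : Set (MultiGr m' d'), IsOpen U ∧ b ∈ U ∧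
      ∃ (F : MultiGr m d → P1Prod m' d') (G : P1Prod m' d' → MultiGr m d),
        IsIsoOn F G (E ∩ p ⁻¹' U) {y | P1Prod.base y ∈ B ∩ U} ∧
        ∀ x ∈ E ∩ p ⁻¹' U, P1Prod.base (F x) = p x

theorem IsRegularOn.const (c : ℂ) (Z : Set (MultiGr m d)) : IsRegularOn (fun _ => c) Z :=
  fun _ _ => ⟨Set.univ, isOpen_univ, trivial, MvPolynomial.C c, 1, by simp⟩

theorem IsRegularOn.neg {f : MultiGr m d → ℂ} {Z : Set (MultiGr m d)} (hf : IsRegularOn f Z) :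
    IsRegularOn (-f) Z := by
  intro x hx
  obtain ⟨U, hU, hxU, P, Q, h⟩ := hf x hx
  refine ⟨U, hU, hxU, -P, Q, fun A hA => ⟨(h A hA).1, ?_⟩⟩
  rw [Pi.neg_apply, (h A hA).2, map_neg, neg_div]

theorem IsRegularOn.add_mul {f g : MultiGr m d → ℂ} {Z U V : Set (MultiGr m d)}
    (hf : IsRegularOn f (Z ∩ U)) (hg : IsRegularOn g (Z ∩ V)) :
    IsRegularOn (f + g) (Z ∩ (U ∩ V)) ∧ IsRegularOn (f * g) (Z ∩ (U ∩ V)) := by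
  constructor
  all_goals
    rintro x ⟨hxZ, hxU, hxV⟩
    obtain ⟨U', hU', hxU', P, Q, h⟩ := hf x ⟨hxZ, hxU⟩
    obtain ⟨V', hV', hxV', P', Q', h'⟩ := hg x ⟨hxZ, hxV⟩
  · refine ⟨U' ∩ V', hU'.inter hV', ⟨hxU', hxV'⟩, P * Q' + Q * P', Q * Q', ?_⟩
    rintro A ⟨⟨hZ, hU, hV⟩, hAU', hAV'⟩
    obtain ⟨h1, h2⟩ := h A ⟨⟨hZ, hU⟩, hAU'⟩
    obtain ⟨h3, h4⟩ := h' A ⟨⟨hZ, hV⟩, hAV'⟩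
    refine ⟨by simpa using ⟨h1, h3⟩, ?_⟩
    rw [Pi.add_apply, h2, h4, div_add_div _ _ h1 h3]
    simp
  · refine ⟨U' ∩ V', hU'.inter hV', ⟨hxU', hxV'⟩, P * P', Q * Q', ?_⟩
    rintro A ⟨⟨hZ, hU, hV⟩, hAU', hAV'⟩
    obtain ⟨h1, h2⟩ := h A ⟨⟨hZ, hU⟩, hAU'⟩
    obtain ⟨h3, h4⟩ := h' A ⟨⟨hZ, hV⟩, hAV'⟩
    refine ⟨by simpa using ⟨h1, h3⟩, ?_⟩
    rw [Pi.mul_apply, h2, h4, div_mul_div_comm]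
    simp

/-- The local ring of `Z` at `x`: the germs at `x` of functions that are regular on a neighbourhood
of `x` in `Z`. -/
def localRingAt (Z : Set (MultiGr m d)) (x : MultiGr m d) : Subring (Filter.Germ (𝓝[Z] x) ℂ) where
  carrier := {γ | ∃ (f : MultiGr m d → ℂ) (U : Set (MultiGr m d)),
    IsOpen U ∧ x ∈ U ∧ IsRegularOn f (Z ∩ U) ∧ γ = (f : Filter.Germ (𝓝[Z] x) ℂ)}
  zero_mem' := ⟨fun _ => 0, Set.univ, isOpen_univ, trivial, IsRegularOn.const 0 _, rfl⟩
  one_mem' := ⟨fun _ => 1, Set.univ, isOpen_univ, trivial, IsRegularOn.const 1 _, rfl⟩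
  add_mem' := by
    rintro _ _ ⟨f, U, hU, hxU, hf, rfl⟩ ⟨g, V, hV, hxV, hg, rfl⟩
    exact ⟨f + g, U ∩ V, hU.inter hV, ⟨hxU, hxV⟩, (hf.add_mul hg).1, rfl⟩
  mul_mem' := by
    rintro _ _ ⟨f, U, hU, hxU, hf, rfl⟩ ⟨g, V, hV, hxV, hg, rfl⟩
    exact ⟨f * g, U ∩ V, hU.inter hV, ⟨hxU, hxV⟩, (hf.add_mul hg).2, rfl⟩
  neg_mem' := by
    rintro _ ⟨f, U, hU, hxU, hf, rfl⟩
    exact ⟨-f, U, hU, hxU, hf.neg, rfl⟩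

/-- A variety over `ℂ` is smooth if its local rings are regular. -/
def IsSmoothVariety (Z : Set (MultiGr m d)) : Prop :=
  ∀ x ∈ Z, IsRegularLocalRing (localRingAt Z x)

end Regular

/-! ### The symplectic vector space `W = ℂ ^ (2 n)`

The basis vector `w_k`, `1 ≤ k ≤ 2 n`, is the standard basis vector with index `k - 1` in
`Fin (2 * n)`. -/

/-- The symplectic form with `⟨w_k, w_{2n+1-k}⟩ = 1` for `1 ≤ k ≤ n` and
`⟨w_k, w_l⟩ = 0` for `k + l ≠ 2 n + 1`. -/
def sympForm (n : ℕ) (x y : Fin (2 * n) → ℂ) : ℂ :=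
  ∑ t : Fin (2 * n), if t.1 < n then x t * y t.rev else -(x t * y t.rev)

/-- A subspace on which the symplectic form vanishes. -/
def IsIsotropic (n : ℕ) (V : Submodule ℂ (Fin (2 * n) → ℂ)) : Prop :=
  ∀ x ∈ V, ∀ y ∈ V, sympForm n x y = 0

/-- The projection `pr_k` along `w_k`: it replaces the coefficient of `w_k` by `0`. -/
def pr (n k : ℕ) : (Fin (2 * n) → ℂ) →ₗ[ℂ] (Fin (2 * n) → ℂ) where
  toFun x t := if t.1 + 1 = k then 0 else x t
  map_add' x y := by ext t; by_cases h : t.1 + 1 = k <;> simp [h]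
  map_smul' c x := by ext t; by_cases h : t.1 + 1 = k <;> simp [h]

/-- The projection `pr_{1,3}` belonging to `i`: it replaces the coefficients of
`w_{i+1}, …, w_{2n-i}` by `0`. -/
def prOuter (n i : ℕ) : (Fin (2 * n) → ℂ) →ₗ[ℂ] (Fin (2 * n) → ℂ) where
  toFun x t := if i < t.1 + 1 ∧ t.1 + 1 ≤ 2 * n - i then 0 else x t
  map_add' x y := by
    ext t
    simp only [Pi.add_apply]
    split_ifs <;> simp
  map_smul' c x := by
    ext t
    simp only [Pi.smul_apply, RingHom.id_apply]
    split_ifs <;> simp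

/-- `W_{i,j}`, the span of `w_1, …, w_i, w_{j+1}, …, w_{2n}`: the vectors whose coefficients at
`w_{i+1}, …, w_j` vanish. -/
def coordSubspace (n i j : ℕ) : Submodule ℂ (Fin (2 * n) → ℂ) where
  carrier := {x | ∀ t : Fin (2 * n), i < t.1 + 1 → t.1 + 1 ≤ j → x t = 0}
  zero_mem' := fun _ _ _ => rfl
  add_mem' := by
    intro x y hx hy t h1 h2
    rw [Pi.add_apply, hx t h1 h2, hy t h1 h2, add_zero]
  smul_mem' := by
    intro c x hx t h1 h2
    rw [Pi.smul_apply, hx t h1 h2, smul_zero]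

/-! ### The varieties `SpR_{2n}` and `SpR_{2n}(l)` -/

/-- The index pairs `(i, j)`, `1 ≤ i ≤ j ≤ 2 n`, `i + j ≤ 2 n`; they label the positive roots
`α_{i,j}` of `sp_{2n}`. (The conditions force `j < 2 n`.) -/
abbrev Root (n : ℕ) : Type :=
  {p : Fin (2 * n) × Fin (2 * n) // 1 ≤ p.1.1 ∧ p.1.1 ≤ p.2.1 ∧ p.1.1 + p.2.1 ≤ 2 * n}

/-- The index `i` of `α_{i,j}`. -/
abbrev Root.i {n : ℕ} (α : Root n) : ℕ := α.1.1.1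

/-- The index `j` of `α_{i,j}`. -/
abbrev Root.j {n : ℕ} (α : Root n) : ℕ := α.1.2.1

/-- `α` precedes `β` in the sequence `α_{1,2n-1}, α_{1,2n-2}, α_{2,2n-2}, α_{1,2n-3}, α_{2,2n-3},
α_{1,2n-4}, α_{3,2n-3}, …, α_{n,n}, α_{n-1,n-1}, …, α_{1,1}`: the difference `j - i` decreases,
and so does `i` where the difference is constant. -/
abbrev Root.Precedes {n : ℕ} (α β : Root n) : Prop :=
  β.j - β.i < α.j - α.i ∨ (α.j - α.i = β.j - β.i ∧ β.i < α.i)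

/-- The number of roots that precede `α`, so `α = β_l` for `l = α.pos + 1`. -/
def Root.pos {n : ℕ} (α : Root n) : ℕ :=
  (Finset.univ.filter fun β : Root n => β.Precedes α).card

/-- Collections of subspaces `V_{i,j}` of `W` with `dim V_{i,j} = i`. -/
abbrev RootGr (n : ℕ) : Type := MultiGr (ι := Root n) (fun _ => 2 * n) (fun α => α.i)

/-- The variety `SpR_{2n}`. -/
def SpR (n : ℕ) : Set (RootGr n) :=
  {V | (∀ α : Root n, V.space α ≤ coordSubspace n α.i α.j) ∧
    (∀ α β : Root n, β.i = α.i + 1 → β.j = α.j → V.space α ≤ V.space β) ∧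
    (∀ α β : Root n, β.i = α.i → β.j = α.j + 1 →
      (V.space α).map (pr n (α.j + 1)) ≤ V.space β) ∧
    (∀ α : Root n, α.i + α.j = 2 * n → IsIsotropic n (V.space α))}

/-- Collections of subspaces `V_{β_1}, …, V_{β_l}` of `W` with `dim V_{i,j} = i`. -/
abbrev StepGr (n l : ℕ) : Type :=
  MultiGr (ι := {α : Root n // α.pos < l}) (fun _ => 2 * n) (fun α => α.1.i)

/-- The projection `(V_{β_k})_{k ≤ n²} ↦ (V_{β_k})_{k ≤ l}`. -/
def toStep (n l : ℕ) (V : RootGr n) : StepGr n l where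
  space α := V.space α.1
  finrank_eq α := V.finrank_eq α.1

/-- The step `l` variety `SpR_{2n}(l)`, the image of `SpR_{2n}` under the projection. -/
def SpRStep (n l : ℕ) : Set (StepGr n l) := toStep n l '' SpR n

/-- The projection `(V_{β_k})_{k ≤ l + 1} ↦ (V_{β_k})_{k ≤ l}`. -/
def stepMap (n l : ℕ) (V : StepGr n (l + 1)) : StepGr n l where
  space α := V.space ⟨α.1, Nat.lt_succ_of_lt α.2⟩
  finrank_eq α := V.finrank_eq ⟨α.1, Nat.lt_succ_of_lt α.2⟩

/-! ### The complete degenerate symplectic flag variety -/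

/-- Collections `(V_1, …, V_n)` of subspaces of `W` with `dim V_i = i`; `V_i` has the index `i - 1`
in `Fin n`. -/
abbrev FlagGr (n : ℕ) : Type := MultiGr (ι := Fin n) (fun _ => 2 * n) (fun i => i.1 + 1)

/-- The degenerate symplectic flag variety: the collections `(V_1, …, V_n)` such that each `V_i`
lies in the degenerate symplectic Grassmannian, i.e. `pr_{1,3} V_i` is isotropic, and
`pr_{i+1} V_i ⊆ V_{i+1}` for `1 ≤ i < n`. -/
def SpFlag (n : ℕ) : Set (FlagGr n) :=
  {V | (∀ i : Fin n, IsIsotropic n ((V.space i).map (prOuter n (i.1 + 1)))) ∧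
    (∀ i i' : Fin n, i'.1 = i.1 + 1 → (V.space i).map (pr n (i'.1 + 1)) ≤ V.space i')}

/-- The orbit of the highest weight point `(⟨w_1⟩, ⟨w_1, w_2⟩, …, ⟨w_1, …, w_n⟩)` under the
degenerate (abelian) group with Lie algebra `n⁻ ⊆ sp_{2n}` (the strictly lower triangular matrices
`γ` in `sp_{2n}`): the exponential of `γ` sends `⟨w_1, …, w_i⟩` to the span of the vectors
`w_t + ∑_{s > i} γ_{s,t} w_s`, `1 ≤ t ≤ i`. -/
def degenerateOrbit (n : ℕ) : Set (FlagGr n) :=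
  {V | ∃ γ : Matrix (Fin (2 * n)) (Fin (2 * n)) ℂ,
    (∀ s t, s ≤ t → γ s t = 0) ∧
    (∀ x y, sympForm n (γ.mulVec x) y + sympForm n x (γ.mulVec y) = 0) ∧
    ∀ i : Fin n, V.space i = Submodule.span ℂ
      {v | ∃ t : Fin (2 * n), t.1 < i.1 + 1 ∧
        v = fun s : Fin (2 * n) =>
          if s.1 < i.1 + 1 then (if s = t then 1 else 0) else γ s t}}

/-- The index pair `(i + 1, i + 1)`. -/
def diagRoot {n : ℕ} (i : Fin n) : Root n :=
  ⟨(⟨i.1 + 1, by omega⟩, ⟨i.1 + 1, by omega⟩), by simp only; omega⟩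

/-- The map `π_{2n} : (V_{i,j}) ↦ (V_{1,1}, …, V_{n,n})`. -/
def forget (n : ℕ) (V : RootGr n) : FlagGr n where
  space i := V.space (diagRoot i)
  finrank_eq i := V.finrank_eq (diagRoot i)

end

/-!
# The tower of projective line fibrations over the degenerate symplectic flag variety

A collection `(V_{i,j})`, extended by `V_{0,j} = 0`, lies in `SpR_{2n}` iff for every root
`α_{i+1,j}` the subspace `V_{i+1,j}` has dimension `i + 1` and lies between `V_{i,j}` and the
subspace `towerUpper`, which is `V_{i+1,j+1} ⊕ ⟨w_{j+1}⟩` if `(i + 1) + j < 2n` and the orthogonal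
complement of `V_{i,j}` in `W_{i+1,j}` if `(i + 1) + j = 2n` (`mem_towerSet_iff`). The upper bound
always contains the lower one and has dimension `i + 2` (`TowerOn.lower_le_upper`,
`TowerOn.finrank_towerUpper`). Both depend only on members that come earlier in the order of the
roots. So each `V_{i+1,j}` is a point on a projective line determined by its predecessors, and every
partial collection can be completed; hence the images `SpR_{2n}(l)` are given by the same
conditions, imposed on the first `l` roots only (`SpRStep_eq_towerSet`), and are closed.

Everything is made explicit by graph projections. A subspace `V ⊆ ℂ ^ k` of dimension `|S|` that
meets the span of the basis vectors outside `S` trivially is the image of a unique projection along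
that span. The entries of this matrix are regular functions on the open set of all such `V`
(`isRegularOn_graphProj`), and its columns are a frame of `V`. If `P` and `R` are the graph
projections of the lower and the upper bound, over `S` and `S ∪ {p, q}`, then the upper bound is the
direct sum of the lower one and the span of the columns `p` and `q` of `R` (`IsPencil`). This
trivializes the `ℙ¹`-fibration locally (`isP1Fibration_stepMap`). It also shows that the collections
in which every `V_{i,j}` is a graph over a prescribed set of coordinates form an affine space, with
one coordinate for each root (`ChartOn.exists_isAffineChart`). These charts cover `SpR_{2n}`. In an
affine chart the local rings are localizations of a polynomial ring, hence regular, and any two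
charts meet (`ChartOn.exists_mem_inter`), so `SpR_{2n}` is smooth and irreducible.

Over a point of the degenerate flag variety, the subspaces `V_{i,j}` are constructed by increasing
`j - i`: a subspace `V_{i,j}` between `pr_j V_{i,j-1}` and `V_{i+1,j} ∩ W_{i,j}` exists for reasons
of dimension, and if `i + j = 2n` the isotropic subspace `pr_j V_{i,j-1}` is extended to a
Lagrangian subspace of `W_{i,j}` (`image_forget`). Where every `V_{i,i}` is a graph over
`⟨w_1, …, w_i⟩`, the images `pr_{i+1} ⋯ pr_j V_{i,i} ⊆ V_{i,j}` have full dimension, so that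
`V_{i,j}` is determined by the flag; this gives the inverse on an open subset (`isIsoOn_forget`),
which is dense by irreducibility. Finally, the same open subset of the degenerate flag variety is
the orbit of the degenerate group: the entries of the graph projections of `V_1, …, V_n` fit
together to one strictly lower triangular matrix, and the isotropy of `V_n` says that it can be
completed to an element of `sp_{2n}` (`degenerateOrbit_eq`).
-/

open Topology

noncomputable section

/-! ### The Zariski topology and regular functions on products of Grassmannians -/

section Toolkit

variable {ι ι' : Type} {m d : ι → ℕ} {m' d' : ι' → ℕ}

/-- The nonvanishing loci of polynomials in the matrix entries are a basis of the topology. -/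
theorem Frame.isOpen_iff {O : Set (Frame m d)} :
    IsOpen O ↔ ∀ A ∈ O, ∃ p : MvPolynomial (FrameIdx m d) ℂ,
      MvPolynomial.eval A.entry p ≠ 0 ∧
        ∀ B : Frame m d, MvPolynomial.eval B.entry p ≠ 0 → B ∈ O := by
  have key : ∀ (p : MvPolynomial (FrameIdx m d) ℂ) (A : Frame m d),
      (MvPolynomial.pointToPoint A.entry : PrimeSpectrum (MvPolynomial (FrameIdx m d) ℂ)) ∈
        (PrimeSpectrum.basicOpen p : Set _) ↔ MvPolynomial.eval A.entry p ≠ 0 := by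
    intro p A
    rw [SetLike.mem_coe, PrimeSpectrum.mem_basicOpen]
    refine not_congr ?_
    exact (MvPolynomial.mem_vanishingIdeal_singleton_iff A.entry p).trans
      (by rw [MvPolynomial.aeval_eq_eval])
  constructor
  · rintro ⟨V, hV, rfl⟩ A hA
    obtain ⟨_, ⟨p, rfl⟩, hp, hpV⟩ :=
      PrimeSpectrum.isTopologicalBasis_basic_opens.exists_subset_of_mem_open hA hV
    exact ⟨p, (key p A).1 hp, fun B hB => hpV ((key p B).2 hB)⟩
  · intro h
    rw [isOpen_iff_forall_mem_open]
    intro A hA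
    obtain ⟨p, hp, hpO⟩ := h A hA
    exact ⟨_, fun B hB => hpO B ((key p B).1 hB),
      ⟨_, (PrimeSpectrum.basicOpen p).isOpen, rfl⟩, (key p A).2 hp⟩

/-- The matrix with index `α` of a frame. -/
def Frame.mat (A : Frame m d) (α : ι) : Matrix (Fin (m α)) (Fin (d α)) ℂ :=
  Matrix.of fun r s => A.entry ⟨α, r, s⟩

theorem MultiGr.ofFrame_space (A : Frame m d) (α : ι) :
    (MultiGr.ofFrame A).space α = LinearMap.range (A.mat α).mulVecLin := by
  rw [Matrix.range_mulVecLin]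
  rfl

theorem Frame.mulVec_injective (A : Frame m d) (α : ι) :
    Function.Injective (A.mat α).mulVec :=
  Matrix.mulVec_injective_iff.2 (A.linInd α)

/-- As many spanning vectors as the dimension form a frame. -/
theorem MultiGr.exists_frame_of_span (V : MultiGr m d) (e : FrameIdx m d → ℂ)
    (h : ∀ α, Submodule.span ℂ (Set.range fun (s : Fin (d α)) (r : Fin (m α)) => e ⟨α, r, s⟩) =
      V.space α) : ∃ A : Frame m d, A.entry = e ∧ MultiGr.ofFrame A = V := by
  refine ⟨⟨e, fun α => ?_⟩, rfl, MultiGr.ext (funext h)⟩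
  rw [linearIndependent_iff_card_eq_finrank_span, Set.finrank, h α, V.finrank_eq,
    Fintype.card_fin]

theorem MultiGr.ofFrame_surjective : Function.Surjective (MultiGr.ofFrame (m := m) (d := d)) := by
  intro V
  have h : ∀ α, ∃ b : Fin (d α) → Fin (m α) → ℂ, Submodule.span ℂ (Set.range b) = V.space α := by
    intro α
    let b := Module.finBasisOfFinrankEq ℂ (V.space α) (V.finrank_eq α)
    refine ⟨fun s => (b s : Fin (m α) → ℂ), ?_⟩
    have := congrArg (Submodule.map (V.space α).subtype) b.span_eq
    rw [Submodule.map_span, Submodule.map_top, Submodule.range_subtype, ← Set.range_comp] at this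
    exact this
  choose b hb using h
  obtain ⟨A, -, hA⟩ := V.exists_frame_of_span (fun i => b i.1 i.2.2 i.2.1) hb
  exact ⟨A, hA⟩

/-- Two frames of the same point differ by a family of invertible matrices, so the saturation of an
open set of frames is a union of translates of it. -/
theorem MultiGr.isOpenMap_ofFrame : IsOpenMap (MultiGr.ofFrame (m := m) (d := d)) := by
  intro O hO
  change IsOpen (MultiGr.ofFrame ⁻¹' (MultiGr.ofFrame '' O))
  rw [Frame.isOpen_iff] at hO ⊢
  rintro A ⟨B, hB, hBA⟩
  obtain ⟨p, hp, hpO⟩ := hO B hB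
  -- the two frames differ by a change of basis `g`, which acts on all frames
  have hg : ∀ α, ∃ g : Matrix (Fin (d α)) (Fin (d α)) ℂ, A.mat α * g = B.mat α := by
    intro α
    have h : ∀ s, (B.mat α).col s ∈ LinearMap.range (A.mat α).mulVecLin := by
      intro s
      rw [← MultiGr.ofFrame_space, ← hBA]
      exact Submodule.subset_span ⟨s, rfl⟩
    choose g hg using h
    refine ⟨Matrix.of fun k s => g s k, ?_⟩
    ext r s
    exact congrFun (hg s) r
  choose g hg using hg
  have hinj : ∀ α, Function.Injective (g α).mulVecLin := by
    intro α x y hxy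
    apply B.mulVec_injective α
    rw [← hg, ← Matrix.mulVec_mulVec, ← Matrix.mulVec_mulVec]
    exact congrArg _ hxy
  have hsurj : ∀ α, LinearMap.range (g α).mulVecLin = ⊤ := fun α =>
    LinearMap.range_eq_top.2 (LinearMap.injective_iff_surjective.1 (hinj α))
  let act : FrameIdx m d → MvPolynomial (FrameIdx m d) ℂ := fun i =>
    ∑ k, MvPolynomial.X ⟨i.1, i.2.1, k⟩ * MvPolynomial.C (g i.1 k i.2.2)
  have hact : ∀ (C : Frame m d) α r s,
      MvPolynomial.eval C.entry (act ⟨α, r, s⟩) = (C.mat α * g α) r s := by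
    intro C α r s
    simp [act, Matrix.mul_apply, Frame.mat]
  have heval : ∀ C : Frame m d, MvPolynomial.eval C.entry (MvPolynomial.bind₁ act p) =
      MvPolynomial.eval (fun i => MvPolynomial.eval C.entry (act i)) p := by
    intro C
    rw [← MvPolynomial.coe_aeval_eq_eval, RingHom.coe_coe, MvPolynomial.aeval_bind₁]
    rfl
  refine ⟨MvPolynomial.bind₁ act p, ?_, fun C hC => ?_⟩
  · rw [heval]
    convert! hp with i
    obtain ⟨α, r, s⟩ := i
    rw [hact, hg]
    rfl
  · obtain ⟨D, hD, hDC⟩ := (MultiGr.ofFrame C).exists_frame_of_span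
      (fun i => MvPolynomial.eval C.entry (act i)) (by
        intro α
        simp only [hact]
        rw [MultiGr.ofFrame_space]
        change Submodule.span ℂ (Set.range (C.mat α * g α).col) = _
        rw [← Matrix.range_mulVecLin, Matrix.mulVecLin_mul, LinearMap.range_comp, hsurj,
          Submodule.map_top])
    refine ⟨D, hpO D ?_, hDC⟩
    rw [hD, ← heval]
    exact hC

theorem MultiGr.isOpen_iff {O : Set (MultiGr m d)} :
    IsOpen O ↔ ∀ A : Frame m d, MultiGr.ofFrame A ∈ O → ∃ p : MvPolynomial (FrameIdx m d) ℂ,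
      MvPolynomial.eval A.entry p ≠ 0 ∧
        ∀ B : Frame m d, MvPolynomial.eval B.entry p ≠ 0 → MultiGr.ofFrame B ∈ O :=
  Frame.isOpen_iff (O := MultiGr.ofFrame ⁻¹' O)

/-- The points having some frame at which the polynomial `p` does not vanish. -/
def MultiGr.nonvanishing (p : MvPolynomial (FrameIdx m d) ℂ) : Set (MultiGr m d) :=
  MultiGr.ofFrame '' {A | MvPolynomial.eval A.entry p ≠ 0}

theorem MultiGr.isOpen_nonvanishing (p : MvPolynomial (FrameIdx m d) ℂ) :
    IsOpen (MultiGr.nonvanishing p) :=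
  MultiGr.isOpenMap_ofFrame _ (Frame.isOpen_iff.2 fun _ hA => ⟨p, hA, fun _ hB => hB⟩)

namespace IsRegularOn

variable {f g : MultiGr m d → ℂ} {Z Z' : Set (MultiGr m d)}

theorem mono (hf : IsRegularOn f Z) (h : Z' ⊆ Z) : IsRegularOn f Z' := by
  intro x hx
  obtain ⟨U, hU, hxU, P, Q, hPQ⟩ := hf x (h hx)
  exact ⟨U, hU, hxU, P, Q, fun A hA => hPQ A ⟨h hA.1, hA.2⟩⟩

theorem congr (hf : IsRegularOn f Z) (h : ∀ x ∈ Z, g x = f x) : IsRegularOn g Z := by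
  intro x hx
  obtain ⟨U, hU, hxU, P, Q, hPQ⟩ := hf x hx
  exact ⟨U, hU, hxU, P, Q, fun A hA => ⟨(hPQ A hA).1, (h _ hA.1).trans (hPQ A hA).2⟩⟩

theorem of_locally (h : ∀ x ∈ Z, ∃ U, IsOpen U ∧ x ∈ U ∧ IsRegularOn f (Z ∩ U)) :
    IsRegularOn f Z := by
  intro x hx
  obtain ⟨U, hU, hxU, hf⟩ := h x hx
  obtain ⟨V, hV, hxV, P, Q, hPQ⟩ := hf x ⟨hx, hxU⟩
  exact ⟨U ∩ V, hU.inter hV, ⟨hxU, hxV⟩, P, Q, fun A hA => hPQ A ⟨⟨hA.1, hA.2.1⟩, hA.2.2⟩⟩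

theorem add (hf : IsRegularOn f Z) (hg : IsRegularOn g Z) :
    IsRegularOn (fun x => f x + g x) Z := by
  have := (add_mul (Z := Z) (U := Set.univ) (V := Set.univ)
    (hf.mono Set.inter_subset_left) (hg.mono Set.inter_subset_left)).1
  exact this.mono (by simp)

theorem mul (hf : IsRegularOn f Z) (hg : IsRegularOn g Z) :
    IsRegularOn (fun x => f x * g x) Z := by
  have := (add_mul (Z := Z) (U := Set.univ) (V := Set.univ)
    (hf.mono Set.inter_subset_left) (hg.mono Set.inter_subset_left)).2
  exact this.mono (by simp)

theorem sub (hf : IsRegularOn f Z) (hg : IsRegularOn g Z) :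
    IsRegularOn (fun x => f x - g x) Z :=
  (hf.add hg.neg).congr fun _ _ => sub_eq_add_neg _ _

theorem sum {κ : Type*} (s : Finset κ) {f : κ → MultiGr m d → ℂ}
    (h : ∀ k ∈ s, IsRegularOn (f k) Z) : IsRegularOn (fun x => ∑ k ∈ s, f k x) Z := by
  classical
  induction s using Finset.induction_on with
  | empty => exact (const 0 Z).congr (by simp)
  | insert a s ha ih =>
    refine ((h a (Finset.mem_insert_self _ _)).add
      (ih fun k hk => h k (Finset.mem_insert_of_mem hk))).congr fun x _ => ?_
    rw [Finset.sum_insert ha]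

theorem div (hf : IsRegularOn f Z) (hg : IsRegularOn g Z) (h0 : ∀ x ∈ Z, g x ≠ 0) :
    IsRegularOn (fun x => f x / g x) Z := by
  intro x hx
  obtain ⟨U, hU, hxU, P, Q, h⟩ := hf x hx
  obtain ⟨V, hV, hxV, P', Q', h'⟩ := hg x hx
  refine ⟨U ∩ V, hU.inter hV, ⟨hxU, hxV⟩, P * Q', Q * P', ?_⟩
  rintro A ⟨hZ, hAU, hAV⟩
  obtain ⟨h1, h2⟩ := h A ⟨hZ, hAU⟩
  obtain ⟨h3, h4⟩ := h' A ⟨hZ, hAV⟩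
  have h5 : MvPolynomial.eval A.entry P' ≠ 0 := by
    intro h6
    exact h0 _ hZ (by rw [h4, h6, zero_div])
  refine ⟨by simpa using ⟨h1, h5⟩, ?_⟩
  simp only [h2, h4, map_mul]
  field_simp

theorem eval {σ : Type*} {g : σ → MultiGr m d → ℂ} (hg : ∀ i, IsRegularOn (g i) Z)
    (p : MvPolynomial σ ℂ) : IsRegularOn (fun x => MvPolynomial.eval (fun i => g i x) p) Z := by
  induction p using MvPolynomial.induction_on with
  | C a => exact (const a Z).congr (by simp)
  | add p q hp hq => exact (hp.add hq).congr (by simp)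
  | mul_X p i hp => exact (hp.mul (hg i)).congr (by simp)

/-- The locus where a regular function does not vanish is open. -/
theorem exists_ne_zero (hf : IsRegularOn f Z) {x : MultiGr m d} (hx : x ∈ Z) (h0 : f x ≠ 0) :
    ∃ O, IsOpen O ∧ x ∈ O ∧ ∀ y ∈ Z ∩ O, f y ≠ 0 := by
  obtain ⟨U, hU, hxU, P, Q, h⟩ := hf x hx
  obtain ⟨A, rfl⟩ := MultiGr.ofFrame_surjective x
  refine ⟨U ∩ MultiGr.nonvanishing P, hU.inter (MultiGr.isOpen_nonvanishing P),
    ⟨hxU, A, fun h1 => h0 ?_, rfl⟩, ?_⟩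
  · rw [(h A ⟨hx, hxU⟩).2, h1, zero_div]
  · rintro _ ⟨hyZ, hyU, B, hB, rfl⟩
    obtain ⟨h1, h2⟩ := h B ⟨hyZ, hyU⟩
    rw [h2]
    exact div_ne_zero hB h1

end IsRegularOn

/-- The subspace `Φ y` of `ℂ ^ k` depends regularly on `y ∈ Z`: locally on `Z`, it is spanned by
vectors, labelled by `κ`, whose coordinates are regular functions. -/
def IsRegularSubspaceOn {k : ℕ} (Φ : MultiGr m d → Submodule ℂ (Fin k → ℂ)) (κ : Type)
    (Z : Set (MultiGr m d)) : Prop :=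
  ∀ x ∈ Z, ∃ U : Set (MultiGr m d), IsOpen U ∧ x ∈ U ∧ ∃ g : κ → Fin k → MultiGr m d → ℂ,
    (∀ a r, IsRegularOn (g a r) (Z ∩ U)) ∧
      ∀ y ∈ Z ∩ U, Submodule.span ℂ (Set.range fun a r => g a r y) = Φ y

namespace IsRegularSubspaceOn

variable {k : ℕ} {Φ Ψ : MultiGr m d → Submodule ℂ (Fin k → ℂ)} {κ κ' : Type}
  {Z Z' : Set (MultiGr m d)}

theorem congr (h : IsRegularSubspaceOn Φ κ Z) (h' : ∀ x ∈ Z, Ψ x = Φ x) :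
    IsRegularSubspaceOn Ψ κ Z := by
  intro x hx
  obtain ⟨U, hU, hxU, g, hg, hs⟩ := h x hx
  exact ⟨U, hU, hxU, g, hg, fun y hy => (hs y hy).trans (h' y hy.1).symm⟩

theorem reindex (h : IsRegularSubspaceOn Φ κ Z) (e : κ' ≃ κ) : IsRegularSubspaceOn Φ κ' Z := by
  intro x hx
  obtain ⟨U, hU, hxU, g, hg, hs⟩ := h x hx
  refine ⟨U, hU, hxU, fun a => g (e a), fun a => hg (e a), fun y hy => ?_⟩
  rw [← hs y hy]
  exact congrArg _ (e.surjective.range_comp fun a r => g a r y)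

theorem mono (h : IsRegularSubspaceOn Φ κ Z) (hZ : Z' ⊆ Z) : IsRegularSubspaceOn Φ κ Z' := by
  intro x hx
  obtain ⟨U, hU, hxU, g, hg, hs⟩ := h x (hZ hx)
  exact ⟨U, hU, hxU, g, fun a r => (hg a r).mono (Set.inter_subset_inter_left _ hZ),
    fun y hy => hs y ⟨hZ hy.1, hy.2⟩⟩

end IsRegularSubspaceOn

/-- A map into a product of Grassmannians all of whose components depend regularly on the point is
given, locally, by a frame with regular entries. -/
theorem exists_regular_frame [Finite ι'] {F : MultiGr m d → MultiGr m' d'} {Z : Set (MultiGr m d)}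
    (h : ∀ α, IsRegularSubspaceOn (fun x => (F x).space α) (Fin (d' α)) Z)
    {x : MultiGr m d} (hx : x ∈ Z) :
    ∃ U : Set (MultiGr m d), IsOpen U ∧ x ∈ U ∧ ∃ g : FrameIdx m' d' → MultiGr m d → ℂ,
      (∀ i, IsRegularOn (g i) (Z ∩ U)) ∧
        ∀ y ∈ Z ∩ U, ∃ B : Frame m' d', B.entry = (fun i => g i y) ∧ MultiGr.ofFrame B = F y := by
  choose U hU hxU g hg hs using fun α => h α x hx
  refine ⟨⋂ α, U α, isOpen_iInter_of_finite hU, Set.mem_iInter.2 hxU,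
    fun i => g i.1 i.2.2 i.2.1, fun i => (hg _ _ _).mono
      (Set.inter_subset_inter_right _ (Set.iInter_subset _ _)), fun y hy => ?_⟩
  exact (F y).exists_frame_of_span _ fun α => hs α y ⟨hy.1, Set.mem_iInter.1 hy.2 α⟩

/-- Regularity of the components implies Zariski continuity: a polynomial in the entries of a
regular frame is a regular function, and its nonvanishing locus is open. -/
theorem continuousOn_of_isRegularSubspaceOn [Finite ι'] {F : MultiGr m d → MultiGr m' d'}
    {Z : Set (MultiGr m d)}
    (h : ∀ α, IsRegularSubspaceOn (fun x => (F x).space α) (Fin (d' α)) Z) : ContinuousOn F Z := by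
  intro x hx
  rw [ContinuousWithinAt, Filter.tendsto_def]
  intro N hN
  obtain ⟨O, hON, hO, hxO⟩ := mem_nhds_iff.1 hN
  obtain ⟨U, hU, hxU, g, hg, hgF⟩ := exists_regular_frame h hx
  obtain ⟨B, hB, hBF⟩ := hgF x ⟨hx, hxU⟩
  obtain ⟨p, hp, hpO⟩ := MultiGr.isOpen_iff.1 hO B (hBF ▸ hxO)
  rw [hB] at hp
  obtain ⟨V, hV, hxV, hne⟩ := (IsRegularOn.eval hg p).exists_ne_zero ⟨hx, hxU⟩ hp
  refine mem_nhdsWithin.2 ⟨U ∩ V, hU.inter hV, ⟨hxU, hxV⟩, ?_⟩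
  rintro y ⟨⟨hyU, hyV⟩, hyZ⟩
  obtain ⟨C, hC, hCF⟩ := hgF y ⟨hyZ, hyU⟩
  refine hON ?_
  rw [← hCF]
  exact hpO C (hC ▸ hne y ⟨⟨hyZ, hyU⟩, hyV⟩)

theorem IsRegularOn.comp [Finite ι'] {F : MultiGr m d → MultiGr m' d'} {Z : Set (MultiGr m d)}
    (h : ∀ α, IsRegularSubspaceOn (fun x => (F x).space α) (Fin (d' α)) Z)
    {f : MultiGr m' d' → ℂ} {Z' : Set (MultiGr m' d')} (hf : IsRegularOn f Z')
    (hF : Set.MapsTo F Z Z') : IsRegularOn (fun x => f (F x)) Z := by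
  refine IsRegularOn.of_locally fun x hx => ?_
  obtain ⟨U, hU, hxU, g, hg, hgF⟩ := exists_regular_frame h hx
  obtain ⟨V, hV, hxV, P, Q, hPQ⟩ := hf (F x) (hF hx)
  obtain ⟨O, hO, hxO, hOV⟩ := mem_nhdsWithin.1
    (continuousOn_of_isRegularSubspaceOn h x hx (hV.mem_nhds hxV))
  refine ⟨U ∩ O, hU.inter hO, ⟨hxU, hxO⟩, ?_⟩
  have hsub : Z ∩ (U ∩ O) ⊆ Z ∩ U := fun y hy => ⟨hy.1, hy.2.1⟩
  have hval : ∀ y ∈ Z ∩ (U ∩ O), MvPolynomial.eval (fun i => g i y) Q ≠ 0 ∧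
      f (F y) = MvPolynomial.eval (fun i => g i y) P / MvPolynomial.eval (fun i => g i y) Q := by
    intro y hy
    obtain ⟨C, hC, hCF⟩ := hgF y (hsub hy)
    rw [← hC, ← hCF]
    refine hPQ C ?_
    rw [hCF]
    exact ⟨hF hy.1, hOV ⟨hy.2.2, hy.1⟩⟩
  exact (((IsRegularOn.eval hg P).mono hsub).div ((IsRegularOn.eval hg Q).mono hsub)
    fun y hy => (hval y hy).1).congr fun y hy => (hval y hy).2

/-- A map into a product of Grassmannians is a morphism if all of its components depend regularly
on the point. -/
theorem IsRegularMapOn.of_isRegularSubspaceOn [Finite ι'] {F : MultiGr m d → MultiGr m' d'}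
    {Z : Set (MultiGr m d)} {Z' : Set (MultiGr m' d')} (hF : Set.MapsTo F Z Z')
    (h : ∀ α, IsRegularSubspaceOn (fun x => (F x).space α) (Fin (d' α)) Z) :
    IsRegularMapOn F Z Z' :=
  ⟨hF, continuousOn_of_isRegularSubspaceOn h, fun _ _ _ hg =>
    IsRegularOn.comp (fun α => (h α).mono Set.inter_subset_left) hg
      fun _ hx => ⟨hF hx.1, hx.2⟩⟩

end Toolkit

/-! ### Subspaces as graphs over coordinate subspaces -/

section Graph

variable {k : ℕ}

/-- The subspace `V` of `ℂ ^ k` is a graph over the coordinates in `S`: the projection of `V` to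
`ℂ ^ S` is an isomorphism. Equivalently, the Plücker coordinate of `V` with index `S` does not
vanish. -/
def IsGraphOver (V : Submodule ℂ (Fin k → ℂ)) (S : Finset (Fin k)) : Prop :=
  S.card = Module.finrank ℂ V ∧ ∀ v ∈ V, (∀ s ∈ S, v s = 0) → v = 0

/-- `P` is the projection onto `V` along the span of the basis vectors with index outside `S`; it
exists iff `V` is a graph over `S`. -/
structure IsGraphProj (P : Matrix (Fin k) (Fin k) ℂ) (V : Submodule ℂ (Fin k → ℂ))
    (S : Finset (Fin k)) : Prop where
  mem : ∀ x, P.mulVec x ∈ V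
  agree : ∀ x, ∀ s ∈ S, P.mulVec x s = x s
  inj : ∀ v ∈ V, (∀ s ∈ S, v s = 0) → v = 0

/-- The projection of a subspace to the coordinates in `S`. -/
def restrictCoords (V : Submodule ℂ (Fin k → ℂ)) (S : Finset (Fin k)) : V →ₗ[ℂ] (S → ℂ) :=
  (LinearMap.funLeft ℂ ℂ (fun s : S => (s : Fin k))).comp V.subtype

theorem restrictCoords_injective {V : Submodule ℂ (Fin k → ℂ)} {S : Finset (Fin k)}
    (h : ∀ v ∈ V, (∀ s ∈ S, v s = 0) → v = 0) : Function.Injective (restrictCoords V S) := by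
  rw [injective_iff_map_eq_zero]
  intro v hv
  exact Subtype.ext (h v v.2 fun s hs => congrFun hv ⟨s, hs⟩)

namespace IsGraphProj

variable {P : Matrix (Fin k) (Fin k) ℂ} {V : Submodule ℂ (Fin k → ℂ)} {S : Finset (Fin k)}

theorem eq_of_agree (h : IsGraphProj P V S) {x v : Fin k → ℂ} (hv : v ∈ V)
    (hx : ∀ s ∈ S, v s = x s) : P.mulVec x = v := by
  rw [← sub_eq_zero]
  refine h.inj _ (V.sub_mem (h.mem x) hv) fun s hs => ?_
  rw [Pi.sub_apply, h.agree x s hs, hx s hs, sub_self]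

theorem mulVec_eq_self (h : IsGraphProj P V S) {v : Fin k → ℂ} (hv : v ∈ V) : P.mulVec v = v :=
  h.eq_of_agree hv fun _ _ => rfl

theorem col_mem (h : IsGraphProj P V S) (c : Fin k) : (fun r => P r c) ∈ V := by
  have := h.mem (Pi.single c 1)
  rwa [Matrix.mulVec_single_one] at this

theorem apply_of_mem (h : IsGraphProj P V S) {s : Fin k} (hs : s ∈ S) (c : Fin k) :
    P s c = if s = c then 1 else 0 := by
  have := h.agree (Pi.single c 1) s hs
  rw [Matrix.mulVec_single_one, Pi.single_apply] at this
  exact this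

theorem apply_of_notMem (h : IsGraphProj P V S) {c : Fin k} (hc : c ∉ S) (r : Fin k) :
    P r c = 0 := by
  refine congrFun (h.inj _ (h.col_mem c) fun s hs => ?_) r
  rw [h.apply_of_mem hs, if_neg]
  rintro rfl
  exact hc hs

theorem unique (h : IsGraphProj P V S) {P' : Matrix (Fin k) (Fin k) ℂ}
    (h' : IsGraphProj P' V S) : P = P' := by
  ext r c
  have := h.eq_of_agree (x := Pi.single c 1) (h'.mem (Pi.single c 1)) (h'.agree _)
  rw [Matrix.mulVec_single_one, Matrix.mulVec_single_one] at this
  exact congrFun this r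

theorem isGraphOver (h : IsGraphProj P V S) : IsGraphOver V S := by
  refine ⟨?_, h.inj⟩
  have hbij : Function.Bijective (restrictCoords V S) := by
    refine ⟨restrictCoords_injective h.inj, fun y => ?_⟩
    refine ⟨⟨P.mulVec fun r => if hr : r ∈ S then y ⟨r, hr⟩ else 0, h.mem _⟩, ?_⟩
    ext s
    exact (h.agree _ s s.2).trans (dif_pos s.2)
  rw [(LinearEquiv.ofBijective _ hbij).finrank_eq, Module.finrank_fintype_fun_eq_card,
    Fintype.card_coe]

theorem span_col (h : IsGraphProj P V S) :
    Submodule.span ℂ (Set.range fun (s : S) (r : Fin k) => P r s) = V := by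
  apply le_antisymm
  · rw [Submodule.span_le]
    rintro _ ⟨s, rfl⟩
    exact h.col_mem s
  · intro v hv
    rw [← h.mulVec_eq_self hv, Matrix.mulVec_eq_sum]
    refine Submodule.sum_mem _ fun c _ => ?_
    rw [op_smul_eq_smul]
    by_cases hc : c ∈ S
    · exact Submodule.smul_mem _ _ (Submodule.subset_span
        (Set.mem_range_self (f := fun (s : S) (r : Fin k) => P r s) ⟨c, hc⟩))
    · convert! Submodule.zero_mem _
      ext r
      simp [h.apply_of_notMem hc r]

end IsGraphProj

/-- The projection is the inverse of the isomorphism of `V` with the coordinate space of `S`,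
applied to the coordinates in `S`. -/
theorem IsGraphOver.exists_isGraphProj {V : Submodule ℂ (Fin k → ℂ)} {S : Finset (Fin k)}
    (h : IsGraphOver V S) : ∃ P, IsGraphProj P V S := by
  have hinj := restrictCoords_injective h.2
  have hrank : Module.finrank ℂ V = Module.finrank ℂ (S → ℂ) := by
    rw [Module.finrank_fintype_fun_eq_card, Fintype.card_coe, h.1]
  let e := LinearEquiv.ofInjectiveOfFinrankEq _ hinj hrank
  have he : ∀ (y : S → ℂ) (s : S), (e.symm y : Fin k → ℂ) s = y s := fun y s =>
    congrFun (e.apply_symm_apply y) s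
  let f : (Fin k → ℂ) →ₗ[ℂ] (Fin k → ℂ) :=
    V.subtype ∘ₗ e.symm.toLinearMap ∘ₗ LinearMap.funLeft ℂ ℂ (fun s : S => (s : Fin k))
  have hf : ∀ x, (LinearMap.toMatrix' f).mulVec x = f x := LinearMap.toMatrix'_mulVec f
  refine ⟨LinearMap.toMatrix' f, fun x => ?_, fun x s hs => ?_, h.2⟩
  · rw [hf]
    exact (e.symm _).2
  · rw [hf]
    exact he _ ⟨s, hs⟩

open Classical in
/-- The projection onto `V` along the basis vectors with index outside `S`; the junk value `0` if
`V` is not a graph over `S`. -/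
def graphProj (V : Submodule ℂ (Fin k → ℂ)) (S : Finset (Fin k)) : Matrix (Fin k) (Fin k) ℂ :=
  if h : ∃ P, IsGraphProj P V S then h.choose else 0

theorem IsGraphOver.isGraphProj {V : Submodule ℂ (Fin k → ℂ)} {S : Finset (Fin k)}
    (h : IsGraphOver V S) : IsGraphProj (graphProj V S) V S := by
  have h' := h.exists_isGraphProj
  rw [graphProj, dif_pos h']
  exact h'.choose_spec

theorem IsGraphProj.graphProj_eq {P : Matrix (Fin k) (Fin k) ℂ} {V : Submodule ℂ (Fin k → ℂ)}
    {S : Finset (Fin k)} (h : IsGraphProj P V S) : graphProj V S = P :=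
  h.isGraphOver.isGraphProj.unique h

theorem isGraphOver_bot : IsGraphOver (⊥ : Submodule ℂ (Fin k → ℂ)) ∅ :=
  ⟨by simp, fun v hv _ => by simpa using hv⟩

/-- Every subspace is a graph over some set of coordinates. -/
theorem exists_isGraphOver (V : Submodule ℂ (Fin k → ℂ)) : ∃ S, IsGraphOver V S := by
  classical
  have hex : ∃ n, ∃ S : Finset (Fin k), S.card = n ∧
      ∀ v ∈ V, (∀ s ∈ S, v s = 0) → v = 0 :=
    ⟨_, Finset.univ, rfl, fun v _ h => funext fun s => h s (Finset.mem_univ s)⟩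
  -- a minimal set of coordinates on which `V` is determined
  obtain ⟨S, hS, hinj⟩ := Nat.find_spec hex
  refine ⟨S, le_antisymm ?_ ?_, hinj⟩
  · have hne : ∀ s : S, ∃ v : V, (∀ t ∈ S, t ≠ s → v.1 t = 0) ∧ v.1 s ≠ 0 := by
      intro s
      have hmin := Nat.find_min hex (m := (S.erase s).card)
        (by rw [← hS]; exact Finset.card_erase_lt_of_mem s.2)
      by_contra! hcon
      refine hmin ⟨S.erase s, rfl, fun v hv h => hinj v hv fun t ht => ?_⟩
      by_cases hts : t = s
      · rw [hts]
        exact hcon ⟨v, hv⟩ fun t ht hts => h t (Finset.mem_erase.2 ⟨hts, ht⟩)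
      · exact h t (Finset.mem_erase.2 ⟨hts, ht⟩)
    choose v hv hv' using hne
    have hli : LinearIndependent ℂ v := by
      rw [Fintype.linearIndependent_iff]
      intro c hc s
      have h1 := congrFun (congrArg Subtype.val hc) s
      rw [AddSubmonoidClass.coe_finsetSum, Finset.sum_apply, Finset.sum_eq_single s] at h1
      · exact (mul_eq_zero.1 h1).resolve_right (hv' s)
      · intro t _ hts
        have := hv t s s.2 fun h => hts (Subtype.ext h.symm)
        simp [this]
      · simp
    simpa using hli.fintype_card_le_finrank
  · have := LinearMap.finrank_le_finrank_of_injective (restrictCoords_injective hinj)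
    rwa [Module.finrank_fintype_fun_eq_card, Fintype.card_coe] at this

end Graph

section Charts

variable {ι : Type} {m d : ι → ℕ}

/-- The points whose subspace with index `α` is a graph over `S`. -/
def graphLocus (α : ι) (S : Finset (Fin (m α))) : Set (MultiGr m d) :=
  {x | IsGraphOver (x.space α) S}

/-- The square submatrix of a frame with rows given by `σ`. -/
def Frame.minor (A : Frame m d) (α : ι) (σ : Fin (d α) → Fin (m α)) :
    Matrix (Fin (d α)) (Fin (d α)) ℂ := (A.mat α).submatrix σ id

/-- The generic square matrix with rows given by `σ`. -/
def genericMinor (α : ι) (σ : Fin (d α) → Fin (m α)) :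
    Matrix (Fin (d α)) (Fin (d α)) (MvPolynomial (FrameIdx m d) ℂ) :=
  Matrix.of fun s s' => MvPolynomial.X ⟨α, σ s, s'⟩

theorem map_genericMinor (A : Frame m d) (α : ι) (σ : Fin (d α) → Fin (m α)) :
    (MvPolynomial.eval A.entry).mapMatrix (genericMinor α σ) = A.minor α σ := by
  ext s s'
  simp [genericMinor, Frame.minor, Frame.mat]

theorem isGraphOver_ofFrame_iff (A : Frame m d) (α : ι) {S : Finset (Fin (m α))}
    (e : Fin (d α) ≃ S) : IsGraphOver ((MultiGr.ofFrame A).space α) S ↔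
      (A.minor α fun s => e s).det ≠ 0 := by
  have hmul : ∀ x s, (A.minor α fun s => e s).mulVec x s = (A.mat α).mulVec x (e s) :=
    fun _ _ => rfl
  constructor
  · rintro ⟨-, h⟩ hdet
    obtain ⟨x, hx0, hx⟩ := Matrix.exists_mulVec_eq_zero_iff.2 hdet
    refine hx0 (A.mulVec_injective α ?_)
    rw [Matrix.mulVec_zero]
    refine h _ (by rw [MultiGr.ofFrame_space]; exact ⟨x, rfl⟩) fun s hs => ?_
    have := hmul x (e.symm ⟨s, hs⟩)
    rw [hx, e.apply_symm_apply] at this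
    exact this.symm
  · intro hdet
    refine ⟨?_, fun v hv h => ?_⟩
    · rw [MultiGr.finrank_eq, ← Fintype.card_coe, ← Fintype.card_congr e, Fintype.card_fin]
    · rw [MultiGr.ofFrame_space] at hv
      obtain ⟨x, rfl⟩ := hv
      have hx : x = 0 := by
        by_contra hx
        refine hdet (Matrix.exists_mulVec_eq_zero_iff.1 ⟨x, hx, ?_⟩)
        ext s
        exact h (e s) (e s).2
      rw [hx, map_zero]

/-- If a subspace of dimension `d α` is a graph over `S`, then `S` is enumerated by
`Fin (d α)`. -/
theorem exists_enumeration {x : MultiGr m d} {α : ι} {S : Finset (Fin (m α))}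
    (h : IsGraphOver (x.space α) S) : Nonempty (Fin (d α) ≃ S) :=
  ⟨(Finset.equivFinOfCardEq (h.1.trans (x.finrank_eq α))).symm⟩

theorem isOpen_graphLocus (α : ι) (S : Finset (Fin (m α))) :
    IsOpen (graphLocus (d := d) α S) := by
  rw [MultiGr.isOpen_iff]
  intro A hA
  obtain ⟨e⟩ := exists_enumeration hA
  have hdet : ∀ B : Frame m d, MvPolynomial.eval B.entry (genericMinor α fun s => e s).det =
      (B.minor α fun s => e s).det := fun B => by rw [RingHom.map_det, map_genericMinor]
  refine ⟨(genericMinor α fun s => e s).det, ?_, fun B hB => ?_⟩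
  · rw [hdet]
    exact (isGraphOver_ofFrame_iff A α e).1 hA
  · rw [hdet] at hB
    exact (isGraphOver_ofFrame_iff B α e).2 hB

/-- The affine coordinates of a subspace, in a chart of the Grassmannian, are regular functions. -/
theorem isRegularOn_graphProj (α : ι) (S : Finset (Fin (m α))) (r c : Fin (m α)) :
    IsRegularOn (fun x : MultiGr m d => graphProj (x.space α) S r c) (graphLocus α S) := by
  by_cases hc : c ∈ S
  swap
  · exact (IsRegularOn.const 0 _).congr fun x hx => hx.isGraphProj.apply_of_notMem hc r
  intro x hx
  obtain ⟨e⟩ := exists_enumeration hx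
  refine ⟨Set.univ, isOpen_univ, trivial,
    ∑ s, MvPolynomial.X ⟨α, r, s⟩ * (genericMinor α fun s => e s).adjugate s (e.symm ⟨c, hc⟩),
    (genericMinor α fun s => e s).det, ?_⟩
  rintro A ⟨hA, -⟩
  have hdet := (isGraphOver_ofFrame_iff A α e).1 hA
  rw [RingHom.map_det, map_genericMinor]
  refine ⟨hdet, ?_⟩
  have hadj : ∀ s s', MvPolynomial.eval A.entry ((genericMinor α fun s => e s).adjugate s s') =
      (A.minor α fun s => e s).adjugate s s' := by
    intro s s'
    rw [← map_genericMinor, ← RingHom.map_adjugate]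
    rfl
  -- the column with index `c` of the normalized frame
  let y : Fin (d α) → ℂ := fun s =>
    ((A.minor α fun s => e s).det)⁻¹ * (A.minor α fun s => e s).adjugate s (e.symm ⟨c, hc⟩)
  have hy : (A.minor α fun s => e s).mulVec y = Pi.single (e.symm ⟨c, hc⟩) 1 := by
    have h1 : y = ((A.minor α fun s => e s).det)⁻¹ •
        (A.minor α fun s => e s).adjugate.mulVec (Pi.single (e.symm ⟨c, hc⟩) 1) := by
      rw [Matrix.mulVec_single_one]
      rfl
    rw [h1, Matrix.mulVec_smul, Matrix.mulVec_mulVec, Matrix.mul_adjugate, Matrix.smul_mulVec,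
      Matrix.one_mulVec, smul_smul, inv_mul_cancel₀ hdet, one_smul]
  have hcol := (IsGraphOver.isGraphProj hA).eq_of_agree (x := Pi.single c 1)
    (v := (A.mat α).mulVec y) (by rw [MultiGr.ofFrame_space]; exact ⟨y, rfl⟩) (by
      intro s hs
      have h1 := congrFun hy (e.symm ⟨s, hs⟩)
      have h2 : (A.minor α fun s => e s).mulVec y (e.symm ⟨s, hs⟩) = (A.mat α).mulVec y s := by
        change (A.mat α).mulVec y (e (e.symm ⟨s, hs⟩)) = _
        rw [e.apply_symm_apply]
      rw [← h2, h1, Pi.single_apply, Pi.single_apply]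
      simp)
  rw [Matrix.mulVec_single_one] at hcol
  refine (congrFun hcol r).trans ?_
  change ∑ s, A.mat α r s * y s = _
  rw [map_sum, Finset.sum_div]
  refine Finset.sum_congr rfl fun s _ => ?_
  rw [map_mul, MvPolynomial.eval_X, hadj]
  simp only [y, Frame.mat, Matrix.of_apply]
  ring

/-- The columns of graph projections are regular frames. -/
theorem isRegularSubspaceOn_space (α : ι) (Z : Set (MultiGr m d)) :
    IsRegularSubspaceOn (fun x => x.space α) (Fin (d α)) Z := by
  intro x _
  obtain ⟨S, hS⟩ := exists_isGraphOver (x.space α)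
  obtain ⟨e⟩ := exists_enumeration hS
  refine ⟨graphLocus α S, isOpen_graphLocus α S, hS,
    fun a r y => graphProj (y.space α) S r (e a),
    fun a r => (isRegularOn_graphProj α S r _).mono Set.inter_subset_right, fun y hy => ?_⟩
  refine Eq.trans ?_ (IsGraphOver.isGraphProj hy.2).span_col
  exact congrArg (fun s : Set (Fin (m α) → ℂ) => Submodule.span ℂ s) (e.surjective.range_comp
    fun (s : S) (r : Fin (m α)) => graphProj (y.space α) S r s)

/-! ### Closed conditions on collections of subspaces -/

/-- A subset is closed if, near each point outside, some regular function vanishes on the subset but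
not at the point. -/
theorem isClosed_of_regular_equations {T : Set (MultiGr m d)}
    (h : ∀ x ∉ T, ∃ Z : Set (MultiGr m d), IsOpen Z ∧ x ∈ Z ∧ ∃ f : MultiGr m d → ℂ,
      IsRegularOn f Z ∧ f x ≠ 0 ∧ ∀ y ∈ Z, y ∈ T → f y = 0) : IsClosed T := by
  rw [← isOpen_compl_iff, isOpen_iff_forall_mem_open]
  intro x hx
  obtain ⟨Z, hZ, hxZ, f, hf, hfx, hfT⟩ := h x hx
  obtain ⟨O, hO, hxO, hOf⟩ := hf.exists_ne_zero hxZ hfx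
  exact ⟨Z ∩ O, fun y hy hyT => hOf y hy (hfT y hy.1 hyT), hZ.inter hO, hxZ, hxO⟩

theorem IsRegularOn.linearMap_apply {k k' : ℕ} (f : (Fin k → ℂ) →ₗ[ℂ] (Fin k' → ℂ))
    {v : MultiGr m d → Fin k → ℂ} {Z : Set (MultiGr m d)}
    (hv : ∀ r, IsRegularOn (fun x => v x r) Z) (r : Fin k') :
    IsRegularOn (fun x => f (v x) r) Z := by
  refine (IsRegularOn.sum Finset.univ (f := fun s x => LinearMap.toMatrix' f r s * v x s)
    fun s _ => (IsRegularOn.const _ Z).mul (hv s)).congr fun x _ => ?_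
  rw [← LinearMap.toMatrix'_mulVec]
  rfl

theorem isClosed_setOf_map_le {α β : ι} (f : (Fin (m α) → ℂ) →ₗ[ℂ] (Fin (m β) → ℂ)) :
    IsClosed {x : MultiGr m d | (x.space α).map f ≤ x.space β} := by
  refine isClosed_of_regular_equations fun x hx => ?_
  obtain ⟨S, hS⟩ := exists_isGraphOver (x.space α)
  obtain ⟨T, hT⟩ := exists_isGraphOver (x.space β)
  have hex : ∃ s, f (fun r => graphProj (x.space α) S r s) ∉ x.space β := by
    by_contra! hcon
    refine hx ?_
    change (x.space α).map f ≤ x.space β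
    rw [Submodule.map_le_iff_le_comap, ← hS.isGraphProj.span_col, Submodule.span_le]
    rintro _ ⟨s, rfl⟩
    exact hcon s
  obtain ⟨s, hs⟩ := hex
  have hex' : ∃ r, f (fun r => graphProj (x.space α) S r s) r -
      (graphProj (x.space β) T).mulVec (f fun r => graphProj (x.space α) S r s) r ≠ 0 := by
    by_contra! hcon
    refine hs ?_
    convert! hT.isGraphProj.mem (f fun r => graphProj (x.space α) S r s) using 1
    ext r
    exact sub_eq_zero.1 (hcon r)
  obtain ⟨r, hr⟩ := hex'
  have hreg : ∀ r, IsRegularOn (fun y : MultiGr m d =>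
      f (fun r => graphProj (y.space α) S r s) r) (graphLocus α S ∩ graphLocus β T) := fun r =>
    IsRegularOn.linearMap_apply f
      (fun r => (isRegularOn_graphProj α S r s).mono Set.inter_subset_left) r
  refine ⟨graphLocus α S ∩ graphLocus β T, (isOpen_graphLocus α S).inter (isOpen_graphLocus β T),
    ⟨hS, hT⟩, _, (hreg r).sub (IsRegularOn.sum Finset.univ (f := fun c y =>
      graphProj (y.space β) T r c * f (fun r => graphProj (y.space α) S r s) c) fun c _ =>
        ((isRegularOn_graphProj β T r c).mono Set.inter_subset_right).mul (hreg c)), hr, ?_⟩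
  rintro y ⟨hyS, hyT⟩ hy
  have h1 := (IsGraphOver.isGraphProj hyT).mulVec_eq_self
    (hy (Submodule.mem_map_of_mem ((IsGraphOver.isGraphProj hyS).col_mem s)))
  exact sub_eq_zero.2 (congrFun h1 r).symm

theorem isClosed_setOf_le_ker {α : ι} {k : ℕ} (f : (Fin (m α) → ℂ) →ₗ[ℂ] (Fin k → ℂ)) :
    IsClosed {x : MultiGr m d | x.space α ≤ LinearMap.ker f} := by
  refine isClosed_of_regular_equations fun x hx => ?_
  obtain ⟨S, hS⟩ := exists_isGraphOver (x.space α)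
  have hex : ∃ s, f (fun r => graphProj (x.space α) S r s) ≠ 0 := by
    by_contra! hcon
    refine hx ?_
    change x.space α ≤ LinearMap.ker f
    rw [← hS.isGraphProj.span_col, Submodule.span_le]
    rintro _ ⟨s, rfl⟩
    exact hcon s
  obtain ⟨s, hs⟩ := hex
  obtain ⟨r, hr⟩ := Function.ne_iff.1 hs
  refine ⟨graphLocus α S, isOpen_graphLocus α S, hS, _,
    IsRegularOn.linearMap_apply f (fun r => isRegularOn_graphProj α S r s) r, hr, ?_⟩
  intro y hyS hy
  exact congrFun (hy ((IsGraphOver.isGraphProj hyS).col_mem s)) r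

theorem isClosed_setOf_bilin_eq_zero {α : ι}
    (b : (Fin (m α) → ℂ) →ₗ[ℂ] (Fin (m α) → ℂ) →ₗ[ℂ] ℂ) :
    IsClosed {x : MultiGr m d | ∀ v ∈ x.space α, ∀ w ∈ x.space α, b v w = 0} := by
  refine isClosed_of_regular_equations fun x hx => ?_
  obtain ⟨S, hS⟩ := exists_isGraphOver (x.space α)
  have hex : ∃ s t, b (fun r => graphProj (x.space α) S r s)
      (fun r => graphProj (x.space α) S r t) ≠ 0 := by
    by_contra! hcon
    refine hx fun v hv w hw => ?_
    have h1 : x.space α ≤ LinearMap.ker (b.flip w) := by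
      rw [← hS.isGraphProj.span_col, Submodule.span_le]
      rintro _ ⟨s, rfl⟩
      have h2 : x.space α ≤ LinearMap.ker (b fun r => graphProj (x.space α) S r s) := by
        conv_lhs => rw [← hS.isGraphProj.span_col]
        rw [Submodule.span_le]
        rintro _ ⟨t, rfl⟩
        exact hcon s t
      exact h2 hw
    exact h1 hv
  obtain ⟨s, t, hst⟩ := hex
  refine ⟨graphLocus α S, isOpen_graphLocus α S, hS, _, ?_, hst, fun y hyS hy =>
    hy _ ((IsGraphOver.isGraphProj hyS).col_mem s) _ ((IsGraphOver.isGraphProj hyS).col_mem t)⟩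
  refine (IsRegularOn.sum Finset.univ fun i _ => IsRegularOn.sum Finset.univ
    (f := fun j y => graphProj (y.space α) S i s * (graphProj (y.space α) S j t *
      b (Pi.single i 1) (Pi.single j 1))) fun j _ => (isRegularOn_graphProj α S i s).mul
        ((isRegularOn_graphProj α S j t).mul (IsRegularOn.const _ _))).congr fun y _ => ?_
  have hexp : ∀ v : Fin (m α) → ℂ, v = ∑ i, v i • Pi.single i 1 := pi_eq_sum_univ'
  conv_lhs => rw [hexp fun r => graphProj (y.space α) S r s,
    hexp fun r => graphProj (y.space α) S r t]
  simp only [map_sum, LinearMap.sum_apply, map_smul, LinearMap.smul_apply, smul_eq_mul,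
    Finset.mul_sum]
  rw [Finset.sum_comm]
  exact Finset.sum_congr rfl fun _ _ => Finset.sum_congr rfl fun _ _ => mul_left_comm _ _ _

end Charts

/-! ### The symplectic form -/

section Symplectic

variable {n : ℕ}

/-- The sign `⟨w_t, w_{2n+1-t}⟩`. -/
def sympSign (n : ℕ) (t : Fin (2 * n)) : ℂ := if t.1 < n then 1 else -1

theorem sympSign_mul_self (t : Fin (2 * n)) : sympSign n t * sympSign n t = 1 := by
  unfold sympSign
  split_ifs <;> norm_num

theorem sympSign_rev (t : Fin (2 * n)) : sympSign n t.rev = -sympSign n t := by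
  unfold sympSign
  have := Fin.val_rev t
  split_ifs <;> first | omega | norm_num

theorem sympForm_eq (x y : Fin (2 * n) → ℂ) :
    sympForm n x y = ∑ t, sympSign n t * (x t * y t.rev) := by
  refine Finset.sum_congr rfl fun t _ => ?_
  unfold sympSign
  split_ifs <;> ring

/-- The symplectic form as a bilinear map. -/
def sympBilin (n : ℕ) : (Fin (2 * n) → ℂ) →ₗ[ℂ] (Fin (2 * n) → ℂ) →ₗ[ℂ] ℂ :=
  LinearMap.mk₂ ℂ (sympForm n)
    (fun x x' y => by
      simp only [sympForm_eq, ← Finset.sum_add_distrib, Pi.add_apply]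
      exact Finset.sum_congr rfl fun _ _ => by ring)
    (fun c x y => by
      simp only [sympForm_eq, Finset.mul_sum, Pi.smul_apply, smul_eq_mul]
      exact Finset.sum_congr rfl fun _ _ => by ring)
    (fun x y y' => by
      simp only [sympForm_eq, ← Finset.sum_add_distrib, Pi.add_apply]
      exact Finset.sum_congr rfl fun _ _ => by ring)
    (fun c x y => by
      simp only [sympForm_eq, Finset.mul_sum, Pi.smul_apply, smul_eq_mul]
      exact Finset.sum_congr rfl fun _ _ => by ring)

@[simp]
theorem sympBilin_apply (x y : Fin (2 * n) → ℂ) : sympBilin n x y = sympForm n x y := rfl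

theorem sympForm_swap (x y : Fin (2 * n) → ℂ) : sympForm n x y = -sympForm n y x := by
  rw [sympForm_eq, sympForm_eq, ← Finset.sum_neg_distrib]
  refine Fintype.sum_equiv Fin.revPerm _ _ fun t => ?_
  rw [Fin.revPerm_apply, sympSign_rev, Fin.rev_rev]
  ring

theorem sympForm_self (x : Fin (2 * n) → ℂ) : sympForm n x x = 0 :=
  self_eq_neg.1 (sympForm_swap x x)

/-- The orthogonal complement for the symplectic form. -/
def sympPerp (n : ℕ) (A : Submodule ℂ (Fin (2 * n) → ℂ)) : Submodule ℂ (Fin (2 * n) → ℂ) where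
  carrier := {y | ∀ x ∈ A, sympForm n x y = 0}
  zero_mem' x _ := (sympBilin n x).map_zero
  add_mem' {y z} hy hz x hx := by
    rw [← sympBilin_apply, map_add, sympBilin_apply, sympBilin_apply, hy x hx, hz x hx, add_zero]
  smul_mem' c y hy x hx := by
    rw [← sympBilin_apply, map_smul, sympBilin_apply, hy x hx, smul_zero]

theorem mem_coordSubspace {i j : ℕ} {x : Fin (2 * n) → ℂ} :
    x ∈ coordSubspace n i j ↔ ∀ t : Fin (2 * n), i < t.1 + 1 → t.1 + 1 ≤ j → x t = 0 := Iff.rfl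

theorem coordSubspace_mono {i j i' j' : ℕ} (hi : i ≤ i') (hj : j' ≤ j) :
    coordSubspace n i j ≤ coordSubspace n i' j' :=
  fun _ hx t h1 h2 => hx t (by omega) (by omega)

theorem pr_apply (k : ℕ) (x : Fin (2 * n) → ℂ) (t : Fin (2 * n)) :
    pr n k x t = if t.1 + 1 = k then 0 else x t := rfl

theorem prOuter_apply (k : ℕ) (x : Fin (2 * n) → ℂ) (t : Fin (2 * n)) :
    prOuter n k x t = if k < t.1 + 1 ∧ t.1 + 1 ≤ 2 * n - k then 0 else x t := rfl

end Symplectic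

section LinearAlgebra

theorem eq_sup_span_of_finrank {k : ℕ} {A V : Submodule ℂ (Fin k → ℂ)} (hAV : A ≤ V)
    (hrank : Module.finrank ℂ V = Module.finrank ℂ A + 1) {v : Fin k → ℂ} (hv : v ∈ V)
    (hvA : v ∉ A) : A ⊔ Submodule.span ℂ {v} = V := by
  have hle : A ⊔ Submodule.span ℂ {v} ≤ V :=
    sup_le hAV ((Submodule.span_singleton_le_iff_mem _ _).2 hv)
  refine Submodule.eq_of_le_of_finrank_le hle ?_
  have hlt : A < A ⊔ Submodule.span ℂ {v} := by
    refine lt_of_le_of_ne le_sup_left fun h => hvA ?_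
    rw [h]
    exact Submodule.mem_sup_right (Submodule.mem_span_singleton_self v)
  have := Submodule.finrank_lt_finrank_of_lt hlt
  omega

theorem exists_notMem_of_finrank_lt {k : ℕ} {A V : Submodule ℂ (Fin k → ℂ)}
    (hrank : Module.finrank ℂ A < Module.finrank ℂ V) : ∃ v ∈ V, v ∉ A := by
  by_contra! h
  have := Submodule.finrank_mono (show V ≤ A from h)
  omega

/-- A subspace containing an isotropic subspace `A` as a hyperplane and orthogonal to `A` is
isotropic. -/
theorem isIsotropic_of_le_sympPerp {n : ℕ} {A V : Submodule ℂ (Fin (2 * n) → ℂ)} (hAV : A ≤ V)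
    (hV : V ≤ sympPerp n A) (hrank : Module.finrank ℂ V = Module.finrank ℂ A + 1) :
    IsIsotropic n V := by
  obtain ⟨v, hv, hvA⟩ := exists_notMem_of_finrank_lt (A := A) (V := V) (by omega)
  have hsup := eq_sup_span_of_finrank hAV hrank hv hvA
  intro x hx y hy
  rw [← hsup] at hx
  obtain ⟨a, ha, z, hz, rfl⟩ := Submodule.mem_sup.1 hx
  obtain ⟨c, rfl⟩ := Submodule.mem_span_singleton.1 hz
  have hy' := hy
  rw [← hsup] at hy
  obtain ⟨b, hb, z, hz, rfl⟩ := Submodule.mem_sup.1 hy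
  obtain ⟨e, rfl⟩ := Submodule.mem_span_singleton.1 hz
  have h1 : sympForm n a (b + e • v) = 0 := hV hy' a ha
  have h2 : sympForm n b v = 0 := hV hv b hb
  simp only [← sympBilin_apply, map_add, map_smul, LinearMap.add_apply, LinearMap.smul_apply]
    at h1 h2 ⊢
  have h3 : sympBilin n v b = 0 := by
    rw [sympBilin_apply, sympForm_swap, ← sympBilin_apply, h2, neg_zero]
  have h4 : sympBilin n v v = 0 := sympForm_self v
  simp only [smul_eq_mul] at h1 ⊢
  linear_combination h1 + c * h3 + e * c * h4

end LinearAlgebra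

/-! ### Towers of subspaces

A collection `(V_{i,j})` is extended to all `i, j ∈ ℕ` by the zero subspace, so that `V_{0,j} = 0`.
The conditions that define `SpR_{2n}` say that `V_{i+1,j}` lies between `V_{i,j}` and a subspace
`towerUpper` of dimension `i + 2` that depends on `V_{i,j}` and `V_{i+1,j+1}` only. -/

section Tower

/-- The largest subspace that can be `V_{i+1,j}`, for `A = V_{i,j}` and `B = V_{i+1,j+1}`: the
orthogonal complement of `A` in `W_{i+1,j}` if `(i + 1) + j = 2n`, and `B ⊕ ⟨w_{j+1}⟩` otherwise. -/
def towerUpper (n i j : ℕ) (A B : Submodule ℂ (Fin (2 * n) → ℂ)) :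
    Submodule ℂ (Fin (2 * n) → ℂ) :=
  coordSubspace n (i + 1) j ⊓
    if 2 * n ≤ i + 1 + j then sympPerp n A else B.comap (pr n (j + 1))

/-- The conditions on `V_{i+1,j}`. -/
structure TowerAt (n : ℕ) (V : ℕ → ℕ → Submodule ℂ (Fin (2 * n) → ℂ)) (i j : ℕ) : Prop where
  finrank_eq : Module.finrank ℂ (V (i + 1) j) = i + 1
  lower : V i j ≤ V (i + 1) j
  upper : V (i + 1) j ≤ towerUpper n i j (V i j) (V (i + 1) (j + 1))

/-- `D` is a set of index pairs that contains, with `(i + 1, j)`, the pairs `(i, j)` and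
`(i + 1, j + 1)` on which the conditions on `V_{i+1,j}` depend. -/
structure IsLowerDomain (n : ℕ) (D : ℕ → ℕ → Prop) : Prop where
  le : ∀ i j, D (i + 1) j → i + 1 ≤ j ∧ i + 1 + j ≤ 2 * n
  left : ∀ i j, D (i + 2) j → D (i + 1) j
  up : ∀ i j, D (i + 1) j → i + 1 + j < 2 * n → D (i + 1) (j + 1)

/-- A collection of subspaces, indexed by `D`, satisfying the conditions of `SpR_{2n}`. -/
structure TowerOn (n : ℕ) (D : ℕ → ℕ → Prop) (V : ℕ → ℕ → Submodule ℂ (Fin (2 * n) → ℂ)) :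
    Prop where
  zero : ∀ j, V 0 j = ⊥
  at_of : ∀ i j, D (i + 1) j → TowerAt n V i j

/-- The set of all index pairs. -/
def fullDomain (n i j : ℕ) : Prop := 1 ≤ i ∧ i ≤ j ∧ i + j ≤ 2 * n

theorem isLowerDomain_fullDomain (n : ℕ) : IsLowerDomain n (fullDomain n) where
  le i j h := ⟨h.2.1, h.2.2⟩
  left i j h := by unfold fullDomain at *; omega
  up i j h h' := by unfold fullDomain at *; omega

/-- Induction along the tower: the condition `M` at `(i + 1, j)` may be deduced from the
conditions on a smaller domain containing all predecessors. -/
theorem IsLowerDomain.induction {n : ℕ} {D : ℕ → ℕ → Prop} (hD : IsLowerDomain n D)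
    {M : ℕ → ℕ → Prop}
    (step : ∀ D' : ℕ → ℕ → Prop, IsLowerDomain n D' → (∀ i j, D' (i + 1) j → D (i + 1) j) →
      (∀ i j, D' (i + 1) j → M i j) → ∀ i j, D (i + 1) j → (1 ≤ i → D' i j) →
      (i + 1 + j < 2 * n → D' (i + 1) (j + 1)) → M i j) :
    ∀ i j, D (i + 1) j → M i j := by
  have key : ∀ k i j, D (i + 1) j → i + (2 * n - j) < k → M i j := by
    intro k
    induction k with
    | zero => intro i j _ h; omega
    | succ k ih =>
      intro i j hij hk
      refine step (fun i j => D i j ∧ i + (2 * n - j) < k + 1) ⟨?_, ?_, ?_⟩ (fun _ _ h => h.1)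
        (fun i j h => ih i j h.1 (by have := h.2; omega)) i j hij ?_ ?_
      · exact fun i j h => hD.le i j h.1
      · exact fun i j h => ⟨hD.left i j h.1, by have := h.2; omega⟩
      · exact fun i j h h' => ⟨hD.up i j h.1 h', by have := h.2; omega⟩
      · intro hi
        obtain ⟨i, rfl⟩ := Nat.exists_eq_add_of_le' hi
        exact ⟨hD.left i j hij, by omega⟩
      · exact fun h => ⟨hD.up i j hij h, by omega⟩
  exact fun i j h => key _ i j h (Nat.lt_succ_self _)

/-- Recursion along the tower. -/
def towerRec {X : Type*} (N : ℕ) (x₀ : X) (g : ℕ → ℕ → X → X → X) : ℕ → ℕ → X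
  | 0, _ => x₀
  | i + 1, j => g i j (towerRec N x₀ g i j) (if j ≤ N then towerRec N x₀ g (i + 1) (j + 1) else x₀)
termination_by i j => i + (N + 1 - j)

theorem towerRec_succ {X : Type*} (N : ℕ) (x₀ : X) (g : ℕ → ℕ → X → X → X) (i : ℕ) {j : ℕ}
    (hj : j ≤ N) : towerRec N x₀ g (i + 1) j =
      g i j (towerRec N x₀ g i j) (towerRec N x₀ g (i + 1) (j + 1)) := by
  rw [towerRec, if_pos hj]

/-- Construction of a family along the tower: the member with index `(i + 1, j)` is chosen
depending on those with indices `(i, j)` and `(i + 1, j + 1)`, whenever this is possible. -/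
theorem exists_tower_family {X : Type*} (N : ℕ) (x₀ : X) (Φ : ℕ → ℕ → X → X → X → Prop) :
    ∃ f : ℕ → ℕ → X, (∀ j, f 0 j = x₀) ∧ ∀ i j, j ≤ N →
      (∃ x, Φ i j (f i j) (f (i + 1) (j + 1)) x) →
      Φ i j (f i j) (f (i + 1) (j + 1)) (f (i + 1) j) := by
  classical
  refine ⟨towerRec N x₀ fun i j a b => if h : ∃ x, Φ i j a b x then h.choose else x₀,
    fun j => by rw [towerRec], fun i j hj h => ?_⟩
  rw [show towerRec N x₀ _ (i + 1) j = h.choose from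
    (towerRec_succ N x₀ _ i hj).trans (dif_pos h)]
  exact h.choose_spec

variable {n : ℕ} {D : ℕ → ℕ → Prop} {V : ℕ → ℕ → Submodule ℂ (Fin (2 * n) → ℂ)}

theorem TowerOn.finrank_lower (hV : TowerOn n D V) {i j : ℕ} (h : 1 ≤ i → D i j) :
    Module.finrank ℂ (V i j) = i := by
  cases i with
  | zero => rw [hV.zero, finrank_bot]
  | succ i => exact (hV.at_of i j (h (by omega))).finrank_eq

theorem TowerAt.le_coordSubspace {i j : ℕ} (h : TowerAt n V i j) :
    V (i + 1) j ≤ coordSubspace n (i + 1) j := h.upper.trans inf_le_left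

theorem TowerAt.le_sympPerp {i j : ℕ} (h : TowerAt n V i j) (hij : 2 * n ≤ i + 1 + j) :
    V (i + 1) j ≤ sympPerp n (V i j) := by
  have := h.upper.trans inf_le_right
  rwa [if_pos hij] at this

theorem TowerAt.map_pr_le {i j : ℕ} (h : TowerAt n V i j) (hij : i + 1 + j < 2 * n) :
    (V (i + 1) j).map (pr n (j + 1)) ≤ V (i + 1) (j + 1) := by
  have := h.upper.trans inf_le_right
  rw [if_neg (by omega)] at this
  exact Submodule.map_le_iff_le_comap.2 this

theorem TowerOn.le_coordSubspace (hV : TowerOn n D V) {i j : ℕ} (h : 1 ≤ i → D i j) :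
    V i j ≤ coordSubspace n i j := by
  cases i with
  | zero => rw [hV.zero]; exact bot_le
  | succ i => exact (hV.at_of i j (h (by omega))).le_coordSubspace

theorem TowerOn.isIsotropic (hD : IsLowerDomain n D) (hV : TowerOn n D V) {i j : ℕ}
    (h : D (i + 1) j) (hij : 2 * n ≤ i + 1 + j) : IsIsotropic n (V (i + 1) j) := by
  have h1 := hV.at_of i j h
  refine isIsotropic_of_le_sympPerp h1.lower (h1.le_sympPerp hij) ?_
  rw [h1.finrank_eq, hV.finrank_lower]
  intro hi
  obtain ⟨i, rfl⟩ := Nat.exists_eq_add_of_le' hi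
  exact hD.left i j h

/-- The form on a subspace is not changed by the projection along a basis vector whose dual basis
vector does not occur. -/
theorem sympForm_pr {i j : ℕ} (hij : i + 1 + j = 2 * n) {x y : Fin (2 * n) → ℂ}
    (hx : ∀ t : Fin (2 * n), t.1 = i → x t = 0) (hy : ∀ t : Fin (2 * n), t.1 = i → y t = 0) :
    sympForm n (pr n (j + 1) x) (pr n (j + 1) y) = sympForm n x y := by
  rw [sympForm_eq, sympForm_eq]
  refine Finset.sum_congr rfl fun t _ => ?_
  have ht := Fin.val_rev t
  rw [pr_apply, pr_apply]
  by_cases h1 : t.1 = j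
  · rw [hy t.rev (by omega)]
    simp
  · by_cases h2 : t.1 = i
    · rw [hx t h2]
      simp
    · rw [if_neg (by omega), if_neg (by omega)]

/-- The necessary inclusion for the existence of `V_{i+1,j}`. -/
theorem TowerOn.lower_le_upper (hD : IsLowerDomain n D) (hV : TowerOn n D V) {i j : ℕ}
    (hij : i + 1 ≤ j) (hij' : i + 1 + j ≤ 2 * n) (hl : 1 ≤ i → D i j)
    (hu : i + 1 + j < 2 * n → D (i + 1) (j + 1)) :
    V i j ≤ towerUpper n i j (V i j) (V (i + 1) (j + 1)) := by
  refine le_inf ((hV.le_coordSubspace hl).trans (coordSubspace_mono (by omega) le_rfl)) ?_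
  cases i with
  | zero => rw [hV.zero]; exact bot_le
  | succ i =>
    have h1 := hl (by omega)
    have h2 := hV.at_of i j h1
    have h3 := h2.map_pr_le (by omega)
    split_ifs with hp
    · have h4 := hD.up i j h1 (by omega)
      have hiso := hV.isIsotropic hD h4 (by omega)
      intro x hx y hy
      rw [← sympForm_pr (i := i + 1) (j := j) (by omega)
        (fun t ht => h2.le_coordSubspace hy t (by omega) (by omega))
        (fun t ht => h2.le_coordSubspace hx t (by omega) (by omega))]
      exact hiso _ (h3 (Submodule.mem_map_of_mem hy)) _ (h3 (Submodule.mem_map_of_mem hx))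
    · rw [← Submodule.map_le_iff_le_comap]
      exact h3.trans (hV.at_of (i + 1) (j + 1) (hu (by omega))).lower

end Tower

/-! ### Coordinate charts of the tower -/

section ChartCombinatorics

/-- The analogue of `towerUpper` for sets of coordinates. -/
def upperCoords (n i j : ℕ) (S T : Finset (Fin (2 * n))) : Finset (Fin (2 * n)) :=
  {t | (t.1 < i + 1 ∨ j ≤ t.1) ∧ if 2 * n ≤ i + 1 + j then t.rev ∉ S else t.1 = j ∨ t ∈ T}

theorem mem_upperCoords {n i j : ℕ} {S T : Finset (Fin (2 * n))} {t : Fin (2 * n)} :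
    t ∈ upperCoords n i j S T ↔ (t.1 < i + 1 ∨ j ≤ t.1) ∧
      if 2 * n ≤ i + 1 + j then t.rev ∉ S else t.1 = j ∨ t ∈ T := by
  simp [upperCoords]

/-- The analogue of `TowerAt` for sets of coordinates. -/
structure ChartAt (n : ℕ) (S : ℕ → ℕ → Finset (Fin (2 * n))) (i j : ℕ) : Prop where
  card_eq : (S (i + 1) j).card = i + 1
  lower : S i j ⊆ S (i + 1) j
  upper : S (i + 1) j ⊆ upperCoords n i j (S i j) (S (i + 1) (j + 1))

/-- Sets of coordinates that label a chart of the tower; they are the collections of coordinate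
subspaces satisfying the conditions of `SpR_{2n}`. -/
structure ChartOn (n : ℕ) (D : ℕ → ℕ → Prop) (S : ℕ → ℕ → Finset (Fin (2 * n))) : Prop where
  zero : ∀ j, S 0 j = ∅
  at_of : ∀ i j, D (i + 1) j → ChartAt n S i j

variable {n : ℕ} {D : ℕ → ℕ → Prop} {S : ℕ → ℕ → Finset (Fin (2 * n))}

theorem ChartOn.card_lower (hS : ChartOn n D S) {i j : ℕ} (h : 1 ≤ i → D i j) :
    (S i j).card = i := by
  cases i with
  | zero => rw [hS.zero, Finset.card_empty]
  | succ i => exact (hS.at_of i j (h (by omega))).card_eq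

theorem ChartOn.mem_range (hS : ChartOn n D S) {i j : ℕ} (h : 1 ≤ i → D i j) {t : Fin (2 * n)}
    (ht : t ∈ S i j) : t.1 < i ∨ j ≤ t.1 := by
  cases i with
  | zero => rw [hS.zero] at ht; simp at ht
  | succ i => exact (mem_upperCoords.1 ((hS.at_of i j (h (by omega))).upper ht)).1

theorem ChartOn.rev_notMem (hD : IsLowerDomain n D) (hS : ChartOn n D S) {i j : ℕ}
    (h : D (i + 1) j) (hij : 2 * n ≤ i + 1 + j) {t : Fin (2 * n)} (ht : t ∈ S (i + 1) j) :
    t.rev ∉ S (i + 1) j := by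
  intro ht'
  have h1 := hS.at_of i j h
  have h2 := (mem_upperCoords.1 (h1.upper ht)).2
  have h3 := (mem_upperCoords.1 (h1.upper ht')).2
  rw [if_pos hij] at h2 h3
  rw [Fin.rev_rev] at h3
  have hcard : (S i j).card = i := hS.card_lower fun hi => by
    obtain ⟨i, rfl⟩ := Nat.exists_eq_add_of_le' hi
    exact hD.left i j h
  have hlt : ({t, t.rev} : Finset (Fin (2 * n))).card ≤ (S (i + 1) j \ S i j).card :=
    Finset.card_le_card fun s hs => by
      rw [Finset.mem_insert, Finset.mem_singleton] at hs
      rw [Finset.mem_sdiff]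
      rcases hs with rfl | rfl
      · exact ⟨ht, h3⟩
      · exact ⟨ht', h2⟩
  have hne : t ≠ t.rev := fun h => by
    have := congrArg Fin.val h
    rw [Fin.val_rev] at this
    omega
  rw [Finset.card_pair hne, Finset.card_sdiff_of_subset h1.lower, h1.card_eq, hcard] at hlt
  omega

theorem ChartOn.lower_subset_upper (hD : IsLowerDomain n D) (hS : ChartOn n D S) {i j : ℕ}
    (hij : i + 1 ≤ j) (hij' : i + 1 + j ≤ 2 * n) (hl : 1 ≤ i → D i j)
    (hu : i + 1 + j < 2 * n → D (i + 1) (j + 1)) :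
    S i j ⊆ upperCoords n i j (S i j) (S (i + 1) (j + 1)) := by
  intro t ht
  have hrange := hS.mem_range hl ht
  refine mem_upperCoords.2 ⟨by omega, ?_⟩
  cases i with
  | zero => rw [hS.zero] at ht; simp at ht
  | succ i =>
    have h1 := hl (by omega)
    have h2 := hS.at_of i j h1
    have h3 : ∀ s ∈ S (i + 1) j, s.1 = j ∨ s ∈ S (i + 1) (j + 1) := by
      intro s hs
      have := (mem_upperCoords.1 (h2.upper hs)).2
      rwa [if_neg (by omega)] at this
    split_ifs with hp
    · intro ht'
      have hrange' := hS.mem_range hl ht'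
      have hv := Fin.val_rev t
      rcases h3 t ht with h4 | h4
      · omega
      · rcases h3 _ ht' with h5 | h5
        · omega
        · exact hS.rev_notMem hD (hD.up i j h1 (by omega)) (by omega) h4 h5
    · rcases h3 t ht with h4 | h4
      · exact Or.inl h4
      · exact Or.inr ((hS.at_of (i + 1) (j + 1) (hu (by omega))).lower h4)

theorem card_outer_coords {n i j : ℕ} (hij : i + 1 ≤ j) (hij' : i + 1 + j = 2 * n) :
    ({t | t.1 < i + 1 ∨ j ≤ t.1} : Finset (Fin (2 * n))).card = 2 * (i + 1) := by
  have h1 : ({t | t.1 < i + 1} : Finset (Fin (2 * n))).card = i + 1 := by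
    rw [Fin.card_filter_val_lt]
    omega
  rw [Finset.filter_or, Finset.card_union_of_disjoint]
  · have h2 : ({t | j ≤ t.1} : Finset (Fin (2 * n))) =
        ({t | t.1 < i + 1} : Finset (Fin (2 * n))).map Fin.revPerm.toEmbedding := by
      ext t
      have := Fin.val_rev t
      simp only [Finset.mem_filter, Finset.mem_univ, true_and, Finset.mem_map_equiv,
        Fin.revPerm_symm, Fin.revPerm_apply]
      omega
    rw [h2, Finset.card_map, h1]
    omega
  · rw [Finset.disjoint_filter]
    intro t _ h1 h2
    omega

theorem ChartOn.card_upperCoords (hS : ChartOn n D S) {i j : ℕ}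
    (hij : i + 1 ≤ j) (hij' : i + 1 + j ≤ 2 * n) (hl : 1 ≤ i → D i j)
    (hu : i + 1 + j < 2 * n → D (i + 1) (j + 1)) :
    (upperCoords n i j (S i j) (S (i + 1) (j + 1))).card = i + 2 := by
  by_cases hp : 2 * n ≤ i + 1 + j
  · have heq : upperCoords n i j (S i j) (S (i + 1) (j + 1)) =
        ({t | t.1 < i + 1 ∨ j ≤ t.1} : Finset (Fin (2 * n))) \
          (S i j).map Fin.revPerm.toEmbedding := by
      ext t
      rw [mem_upperCoords, if_pos hp, Finset.mem_sdiff, Finset.mem_map_equiv]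
      simp
    rw [heq, Finset.card_sdiff_of_subset, card_outer_coords hij (by omega), Finset.card_map,
      hS.card_lower hl]
    · omega
    · intro t ht
      rw [Finset.mem_map_equiv] at ht
      have h1 := hS.mem_range hl ht
      rw [Fin.revPerm_symm, Fin.revPerm_apply] at h1
      have := Fin.val_rev t
      rw [Finset.mem_filter]
      refine ⟨Finset.mem_univ _, ?_⟩
      omega
  · have hj : j < 2 * n := by omega
    have h1 := hu (by omega)
    have heq : upperCoords n i j (S i j) (S (i + 1) (j + 1)) =
        insert ⟨j, hj⟩ (S (i + 1) (j + 1)) := by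
      ext t
      rw [mem_upperCoords, if_neg hp, Finset.mem_insert, Fin.ext_iff]
      constructor
      · exact fun h => h.2
      · rintro (h | h)
        · exact ⟨Or.inr h.ge, Or.inl h⟩
        · have := hS.mem_range (fun _ => h1) h
          exact ⟨by omega, Or.inr h⟩
    rw [heq, Finset.card_insert_of_notMem, (hS.at_of i (j + 1) h1).card_eq]
    intro h
    have := hS.mem_range (fun _ => h1) h
    simp only at this
    omega

end ChartCombinatorics

/-! ### Graph projections along the tower -/

section TowerProj

variable {n : ℕ}

/-- The graph projection of `towerUpper`, in terms of those of `A` and `B`: if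
`(i + 1) + j = 2n`, it is `p - P'`, where `p` is the projection to `W_{i+1,j}` and `P'` is the
adjoint of `P` with respect to the symplectic form. -/
def upperProj (n i j : ℕ) (P Q : Matrix (Fin (2 * n)) (Fin (2 * n)) ℂ) :
    Matrix (Fin (2 * n)) (Fin (2 * n)) ℂ :=
  Matrix.of fun r c => if 2 * n ≤ i + 1 + j then
    (if r = c ∧ (r.1 < i + 1 ∨ j ≤ r.1) then 1 else 0) -
      sympSign n r * sympSign n c * P c.rev r.rev
  else Q r c + if r = c ∧ r.1 = j then 1 else 0

/-- The case in which the upper bound is `B ⊕ ⟨w_{j+1}⟩`. -/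
theorem isGraphProj_upperProj_of_lt {i j : ℕ} (hij : i + 1 + j < 2 * n)
    {A B : Submodule ℂ (Fin (2 * n) → ℂ)} {P Q : Matrix (Fin (2 * n)) (Fin (2 * n)) ℂ}
    {S T : Finset (Fin (2 * n))} (hij' : i + 1 ≤ j) (hQ : IsGraphProj Q B T)
    (hB : B ≤ coordSubspace n (i + 1) (j + 1)) :
    IsGraphProj (upperProj n i j P Q) (towerUpper n i j A B) (upperCoords n i j S T) := by
  have hnot : ¬ 2 * n ≤ i + 1 + j := by omega
  have hval : ∀ x t, (upperProj n i j P Q).mulVec x t =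
      Q.mulVec x t + if t.1 = j then x t else 0 := by
    intro x t
    simp only [Matrix.mulVec, dotProduct, upperProj, if_neg hnot, Matrix.of_apply, add_mul,
      Finset.sum_add_distrib, ite_mul, one_mul, zero_mul]
    congr 1
    by_cases h : t.1 = j <;> simp [h]
  have hQ0 : ∀ x (t : Fin (2 * n)), i + 1 ≤ t.1 → t.1 ≤ j → Q.mulVec x t = 0 := fun x t h1 h2 =>
    hB (hQ.mem x) t (by omega) (by omega)
  refine ⟨fun x => ⟨fun t h1 h2 => ?_, ?_⟩, fun x s hs => ?_, fun v hv hvS => ?_⟩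
  · rw [hval, hQ0 x t (by omega) (by omega), if_neg (by omega), add_zero]
  · rw [if_neg hnot]
    change pr n (j + 1) _ ∈ B
    convert hQ.mem x using 1
    ext t
    rw [pr_apply, hval]
    by_cases h : t.1 = j
    · rw [if_pos (by omega), hQ0 x t (by omega) (by omega)]
    · rw [if_neg (by omega), if_neg h, add_zero]
  · rw [mem_upperCoords, if_neg hnot] at hs
    rw [hval]
    by_cases h : s.1 = j
    · rw [hQ0 x s (by omega) (by omega), if_pos h, zero_add]
    · rw [hQ.agree x s (hs.2.resolve_left h), if_neg h, add_zero]
  · have h1 : pr n (j + 1) v ∈ B := by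
      have := hv.2
      rwa [if_neg hnot] at this
    have h0 : ∀ t : Fin (2 * n), (t.1 = j ∨ t ∈ T) → v t = 0 := by
      intro t ht
      by_cases h : t.1 < i + 1 ∨ j ≤ t.1
      · exact hvS t (mem_upperCoords.2 ⟨h, by rwa [if_neg hnot]⟩)
      · exact hv.1 t (by omega) (by omega)
    have h2 := hQ.inj _ h1 fun s hs => by
      rw [pr_apply, h0 s (Or.inr hs), ite_self]
    ext t
    by_cases h : t.1 = j
    · exact h0 t (Or.inl h)
    · have := congrFun h2 t
      rwa [pr_apply, if_neg (by omega)] at this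

/-- The case in which the upper bound is the orthogonal complement of `A` in `W_{i+1,j}`. -/
theorem isGraphProj_upperProj_of_eq {i j : ℕ} (hij : i + 1 + j = 2 * n)
    {A B : Submodule ℂ (Fin (2 * n) → ℂ)} {P Q : Matrix (Fin (2 * n)) (Fin (2 * n)) ℂ}
    {S T : Finset (Fin (2 * n))} (hP : IsGraphProj P A S)
    (hA : A ≤ coordSubspace n (i + 1) j) :
    IsGraphProj (upperProj n i j P Q) (towerUpper n i j A B) (upperCoords n i j S T) := by
  have hle : 2 * n ≤ i + 1 + j := hij.ge
  have hS : ∀ s ∈ S, s.1 < i + 1 ∨ j ≤ s.1 := by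
    intro s hs
    by_contra h
    have h1 := hA (hP.col_mem s) s (by omega) (by omega)
    simp only [hP.apply_of_mem hs, if_true] at h1
    exact one_ne_zero h1
  have hval : ∀ x t, (upperProj n i j P Q).mulVec x t =
      (if t.1 < i + 1 ∨ j ≤ t.1 then x t else 0) -
        ∑ c, sympSign n t * sympSign n c * P c.rev t.rev * x c := by
    intro x t
    simp only [Matrix.mulVec, dotProduct, upperProj, if_pos hle, Matrix.of_apply, sub_mul,
      Finset.sum_sub_distrib, ite_mul, one_mul, zero_mul]
    congr 1
    by_cases h : t.1 < i + 1 ∨ j ≤ t.1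
    · simp only [h, and_true, if_true, Finset.sum_ite_eq, Finset.mem_univ]
    · simp only [h, and_false, if_false, Finset.sum_const_zero]
  have hval' : ∀ x (t : Fin (2 * n)), t.rev ∉ S → (upperProj n i j P Q).mulVec x t =
      if t.1 < i + 1 ∨ j ≤ t.1 then x t else 0 := by
    intro x t ht
    rw [hval, Finset.sum_eq_zero, sub_zero]
    intro c _
    rw [hP.apply_of_notMem ht]
    ring
  have hW : ∀ t : Fin (2 * n), ¬ (t.1 < i + 1 ∨ j ≤ t.1) → t.rev ∉ S := by
    intro t ht h
    have := hS _ h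
    have := Fin.val_rev t
    omega
  refine ⟨fun x => ⟨fun t h1 h2 => ?_, ?_⟩, fun x s hs => ?_, fun v hv hvS => ?_⟩
  · rw [hval' x t (hW t (by omega)), if_neg (by omega)]
  · rw [if_pos hle]
    intro a ha
    -- `⟨a, p x⟩ = ⟨a, x⟩ = ⟨P a, x⟩ = ⟨a, P' x⟩`
    have h1 : ∑ t, sympSign n t * (a t * ∑ c, sympSign n t.rev * sympSign n c *
        P c.rev t * x c) = ∑ t, sympSign n t * (P.mulVec a t * x t.rev) := by
      have h2 : ∀ t, P.mulVec a t = ∑ c, P t c * a c := fun _ => rfl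
      simp only [h2, Finset.mul_sum, Finset.sum_mul]
      rw [Finset.sum_comm]
      refine Fintype.sum_equiv Fin.revPerm _ _ fun c => ?_
      refine Finset.sum_congr rfl fun t _ => ?_
      rw [Fin.revPerm_apply, Fin.rev_rev, sympSign_rev, sympSign_rev]
      linear_combination (-(sympSign n c * P c.rev t * x c * a t)) * sympSign_mul_self t
    rw [sympForm_eq]
    simp only [hval, mul_sub, Finset.sum_sub_distrib, Fin.rev_rev, h1]
    rw [hP.mulVec_eq_self ha, ← Finset.sum_sub_distrib]
    refine Finset.sum_eq_zero fun t _ => ?_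
    have ht := Fin.val_rev t
    split_ifs with h
    · ring
    · rw [hA ha t (by omega) (by omega)]
      ring
  · rw [mem_upperCoords, if_pos hle] at hs
    rw [hval' x s hs.2, if_pos hs.1]
  · have h0 : ∀ t : Fin (2 * n), t.rev ∉ S → v t = 0 := by
      intro t ht
      by_cases h : t.1 < i + 1 ∨ j ≤ t.1
      · exact hvS t (mem_upperCoords.2 ⟨h, by rwa [if_pos hle]⟩)
      · exact hv.1 t (by omega) (by omega)
    ext t
    by_cases ht : t.rev ∈ S
    · have h1 : sympForm n (fun r => P r t.rev) v = 0 := by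
        have := hv.2
        rw [if_pos hle] at this
        exact this _ (hP.col_mem _)
      rw [sympForm_eq, Finset.sum_eq_single t.rev] at h1
      · rw [hP.apply_of_mem ht, if_pos rfl, Fin.rev_rev, one_mul] at h1
        refine (mul_eq_zero.1 h1).resolve_left fun h => ?_
        have := sympSign_mul_self (n := n) t.rev
        rw [h, zero_mul] at this
        exact zero_ne_one this
      · intro s _ hst
        by_cases hs : s ∈ S
        · rw [hP.apply_of_mem hs, if_neg hst]
          ring
        · rw [h0 s.rev (by rwa [Fin.rev_rev])]
          ring
      · simp
    · exact h0 t ht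

/-- If `v` vanishes on `S` and has the coordinate `1` at `p`, then adding `v` to a graph over `S`
gives a graph over `S ∪ {p}`. -/
theorem IsGraphProj.addVector {k : ℕ} {A : Submodule ℂ (Fin k → ℂ)}
    {P : Matrix (Fin k) (Fin k) ℂ} {S : Finset (Fin k)} (hP : IsGraphProj P A S)
    {v : Fin k → ℂ} {p : Fin k} (hv : ∀ s ∈ S, v s = 0) (hvp : v p = 1) :
    IsGraphProj (Matrix.of fun r c => P r c + v r * ((if p = c then 1 else 0) - P p c))
      (A ⊔ Submodule.span ℂ {v}) (insert p S) := by
  have hval : ∀ x, (Matrix.of fun r c => P r c + v r * ((if p = c then 1 else 0) - P p c)).mulVec x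
      = P.mulVec x + (x p - P.mulVec x p) • v := by
    intro x
    ext r
    simp only [Matrix.mulVec, dotProduct, Matrix.of_apply, Pi.add_apply, Pi.smul_apply,
      smul_eq_mul, add_mul, Finset.sum_add_distrib]
    congr 1
    have : ∀ c, v r * ((if p = c then 1 else 0) - P p c) * x c =
        v r * (if p = c then x c else 0) - v r * (P p c * x c) := by
      intro c
      split_ifs <;> ring
    simp only [this, Finset.sum_sub_distrib, ← Finset.mul_sum, Finset.sum_ite_eq,
      Finset.mem_univ, if_true]
    ring
  refine ⟨fun x => ?_, fun x s hs => ?_, fun w hw hwS => ?_⟩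
  · rw [hval]
    exact Submodule.add_mem_sup (hP.mem x)
      (Submodule.smul_mem _ _ (Submodule.mem_span_singleton_self v))
  · rw [hval, Pi.add_apply, Pi.smul_apply, smul_eq_mul]
    rcases Finset.mem_insert.1 hs with rfl | hs
    · rw [hvp]
      ring
    · rw [hv s hs, hP.agree x s hs]
      ring
  · obtain ⟨a, ha, z, hz, rfl⟩ := Submodule.mem_sup.1 hw
    obtain ⟨c, rfl⟩ := Submodule.mem_span_singleton.1 hz
    have ha0 : a = 0 := hP.inj a ha fun s hs => by
      have := hwS s (Finset.mem_insert_of_mem hs)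
      rwa [Pi.add_apply, Pi.smul_apply, hv s hs, smul_zero, add_zero] at this
    have := hwS p (Finset.mem_insert_self _ _)
    rw [ha0, zero_add, Pi.smul_apply, hvp, smul_eq_mul, mul_one] at this
    rw [ha0, this, zero_smul, zero_add]

/-- The charts of the projective line of subspaces between `A` and `B`: each of them is a graph
over `S ∪ {p}` for some `p`, if `A` is a graph over `S`. -/
theorem exists_isGraphOver_insert {k : ℕ} {A V B : Submodule ℂ (Fin k → ℂ)}
    {S T : Finset (Fin k)} (hA : IsGraphOver A S) (hB : IsGraphOver B T)
    (hAV : A ≤ V) (hVB : V ≤ B) (hrank : Module.finrank ℂ V = Module.finrank ℂ A + 1) :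
    ∃ p ∈ T, p ∉ S ∧ IsGraphOver V (insert p S) := by
  obtain ⟨u, hu, huA⟩ := exists_notMem_of_finrank_lt (A := A) (V := V) (by omega)
  have hP := hA.isGraphProj
  -- a vector of `V` outside `A` that vanishes on `S`
  set v := u - (graphProj A S).mulVec u with hvdef
  have hv : v ∈ V := V.sub_mem hu (hAV (hP.mem u))
  have hvS : ∀ s ∈ S, v s = 0 := fun s hs => by
    rw [hvdef, Pi.sub_apply, hP.agree u s hs, sub_self]
  have hv0 : v ≠ 0 := fun h => huA (by
    rw [sub_eq_zero.1 h]
    exact hP.mem u)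
  obtain ⟨p, hpT, hp⟩ : ∃ p ∈ T, v p ≠ 0 := by
    by_contra! h
    exact hv0 (hB.2 v (hVB hv) h)
  have hpS : p ∉ S := fun h => hp (hvS p h)
  refine ⟨p, hpT, hpS, ?_⟩
  have hw := hP.addVector (v := (v p)⁻¹ • v) (p := p)
    (fun s hs => by rw [Pi.smul_apply, hvS s hs, smul_zero])
    (by rw [Pi.smul_apply, smul_eq_mul, inv_mul_cancel₀ hp])
  have hsup : A ⊔ Submodule.span ℂ {(v p)⁻¹ • v} = V := by
    refine eq_sup_span_of_finrank hAV hrank (V.smul_mem _ hv) fun h => ?_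
    exact hv0 (hA.2 v (by
      have := A.smul_mem (v p) h
      rwa [smul_smul, mul_inv_cancel₀ hp, one_smul] at this) hvS)
  rw [hsup] at hw
  exact hw.isGraphOver

variable {D : ℕ → ℕ → Prop} {V : ℕ → ℕ → Submodule ℂ (Fin (2 * n) → ℂ)}
  {S : ℕ → ℕ → Finset (Fin (2 * n))}

theorem TowerOn.isGraphProj_upperProj (hV : TowerOn n D V) {i j : ℕ}
    (hij : i + 1 ≤ j) (hij' : i + 1 + j ≤ 2 * n) (hl : 1 ≤ i → D i j)
    (hu : i + 1 + j < 2 * n → D (i + 1) (j + 1)) {P Q : Matrix (Fin (2 * n)) (Fin (2 * n)) ℂ}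
    {S T : Finset (Fin (2 * n))} (hP : IsGraphProj P (V i j) S)
    (hQ : i + 1 + j < 2 * n → IsGraphProj Q (V (i + 1) (j + 1)) T) :
    IsGraphProj (upperProj n i j P Q) (towerUpper n i j (V i j) (V (i + 1) (j + 1)))
      (upperCoords n i j S T) := by
  rcases hij'.lt_or_eq with h | h
  · exact isGraphProj_upperProj_of_lt h hij (hQ h) (hV.le_coordSubspace fun _ => hu h)
  · exact isGraphProj_upperProj_of_eq h hP
      ((hV.le_coordSubspace hl).trans (coordSubspace_mono (by omega) le_rfl))

/-- Every point of the tower lies in one of the charts. -/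
theorem TowerOn.exists_chartOn (hD : IsLowerDomain n D) (hV : TowerOn n D V) :
    ∃ S, ChartOn n D S ∧ ∀ i j, (1 ≤ i → D i j) → IsGraphOver (V i j) (S i j) := by
  obtain ⟨S, hS0, hS⟩ := exists_tower_family (2 * n) (∅ : Finset (Fin (2 * n)))
    fun i j a b x => x.card = i + 1 ∧ a ⊆ x ∧ x ⊆ upperCoords n i j a b ∧
      IsGraphOver (V (i + 1) j) x
  have hgraph : ∀ D' : ℕ → ℕ → Prop,
      (∀ i j, D' (i + 1) j → ChartAt n S i j ∧ IsGraphOver (V (i + 1) j) (S (i + 1) j)) →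
      ∀ i j, (1 ≤ i → D' i j) → IsGraphOver (V i j) (S i j) := by
    intro D' h i j hij
    cases i with
    | zero => rw [hV.zero, hS0]; exact isGraphOver_bot
    | succ i => exact (h i j (hij (by omega))).2
  have key : ∀ i j, D (i + 1) j → ChartAt n S i j ∧ IsGraphOver (V (i + 1) j) (S (i + 1) j) := by
    refine hD.induction fun D' hD' hsub ih i j hij hl hu => ?_
    have hC : ChartOn n D' S := ⟨hS0, fun i j h => (ih i j h).1⟩
    have hV' : TowerOn n D' V := ⟨hV.zero, fun i j h => hV.at_of i j (hsub i j h)⟩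
    obtain ⟨hle, hle'⟩ := hD.le i j hij
    have hat := hV.at_of i j hij
    have hA := hgraph D' ih i j hl
    have hproj := hV'.isGraphProj_upperProj hle hle' hl hu hA.isGraphProj
      fun h => (hgraph D' ih (i + 1) (j + 1) fun _ => hu h).isGraphProj
    obtain ⟨p, hpT, hpS, hp⟩ := exists_isGraphOver_insert hA hproj.isGraphOver hat.lower hat.upper
      (by rw [hat.finrank_eq, hV'.finrank_lower hl])
    have := hS i j (by omega) ⟨insert p (S i j), by
      rw [Finset.card_insert_of_notMem hpS, hC.card_lower hl], Finset.subset_insert _ _,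
      Finset.insert_subset hpT (hC.lower_subset_upper hD' hle hle' hl hu), hp⟩
    exact ⟨⟨this.1, this.2.1, this.2.2.1⟩, this.2.2.2⟩
  exact ⟨S, ⟨hS0, fun i j h => (key i j h).1⟩, hgraph D key⟩

end TowerProj

/-! ### Collections labelled by families of roots -/

section Varieties

variable {n : ℕ} {ι : Type}

/-- The collections of subspaces `V_{r a}`, where `r` is a family of roots, with
`dim V_{i,j} = i`. -/
abbrev FamGr (r : ι → Root n) : Type := MultiGr (ι := ι) (fun _ => 2 * n) (fun a => (r a).i)

/-- The index pairs of a family of roots. -/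
def rootDomain (r : ι → Root n) (i j : ℕ) : Prop := ∃ a, (r a).i = i ∧ (r a).j = j

open Classical in
/-- A collection of subspaces labelled by a family of roots, extended by zero to all indices. -/
def extendZero (r : ι → Root n) (V : FamGr r) (i j : ℕ) : Submodule ℂ (Fin (2 * n) → ℂ) :=
  if h : rootDomain r i j then V.space h.choose else ⊥

theorem Root.ext_ij {α β : Root n} (hi : α.i = β.i) (hj : α.j = β.j) : α = β :=
  Subtype.ext (Prod.ext (Fin.ext hi) (Fin.ext hj))

theorem extendZero_apply {r : ι → Root n} (hr : Function.Injective r) (V : FamGr r) (a : ι) :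
    extendZero r V (r a).i (r a).j = V.space a := by
  have h : rootDomain r (r a).i (r a).j := ⟨a, rfl, rfl⟩
  rw [extendZero, dif_pos h]
  congr 1
  exact hr (Root.ext_ij h.choose_spec.1 h.choose_spec.2)

theorem extendZero_eq {r : ι → Root n} (hr : Function.Injective r) (V : FamGr r) {a : ι} {i j : ℕ}
    (hi : (r a).i = i) (hj : (r a).j = j) : extendZero r V i j = V.space a := by
  subst hi hj
  exact extendZero_apply hr V a

theorem extendZero_zero (r : ι → Root n) (V : FamGr r) (j : ℕ) : extendZero r V 0 j = ⊥ := by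
  rw [extendZero, dif_neg]
  rintro ⟨a, ha, -⟩
  have := (r a).2.1
  unfold Root.i at ha
  omega

/-- The conditions of `SpR_{2n}` for the members of a family of roots. -/
def towerSet (r : ι → Root n) : Set (FamGr r) :=
  {V | (∀ a, V.space a ≤ coordSubspace n (r a).i (r a).j) ∧
    (∀ a b, (r b).i = (r a).i + 1 → (r b).j = (r a).j → V.space a ≤ V.space b) ∧
    (∀ a b, (r b).i = (r a).i → (r b).j = (r a).j + 1 →
      (V.space a).map (pr n ((r a).j + 1)) ≤ V.space b) ∧
    (∀ a, (r a).i + (r a).j = 2 * n → IsIsotropic n (V.space a))}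

/-- The conditions of `SpR_{2n}` say that each `V_{i+1,j}` lies between the bounds given by its
predecessors. The isotropy of `V_{i+1,j}`, for `(i + 1) + j = 2n`, is the same as orthogonality to
its isotropic hyperplane `V_{i,j}`. -/
theorem mem_towerSet_iff {r : ι → Root n} (hr : Function.Injective r)
    (hD : IsLowerDomain n (rootDomain r)) {V : FamGr r} :
    V ∈ towerSet r ↔ TowerOn n (rootDomain r) (extendZero r V) := by
  constructor
  · rintro ⟨h1, h2, h3, h4⟩
    refine ⟨extendZero_zero r V, ?_⟩
    rintro i j ⟨a, hi, hj⟩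
    have hlow : extendZero r V i j ≤ extendZero r V (i + 1) j := by
      cases i with
      | zero => rw [extendZero_zero]; exact bot_le
      | succ i =>
        obtain ⟨b, hbi, hbj⟩ := hD.left i j ⟨a, hi, hj⟩
        rw [extendZero_eq hr V hi hj, extendZero_eq hr V hbi hbj]
        exact h2 b a (by omega) (by omega)
    refine ⟨?_, hlow, le_inf ?_ ?_⟩
    · rw [extendZero_eq hr V hi hj, V.finrank_eq, hi]
    · rw [extendZero_eq hr V hi hj, ← hi, ← hj]
      exact h1 a
    · split_ifs with hp
      · have := h4 a (by have := (hD.le i j ⟨a, hi, hj⟩).2; omega)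
        intro y hy x hx
        have hx' := hlow hx
        rw [extendZero_eq hr V hi hj] at hx' hy
        exact this x hx' y hy
      · obtain ⟨b, hbi, hbj⟩ := hD.up i j ⟨a, hi, hj⟩ (by omega)
        rw [extendZero_eq hr V hi hj, extendZero_eq hr V hbi hbj, ← Submodule.map_le_iff_le_comap,
          ← hj]
        exact h3 a b (by omega) (by omega)
  · intro h
    have hpos : ∀ a, ∃ i, (r a).i = i + 1 := fun a =>
      Nat.exists_eq_add_of_le' (r a).2.1
    have hat : ∀ a i, (r a).i = i + 1 → TowerAt n (extendZero r V) i (r a).j := fun a i hi =>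
      h.at_of i _ ⟨a, hi, rfl⟩
    refine ⟨fun a => ?_, fun a b hi hj => ?_, fun a b hi hj => ?_, fun a ha => ?_⟩
    · rw [← extendZero_apply hr]
      exact h.le_coordSubspace fun _ => ⟨a, rfl, rfl⟩
    · have := (hat b (r a).i hi).lower
      rw [← hi, extendZero_apply hr, hj, extendZero_apply hr] at this
      exact this
    · obtain ⟨i, hi'⟩ := hpos a
      have h1 := (r b).2.2.2
      have := (hat a i hi').map_pr_le (by unfold Root.i Root.j at *; omega)
      rw [extendZero_eq hr V hi' rfl, extendZero_eq hr V (hi.trans hi') hj] at this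
      exact this
    · obtain ⟨i, hi'⟩ := hpos a
      rw [← extendZero_eq hr V hi' rfl]
      exact h.isIsotropic hD ⟨a, hi', rfl⟩ (by omega)

theorem isClosed_towerSet (r : ι → Root n) : IsClosed (towerSet r) := by
  have h1 : towerSet r =
      (⋂ a, {V : FamGr r | V.space a ≤ coordSubspace n (r a).i (r a).j}) ∩
      ((⋂ a, ⋂ b, ⋂ (_ : (r b).i = (r a).i + 1), ⋂ (_ : (r b).j = (r a).j),
        {V : FamGr r | (V.space a).map LinearMap.id ≤ V.space b}) ∩
      ((⋂ a, ⋂ b, ⋂ (_ : (r b).i = (r a).i), ⋂ (_ : (r b).j = (r a).j + 1),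
        {V : FamGr r | (V.space a).map (pr n ((r a).j + 1)) ≤ V.space b}) ∩
      (⋂ a, ⋂ (_ : (r a).i + (r a).j = 2 * n),
        {V : FamGr r | ∀ v ∈ V.space a, ∀ w ∈ V.space a, sympBilin n v w = 0}))) := by
    ext V
    simp only [towerSet, IsIsotropic, Set.mem_ofPred_eq, Set.mem_inter_iff, Set.mem_iInter,
      Submodule.map_id, sympBilin_apply]
  rw [h1]
  refine IsClosed.inter (isClosed_iInter fun a => ?_) (IsClosed.inter ?_ (IsClosed.inter ?_ ?_))
  · have h2 : coordSubspace n (r a).i (r a).j = LinearMap.ker (LinearMap.pi fun t : Fin (2 * n) =>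
        if (r a).i < t.1 + 1 ∧ t.1 + 1 ≤ (r a).j then LinearMap.proj (R := ℂ) t else 0) := by
      ext x
      rw [mem_coordSubspace, LinearMap.mem_ker, funext_iff]
      refine forall_congr' fun t => ?_
      rw [LinearMap.pi_apply]
      split_ifs with h
      · exact ⟨fun h' => h' h.1 h.2, fun h' _ _ => h'⟩
      · exact ⟨fun _ => rfl, fun _ h1 h2 => absurd ⟨h1, h2⟩ h⟩
    rw [h2]
    exact isClosed_setOf_le_ker _
  · exact isClosed_iInter fun a => isClosed_iInter fun b => isClosed_iInter fun _ =>
      isClosed_iInter fun _ => isClosed_setOf_map_le _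
  · exact isClosed_iInter fun a => isClosed_iInter fun b => isClosed_iInter fun _ =>
      isClosed_iInter fun _ => isClosed_setOf_map_le _
  · exact isClosed_iInter fun a => isClosed_iInter fun _ => isClosed_setOf_bilin_eq_zero _

end Varieties

/-! ### Completion of partial collections -/

section Intermediate

theorem exists_intermediate_subspace {k : ℕ} {A B : Submodule ℂ (Fin k → ℂ)} (hAB : A ≤ B)
    {e : ℕ} (he : Module.finrank ℂ A ≤ e) (he' : e ≤ Module.finrank ℂ B) :
    ∃ V, A ≤ V ∧ V ≤ B ∧ Module.finrank ℂ V = e := by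
  induction e, he using Nat.le_induction with
  | base => exact ⟨A, le_rfl, hAB, rfl⟩
  | succ e he ih =>
    obtain ⟨V, hAV, hVB, hV⟩ := ih (by omega)
    obtain ⟨v, hv, hvV⟩ := exists_notMem_of_finrank_lt (A := V) (V := B) (by omega)
    exact ⟨V ⊔ Submodule.span ℂ {v}, hAV.trans le_sup_left,
      sup_le hVB ((Submodule.span_singleton_le_iff_mem _ _).2 hv),
      by rw [Submodule.finrank_sup_span_singleton hvV, hV]⟩

end Intermediate

section Extension

variable {n : ℕ} {D : ℕ → ℕ → Prop} {V V' : ℕ → ℕ → Submodule ℂ (Fin (2 * n) → ℂ)}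

theorem TowerOn.finrank_towerUpper (hD : IsLowerDomain n D) (hV : TowerOn n D V) {i j : ℕ}
    (hij : i + 1 ≤ j) (hij' : i + 1 + j ≤ 2 * n) (hl : 1 ≤ i → D i j)
    (hu : i + 1 + j < 2 * n → D (i + 1) (j + 1)) :
    Module.finrank ℂ (towerUpper n i j (V i j) (V (i + 1) (j + 1))) = i + 2 := by
  obtain ⟨S, hS, hVS⟩ := hV.exists_chartOn hD
  rw [← hS.card_upperCoords hij hij' hl hu]
  exact (hV.isGraphProj_upperProj hij hij' hl hu (hVS i j hl).isGraphProj
    fun h => (hVS (i + 1) (j + 1) fun _ => hu h).isGraphProj).isGraphOver.1.symm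

theorem towerUpper_congr {i j : ℕ} {A B B' : Submodule ℂ (Fin (2 * n) → ℂ)}
    (h : i + 1 + j < 2 * n → B = B') : towerUpper n i j A B = towerUpper n i j A B' := by
  unfold towerUpper
  split_ifs with hp
  · rfl
  · rw [h (by omega)]

theorem TowerAt.congr {i j : ℕ} (h : TowerAt n V i j) (h1 : V' i j = V i j)
    (h2 : V' (i + 1) j = V (i + 1) j)
    (h3 : i + 1 + j < 2 * n → V' (i + 1) (j + 1) = V (i + 1) (j + 1)) : TowerAt n V' i j where
  finrank_eq := by rw [h2, h.finrank_eq]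
  lower := by rw [h1, h2]; exact h.lower
  upper := by rw [h1, h2, towerUpper_congr h3]; exact h.upper

theorem TowerOn.congr (hD : IsLowerDomain n D) (hV : TowerOn n D V)
    (h : ∀ i j, (1 ≤ i → D i j) → V' i j = V i j) : TowerOn n D V' where
  zero j := by rw [h 0 j (by omega), hV.zero]
  at_of i j hij := by
    refine (hV.at_of i j hij).congr (h i j fun hi => ?_) (h _ j fun _ => hij)
      fun hu => h _ _ fun _ => hD.up i j hij hu
    obtain ⟨i, rfl⟩ := Nat.exists_eq_add_of_le' hi
    exact hD.left i j hij

/-- A construction of collections in `SpR_{2n}` in which `V_{i+1,j}` is chosen, step by step, with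
a given property. -/
theorem exists_towerOn (hD : IsLowerDomain n D)
    (Φ : ℕ → ℕ → Submodule ℂ (Fin (2 * n) → ℂ) → Prop)
    (hΦ : ∀ D' V, IsLowerDomain n D' → TowerOn n D' V → (∀ i j, D' (i + 1) j → D (i + 1) j) →
      (∀ i j, D' (i + 1) j → Φ (i + 1) j (V (i + 1) j)) → ∀ i j, D (i + 1) j →
      (1 ≤ i → D' i j) → (i + 1 + j < 2 * n → D' (i + 1) (j + 1)) →
      ∃ X : Submodule ℂ (Fin (2 * n) → ℂ), Module.finrank ℂ X = i + 1 ∧ V i j ≤ X ∧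
        X ≤ towerUpper n i j (V i j) (V (i + 1) (j + 1)) ∧ Φ (i + 1) j X) :
    ∃ V, TowerOn n D V ∧ ∀ i j, D (i + 1) j → Φ (i + 1) j (V (i + 1) j) := by
  obtain ⟨V, hV0, hV⟩ := exists_tower_family (2 * n) (⊥ : Submodule ℂ (Fin (2 * n) → ℂ))
    fun i j A B X => Module.finrank ℂ X = i + 1 ∧ A ≤ X ∧ X ≤ towerUpper n i j A B ∧
      Φ (i + 1) j X
  have key : ∀ i j, D (i + 1) j → TowerAt n V i j ∧ Φ (i + 1) j (V (i + 1) j) := by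
    refine hD.induction fun D' hD' hsub ih i j hij hl hu => ?_
    obtain ⟨h1, h2, h3, h4⟩ := hV i j (by have := hD.le i j hij; omega)
      (hΦ D' V hD' ⟨hV0, fun i j h => (ih i j h).1⟩ hsub (fun i j h => (ih i j h).2) i j hij hl hu)
    exact ⟨⟨h1, h2, h3⟩, h4⟩
  exact ⟨V, ⟨hV0, fun i j h => (key i j h).1⟩, fun i j h => (key i j h).2⟩

/-- A partial collection can be completed. -/
theorem TowerOn.exists_extension {D₁ : ℕ → ℕ → Prop} (hD₁ : IsLowerDomain n D₁)
    (hD : IsLowerDomain n D) (hV : TowerOn n D V) :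
    ∃ V', TowerOn n D₁ V' ∧ ∀ i j, D₁ (i + 1) j → D (i + 1) j → V' (i + 1) j = V (i + 1) j := by
  refine exists_towerOn hD₁ (fun i j X => D i j → X = V i j) ?_
  intro D' V' hD' hV' _ hΦ i j hij hl hu
  obtain ⟨hle, hle'⟩ := hD₁.le i j hij
  by_cases hDij : D (i + 1) j
  · have hat := hV.at_of i j hDij
    have h1 : V' i j = V i j := by
      cases i with
      | zero => rw [hV.zero, hV'.zero]
      | succ i => exact hΦ i j (hl (by omega)) (hD.left i j hDij)
    refine ⟨V (i + 1) j, hat.finrank_eq, h1.le.trans hat.lower, ?_, fun _ => rfl⟩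
    rw [h1, towerUpper_congr fun h => hΦ i (j + 1) (hu h) (hD.up i j hDij h)]
    exact hat.upper
  · obtain ⟨X, h1, h2, h3⟩ := exists_intermediate_subspace
      (hV'.lower_le_upper hD' hle hle' hl hu) (e := i + 1)
      (by rw [hV'.finrank_lower hl]; omega)
      (by rw [hV'.finrank_towerUpper hD' hle hle' hl hu]; omega)
    exact ⟨X, h3, h1, h2, fun h => absurd h hDij⟩

end Extension

/-! ### The order of the roots -/

section Order

variable {n : ℕ}

/-- The root `α_{i,j}`. -/
def mkRoot {i j : ℕ} (h : fullDomain n i j) : Root n :=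
  ⟨(⟨i, by unfold fullDomain at h; omega⟩, ⟨j, by unfold fullDomain at h; omega⟩), h⟩

theorem Root.fullDomain (α : Root n) : fullDomain n α.i α.j := α.2

theorem Root.Precedes.trans {α β γ : Root n} (h : α.Precedes β) (h' : β.Precedes γ) :
    α.Precedes γ := by
  unfold Root.Precedes at *
  omega

theorem Root.not_precedes_self (α : Root n) : ¬ α.Precedes α := by
  unfold Root.Precedes
  omega

theorem Root.Precedes.pos_lt {α β : Root n} (h : α.Precedes β) : α.pos < β.pos := by
  refine Finset.card_lt_card ((Finset.ssubset_iff_of_subset fun γ hγ => ?_).2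
    ⟨α, by simpa using h, by simp [α.not_precedes_self]⟩)
  rw [Finset.mem_filter] at hγ ⊢
  exact ⟨hγ.1, hγ.2.trans h⟩

theorem Root.pos_injective : Function.Injective (Root.pos (n := n)) := by
  intro α β h
  by_contra hne
  have h1 : ¬ α.Precedes β := fun h' => h'.pos_lt.ne h
  have h2 : ¬ β.Precedes α := fun h' => h'.pos_lt.ne h.symm
  have h3 := α.fullDomain
  have h4 := β.fullDomain
  refine hne (Root.ext_ij ?_ ?_) <;> unfold Root.Precedes _root_.fullDomain at * <;> omega

theorem Root.pos_lt_card (α : Root n) : α.pos < Fintype.card (Root n) := by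
  rw [← Finset.card_univ]
  refine Finset.card_lt_card ((Finset.ssubset_iff_of_subset (Finset.subset_univ _)).2
    ⟨α, Finset.mem_univ _, by simp [α.not_precedes_self]⟩)

/-- The positive roots correspond to the entries of a square matrix of size `n`: the roots
`α_{i,j}` with `j ≤ n` to the entries on and above the diagonal, the others to those below. -/
def rootEquiv (n : ℕ) : Root n ≃ Fin n × Fin n where
  toFun α := if h : α.j ≤ n then
      (⟨α.i - 1, by have := α.fullDomain; unfold fullDomain at this; omega⟩,
        ⟨α.j - 1, by have := α.fullDomain; unfold fullDomain at this; omega⟩)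
    else (⟨2 * n - α.j, by have := α.fullDomain; unfold fullDomain at this; omega⟩,
        ⟨α.i - 1, by have := α.fullDomain; unfold fullDomain at this; omega⟩)
  invFun x := if h : x.1.1 ≤ x.2.1 then
      mkRoot (i := x.1.1 + 1) (j := x.2.1 + 1) (by unfold fullDomain; omega)
    else mkRoot (i := x.2.1 + 1) (j := 2 * n - x.1.1) (by unfold fullDomain; omega)
  left_inv α := by
    have h1 := α.fullDomain
    unfold fullDomain at h1
    by_cases h : α.j ≤ n
    · simp only [dif_pos h]
      rw [dif_pos (by omega)]
      exact Root.ext_ij (by simp only [Root.i, mkRoot] at *; omega)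
        (by simp only [Root.j, mkRoot] at *; omega)
    · simp only [dif_neg h]
      rw [dif_neg (by omega)]
      exact Root.ext_ij (by simp only [Root.i, mkRoot] at *; omega)
        (by simp only [Root.j, mkRoot] at *; omega)
  right_inv x := by
    obtain ⟨a, b⟩ := x
    by_cases h : a.1 ≤ b.1
    · simp only [h, dif_pos]
      rw [dif_pos (by simp only [Root.j, mkRoot]; omega)]
      simp [mkRoot, Root.i, Root.j]
    · simp only [h, dif_neg, not_false_eq_true]
      rw [dif_neg (by simp only [Root.j, mkRoot]; omega)]
      refine Prod.ext (Fin.ext ?_) (Fin.ext ?_)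
      · simp only [mkRoot, Root.j]
        omega
      · simp only [mkRoot, Root.i]
        omega

theorem card_root (n : ℕ) : Fintype.card (Root n) = n ^ 2 := by
  rw [Fintype.card_congr (rootEquiv n), Fintype.card_prod, Fintype.card_fin, sq]

theorem Root.pos_lt (α : Root n) : α.pos < n ^ 2 := card_root n ▸ α.pos_lt_card

theorem exists_root_pos_eq {l : ℕ} (hl : l < n ^ 2) : ∃ α : Root n, α.pos = l := by
  have h : Function.Bijective fun α : Root n => (⟨α.pos, α.pos_lt⟩ : Fin (n ^ 2)) := by
    rw [Fintype.bijective_iff_injective_and_card, card_root, Fintype.card_fin]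
    exact ⟨fun α β h => Root.pos_injective (Fin.ext_iff.1 h), rfl⟩
  obtain ⟨α, hα⟩ := h.2 ⟨l, hl⟩
  exact ⟨α, Fin.ext_iff.1 hα⟩

/-- The family of the first `l` roots. -/
abbrev stepRoot (n l : ℕ) : {α : Root n // α.pos < l} → Root n := fun a => a.1

theorem stepRoot_injective (n l : ℕ) : Function.Injective (stepRoot n l) :=
  Subtype.val_injective

theorem rootDomain_stepRoot {l i j : ℕ} (h : fullDomain n i j) :
    rootDomain (stepRoot n l) i j ↔ (mkRoot h).pos < l := by
  constructor
  · rintro ⟨a, hi, hj⟩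
    rw [show mkRoot h = a.1 from Root.ext_ij hi.symm hj.symm]
    exact a.2
  · exact fun h' => ⟨⟨_, h'⟩, rfl, rfl⟩

theorem fullDomain_of_rootDomain {ι : Type} {r : ι → Root n} {i j : ℕ} (h : rootDomain r i j) :
    fullDomain n i j := by
  obtain ⟨a, rfl, rfl⟩ := h
  exact (r a).fullDomain

theorem mkRoot_left_precedes {i j : ℕ} (h : fullDomain n (i + 1) j) (h' : fullDomain n i j) :
    (mkRoot h').Precedes (mkRoot h) := by
  unfold Root.Precedes Root.i Root.j mkRoot fullDomain at *
  simp only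
  omega

theorem mkRoot_up_precedes {i j : ℕ} (h : fullDomain n i j) (h' : fullDomain n i (j + 1)) :
    (mkRoot h').Precedes (mkRoot h) := by
  unfold Root.Precedes Root.i Root.j mkRoot fullDomain at *
  simp only
  omega

theorem isLowerDomain_stepRoot (n l : ℕ) : IsLowerDomain n (rootDomain (stepRoot n l)) where
  le i j h := (isLowerDomain_fullDomain n).le i j (fullDomain_of_rootDomain h)
  left i j h := by
    have h1 := fullDomain_of_rootDomain h
    have h2 := (isLowerDomain_fullDomain n).left i j h1
    rw [rootDomain_stepRoot h2]
    exact (mkRoot_left_precedes h1 h2).pos_lt.trans ((rootDomain_stepRoot h1).1 h)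
  up i j h h' := by
    have h1 := fullDomain_of_rootDomain h
    have h2 := (isLowerDomain_fullDomain n).up i j h1 h'
    rw [rootDomain_stepRoot h2]
    exact (mkRoot_up_precedes h1 h2).pos_lt.trans ((rootDomain_stepRoot h1).1 h)

theorem rootDomain_id : rootDomain (fun α : Root n => α) = fullDomain n := by
  ext i j
  exact ⟨fullDomain_of_rootDomain, fun h => ⟨mkRoot h, rfl, rfl⟩⟩

theorem isLowerDomain_id (n : ℕ) : IsLowerDomain n (rootDomain fun α : Root n => α) :=
  rootDomain_id ▸ isLowerDomain_fullDomain n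

end Order

/-! ### The varieties of the tower -/

section Steps

variable {n : ℕ} {ι : Type}

/-- The collection of subspaces given by a solution of the conditions of `SpR_{2n}`. -/
def TowerOn.toFamGr {r : ι → Root n} {V : ℕ → ℕ → Submodule ℂ (Fin (2 * n) → ℂ)}
    (hV : TowerOn n (rootDomain r) V) : FamGr r where
  space a := V (r a).i (r a).j
  finrank_eq a := hV.finrank_lower fun _ => ⟨a, rfl, rfl⟩

theorem TowerOn.extendZero_toFamGr {r : ι → Root n} (hr : Function.Injective r)
    {V : ℕ → ℕ → Submodule ℂ (Fin (2 * n) → ℂ)} (hV : TowerOn n (rootDomain r) V) (i j : ℕ)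
    (h : 1 ≤ i → rootDomain r i j) : extendZero r hV.toFamGr i j = V i j := by
  cases i with
  | zero => rw [extendZero_zero, hV.zero]
  | succ i =>
    obtain ⟨a, hi, hj⟩ := h (by omega)
    rw [extendZero_eq hr _ hi hj, ← hi, ← hj]
    rfl

theorem TowerOn.toFamGr_mem {r : ι → Root n} (hr : Function.Injective r)
    (hD : IsLowerDomain n (rootDomain r)) {V : ℕ → ℕ → Submodule ℂ (Fin (2 * n) → ℂ)}
    (hV : TowerOn n (rootDomain r) V) : hV.toFamGr ∈ towerSet r :=
  (mem_towerSet_iff hr hD).2 (hV.congr hD (hV.extendZero_toFamGr hr))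

theorem SpR_eq_towerSet (n : ℕ) : SpR n = towerSet fun α : Root n => α := rfl

/-- The image of `SpR_{2n}` is given by the conditions on the first `l` roots, since every solution
of these can be completed. -/
theorem SpRStep_eq_towerSet (n l : ℕ) : SpRStep n l = towerSet (stepRoot n l) := by
  apply Set.Subset.antisymm
  · rintro _ ⟨V, ⟨h1, h2, h3, h4⟩, rfl⟩
    exact ⟨fun a => h1 a.1, fun a b => h2 a.1 b.1, fun a b => h3 a.1 b.1, fun a => h4 a.1⟩
  · intro V hV
    have hD := isLowerDomain_stepRoot n l
    rw [mem_towerSet_iff (stepRoot_injective n l) hD] at hV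
    obtain ⟨V', hV', hext⟩ := hV.exists_extension (isLowerDomain_id n) hD
    refine ⟨hV'.toFamGr, hV'.toFamGr_mem Function.injective_id (isLowerDomain_id n), ?_⟩
    refine MultiGr.ext (funext fun a => ?_)
    obtain ⟨i, hi⟩ := Nat.exists_eq_add_of_le' a.1.2.1
    have h1 := hext i a.1.j ⟨a.1, hi, rfl⟩ ⟨a, hi, rfl⟩
    rw [extendZero_eq (stepRoot_injective n l) V (a := a) hi rfl] at h1
    rw [← h1, ← hi]
    rfl

theorem isClosed_SpR (n : ℕ) : IsClosed (SpR n) := isClosed_towerSet _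

theorem isClosed_SpRStep (n l : ℕ) : IsClosed (SpRStep n l) := by
  rw [SpRStep_eq_towerSet]
  exact isClosed_towerSet _

theorem isClosed_SpFlag (n : ℕ) : IsClosed (SpFlag n) := by
  have h : SpFlag n = (⋂ i : Fin n, {V : FlagGr n | ∀ v ∈ V.space i, ∀ w ∈ V.space i,
      (sympBilin n).compl₁₂ (prOuter n (i.1 + 1)) (prOuter n (i.1 + 1)) v w = 0}) ∩
      ⋂ i : Fin n, ⋂ i' : Fin n, ⋂ (_ : i'.1 = i.1 + 1),
        {V : FlagGr n | (V.space i).map (pr n (i'.1 + 1)) ≤ V.space i'} := by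
    ext V
    simp only [SpFlag, IsIsotropic, Set.mem_ofPred_eq, Set.mem_inter_iff, Set.mem_iInter,
      LinearMap.compl₁₂_apply, sympBilin_apply, Submodule.mem_map, forall_exists_index, and_imp,
      forall_apply_eq_imp_iff₂]
  rw [h]
  exact (isClosed_iInter fun i => isClosed_setOf_bilin_eq_zero _).inter
    (isClosed_iInter fun i => isClosed_iInter fun i' => isClosed_iInter fun _ =>
      isClosed_setOf_map_le _)

theorem SpR_nonempty (n : ℕ) : (SpR n).Nonempty := by
  obtain ⟨V, hV, -⟩ := TowerOn.exists_extension (isLowerDomain_id n)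
    (D := fun _ _ => False) (V := fun _ _ => ⊥) ⟨nofun, nofun, nofun⟩ ⟨fun _ => rfl, nofun⟩
  exact ⟨_, hV.toFamGr_mem Function.injective_id (isLowerDomain_id n)⟩

theorem SpRStep_zero (n : ℕ) : ∃ P, SpRStep n 0 = {P} := by
  obtain ⟨V, hV⟩ := SpR_nonempty n
  refine ⟨toStep n 0 V, Set.eq_singleton_iff_unique_mem.2 ⟨⟨V, hV, rfl⟩, fun X _ => ?_⟩⟩
  exact MultiGr.ext (funext fun a => absurd a.2 (Nat.not_lt_zero _))

theorem isRegularMapOn_toStep (n l : ℕ) : IsRegularMapOn (toStep n l) (SpR n) (SpRStep n l) :=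
  IsRegularMapOn.of_isRegularSubspaceOn (fun V hV => ⟨V, hV, rfl⟩)
    fun a => isRegularSubspaceOn_space a.1 _

theorem isRegularMapOn_stepMap (n l : ℕ) :
    IsRegularMapOn (stepMap n l) (SpRStep n (l + 1)) (SpRStep n l) :=
  IsRegularMapOn.of_isRegularSubspaceOn (by
    rintro _ ⟨V, hV, rfl⟩
    exact ⟨V, hV, rfl⟩)
    fun a => isRegularSubspaceOn_space (m := fun _ : {α : Root n // α.pos < l + 1} => 2 * n) _ _

/-- The last variety of the tower is isomorphic to `SpR_{2n}`. -/
theorem exists_isIsoOn_toStep (n : ℕ) :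
    ∃ G, IsIsoOn (toStep n (n ^ 2)) G (SpR n) (SpRStep n (n ^ 2)) := by
  refine ⟨fun V => ⟨fun α => V.space ⟨α, α.pos_lt⟩, fun α => V.finrank_eq ⟨α, α.pos_lt⟩⟩,
    isRegularMapOn_toStep n _, IsRegularMapOn.of_isRegularSubspaceOn ?_ fun α =>
      isRegularSubspaceOn_space (m := fun _ : {α : Root n // α.pos < n ^ 2} => 2 * n) _ _,
    fun V _ => rfl, fun V _ => rfl⟩
  rintro _ ⟨V, hV, rfl⟩
  exact hV

end Steps

/-! ### The projective line of subspaces between `A` and `B` -/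

section Pencil

variable {k : ℕ}

/-- The linear map `ℂ² → ℂ ^ k` with image the span of the columns `p` and `q` of `R`. -/
def pencilMap (R : Matrix (Fin k) (Fin k) ℂ) (p q : Fin k) : (Fin 2 → ℂ) →ₗ[ℂ] (Fin k → ℂ) where
  toFun z r := z 0 * R r p + z 1 * R r q
  map_add' z z' := by
    ext r
    simp only [Pi.add_apply]
    ring
  map_smul' c z := by
    ext r
    simp only [Pi.smul_apply, smul_eq_mul, RingHom.id_apply]
    ring

theorem pencilMap_apply (R : Matrix (Fin k) (Fin k) ℂ) (p q : Fin k) (z : Fin 2 → ℂ) (r : Fin k) :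
    pencilMap R p q z r = z 0 * R r p + z 1 * R r q := rfl

theorem pencilMap_eq_mulVec (R : Matrix (Fin k) (Fin k) ℂ) (p q : Fin k) (z : Fin 2 → ℂ) :
    pencilMap R p q z = R.mulVec (z 0 • Pi.single p 1 + z 1 • Pi.single q 1) := by
  rw [Matrix.mulVec_add, Matrix.mulVec_smul, Matrix.mulVec_smul, Matrix.mulVec_single_one,
    Matrix.mulVec_single_one]
  rfl

/-- `A ≤ B` are graphs over `S` and over `S ∪ {p, q}`. Then `B` is the direct sum of `A` and the
image of `pencilMap R p q`, and the subspaces between `A` and `B` correspond to those of `ℂ²`. -/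
structure IsPencil (P R : Matrix (Fin k) (Fin k) ℂ) (A B : Submodule ℂ (Fin k → ℂ))
    (S : Finset (Fin k)) (p q : Fin k) : Prop where
  lower : IsGraphProj P A S
  upper : IsGraphProj R B (insert p (insert q S))
  le : A ≤ B
  ne : p ≠ q
  left_notMem : p ∉ S
  right_notMem : q ∉ S

namespace IsPencil

variable {P R : Matrix (Fin k) (Fin k) ℂ} {A B V : Submodule ℂ (Fin k → ℂ)}
  {S : Finset (Fin k)} {p q : Fin k}

theorem pencilMap_mem (h : IsPencil P R A B S p q) (z : Fin 2 → ℂ) : pencilMap R p q z ∈ B := by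
  rw [pencilMap_eq_mulVec]
  exact h.upper.mem _

theorem pencilMap_left (h : IsPencil P R A B S p q) (z : Fin 2 → ℂ) :
    pencilMap R p q z p = z 0 := by
  rw [pencilMap_apply, h.upper.apply_of_mem (by simp), h.upper.apply_of_mem (by simp),
    if_pos rfl, if_neg h.ne]
  ring

theorem pencilMap_right (h : IsPencil P R A B S p q) (z : Fin 2 → ℂ) :
    pencilMap R p q z q = z 1 := by
  rw [pencilMap_apply, h.upper.apply_of_mem (by simp), h.upper.apply_of_mem (by simp),
    if_pos rfl, if_neg h.ne.symm]
  ring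

theorem pencilMap_of_mem (h : IsPencil P R A B S p q) (z : Fin 2 → ℂ) {s : Fin k} (hs : s ∈ S) :
    pencilMap R p q z s = 0 := by
  have h1 : s ≠ p := fun h' => h.left_notMem (h' ▸ hs)
  have h2 : s ≠ q := fun h' => h.right_notMem (h' ▸ hs)
  have hs' : s ∈ insert p (insert q S) := by simp [hs]
  rw [pencilMap_apply, h.upper.apply_of_mem hs', h.upper.apply_of_mem hs', if_neg h1, if_neg h2]
  ring

theorem eq_pencilMap (h : IsPencil P R A B S p q) {v : Fin k → ℂ} (hv : v ∈ B)
    (hvS : ∀ s ∈ S, v s = 0) {z : Fin 2 → ℂ} (h0 : z 0 = v p) (h1 : z 1 = v q) :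
    pencilMap R p q z = v := by
  rw [← sub_eq_zero]
  refine h.upper.inj _ (B.sub_mem (h.pencilMap_mem z) hv) fun s hs => ?_
  rw [Pi.sub_apply]
  rcases Finset.mem_insert.1 hs with rfl | hs
  · rw [h.pencilMap_left, h0, sub_self]
  rcases Finset.mem_insert.1 hs with rfl | hs
  · rw [h.pencilMap_right, h1, sub_self]
  · rw [h.pencilMap_of_mem z hs, hvS s hs, sub_self]

theorem injective (h : IsPencil P R A B S p q) : Function.Injective (pencilMap R p q) := by
  intro z z' hz
  have h1 := congrFun hz p
  have h2 := congrFun hz q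
  rw [h.pencilMap_left, h.pencilMap_left] at h1
  rw [h.pencilMap_right, h.pencilMap_right] at h2
  ext a
  fin_cases a
  · exact h1
  · exact h2

theorem eq_zero_of_pencilMap_mem (h : IsPencil P R A B S p q) {z : Fin 2 → ℂ}
    (hz : pencilMap R p q z ∈ A) : pencilMap R p q z = 0 :=
  h.lower.inj _ hz fun _ hs => h.pencilMap_of_mem z hs

theorem sup_map_le (h : IsPencil P R A B S p q) (ℓ : Submodule ℂ (Fin 2 → ℂ)) :
    A ⊔ ℓ.map (pencilMap R p q) ≤ B := by
  refine sup_le h.le ?_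
  rintro _ ⟨z, -, rfl⟩
  exact h.pencilMap_mem z

theorem comap_sup_map (h : IsPencil P R A B S p q) (ℓ : Submodule ℂ (Fin 2 → ℂ)) :
    (A ⊔ ℓ.map (pencilMap R p q)).comap (pencilMap R p q) = ℓ := by
  apply le_antisymm
  · intro z hz
    obtain ⟨a, ha, w, ⟨z', hz', rfl⟩, haw⟩ := Submodule.mem_sup.1 (Submodule.mem_comap.1 hz)
    have h1 : pencilMap R p q (z - z') ∈ A := by
      rw [map_sub, ← haw, add_sub_cancel_right]
      exact ha
    have h2 := h.eq_zero_of_pencilMap_mem h1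
    rw [← (pencilMap R p q).map_zero] at h2
    rw [sub_eq_zero.1 (h.injective h2)]
    exact hz'
  · exact fun z hz => Submodule.mem_sup_right (Submodule.mem_map_of_mem hz)

theorem sup_map_comap (h : IsPencil P R A B S p q) (hAV : A ≤ V) (hVB : V ≤ B) :
    A ⊔ (V.comap (pencilMap R p q)).map (pencilMap R p q) = V := by
  apply le_antisymm
  · exact sup_le hAV (Submodule.map_comap_le _ _)
  · intro v hv
    have hw : v - P.mulVec v ∈ V := V.sub_mem hv (hAV (h.lower.mem v))
    set w := v - P.mulVec v with hwdef
    have hz : pencilMap R p q ![w p, w q] = w := h.eq_pencilMap (hVB hw)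
      (fun s hs => by rw [hwdef, Pi.sub_apply, h.lower.agree v s hs, sub_self]) rfl rfl
    have hvw : v = P.mulVec v + w := by rw [hwdef, add_sub_cancel]
    rw [hvw]
    refine Submodule.add_mem_sup (h.lower.mem v) ⟨_, ?_, hz⟩
    change pencilMap R p q _ ∈ V
    rw [hz]
    exact hw

theorem finrank_sup_map (h : IsPencil P R A B S p q) (ℓ : Submodule ℂ (Fin 2 → ℂ)) :
    Module.finrank ℂ (A ⊔ ℓ.map (pencilMap R p q) : Submodule ℂ (Fin k → ℂ)) =
      Module.finrank ℂ A + Module.finrank ℂ ℓ := by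
  have h1 := Submodule.finrank_sup_add_finrank_inf_eq A (ℓ.map (pencilMap R p q))
  have h2 : A ⊓ ℓ.map (pencilMap R p q) = ⊥ := by
    rw [eq_bot_iff]
    rintro _ ⟨hv, z, -, rfl⟩
    exact h.eq_zero_of_pencilMap_mem hv
  rw [h2, finrank_bot, add_zero] at h1
  rw [h1, (Submodule.equivMapOfInjective _ h.injective ℓ).finrank_eq]

theorem finrank_comap (h : IsPencil P R A B S p q) (hAV : A ≤ V) (hVB : V ≤ B)
    (hrank : Module.finrank ℂ V = Module.finrank ℂ A + 1) :
    Module.finrank ℂ (V.comap (pencilMap R p q)) = 1 := by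
  have := h.finrank_sup_map (V.comap (pencilMap R p q))
  rw [h.sup_map_comap hAV hVB] at this
  omega

/-- The line in `ℂ²` corresponding to a subspace that is a graph over `S ∪ {s}`. -/
theorem span_eq_comap (h : IsPencil P R A B S p q) (hAV : A ≤ V) (hVB : V ≤ B)
    (hrank : Module.finrank ℂ V = Module.finrank ℂ A + 1) {s : Fin k} (hs : s = p ∨ s = q)
    (hV : IsGraphOver V (insert s S)) :
    Submodule.span ℂ {![graphProj V (insert s S) p s, graphProj V (insert s S) q s]} =
      V.comap (pencilMap R p q) := by
  have hsS : s ∉ S := by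
    rcases hs with rfl | rfl
    · exact h.left_notMem
    · exact h.right_notMem
  have hcol := hV.isGraphProj.col_mem s
  have hz : pencilMap R p q ![graphProj V (insert s S) p s, graphProj V (insert s S) q s] =
      fun r => graphProj V (insert s S) r s :=
    h.eq_pencilMap (hVB hcol) (fun t ht => by
      rw [hV.isGraphProj.apply_of_mem (Finset.mem_insert_of_mem ht), if_neg]
      rintro rfl
      exact hsS ht) rfl rfl
  refine Submodule.eq_of_le_of_finrank_le ?_ ?_
  · rw [Submodule.span_singleton_le_iff_mem, Submodule.mem_comap, hz]
    exact hcol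
  · rw [h.finrank_comap hAV hVB hrank, finrank_span_singleton]
    intro h0
    rw [h0, map_zero] at hz
    have := congrFun hz s
    simp only [hV.isGraphProj.apply_of_mem (Finset.mem_insert_self s S), if_true] at this
    exact zero_ne_one this

end IsPencil

end Pencil

/-! ### The tower of projective line fibrations -/

section Fibration

variable {n l : ℕ}

open Classical in
/-- `X` if it has dimension `e`, and `Y` otherwise. -/
def withFinrank {k : ℕ} (e : ℕ) (X Y : Submodule ℂ (Fin k → ℂ)) : Submodule ℂ (Fin k → ℂ) :=
  if Module.finrank ℂ X = e then X else Y

theorem finrank_withFinrank {k e : ℕ} {X Y : Submodule ℂ (Fin k → ℂ)}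
    (hY : Module.finrank ℂ Y = e) : Module.finrank ℂ (withFinrank e X Y) = e := by
  unfold withFinrank
  by_cases h : Module.finrank ℂ X = e
  · rw [if_pos h]
    exact h
  · rw [if_neg h]
    exact hY

theorem withFinrank_eq {k e : ℕ} {X Y : Submodule ℂ (Fin k → ℂ)}
    (hX : Module.finrank ℂ X = e) : withFinrank e X Y = X := if_pos hX

/-- The point of the product with `ℙ¹` with given components. -/
def P1Prod.mk {ι : Type} {m d : ι → ℕ} (b : MultiGr m d) (ℓ : Submodule ℂ (Fin 2 → ℂ))
    (hℓ : Module.finrank ℂ ℓ = 1) : P1Prod m d where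
  space
    | none => ℓ
    | some a => b.space a
  finrank_eq
    | none => hℓ
    | some a => b.finrank_eq a

section P1Prod

variable {ι ι' : Type} {m d : ι → ℕ} {m' d' : ι' → ℕ}

/-- The component in `ℙ¹`. -/
def P1Prod.line (y : P1Prod m d) : Submodule ℂ (Fin 2 → ℂ) := y.space none

theorem P1Prod.finrank_line (y : P1Prod m d) : Module.finrank ℂ y.line = 1 := y.finrank_eq none

theorem P1Prod.ext_base {y y' : P1Prod m d} (h : y.base = y'.base) (h' : y.line = y'.line) :
    y = y' := by
  refine MultiGr.ext (funext fun o => ?_)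
  cases o with
  | none => exact h'
  | some a => exact congrFun (congrArg MultiGr.space h) a

theorem isRegularSubspaceOn_base (a : ι) (Z : Set (P1Prod m d)) :
    IsRegularSubspaceOn (fun y : P1Prod m d => y.base.space a) (Fin (d a)) Z :=
  isRegularSubspaceOn_space (m := fun o : Option ι => o.elim 2 m) (some a) Z

theorem isRegularSubspaceOn_line (Z : Set (P1Prod m d)) :
    IsRegularSubspaceOn (fun y : P1Prod m d => y.line) (Fin 1) Z :=
  isRegularSubspaceOn_space (m := fun o : Option ι => o.elim 2 m) none Z

theorem IsRegularMapOn.of_base_line [Finite ι] {F : MultiGr m' d' → P1Prod m d}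
    {Z : Set (MultiGr m' d')} {Z' : Set (P1Prod m d)} (hF : Set.MapsTo F Z Z')
    (hbase : ∀ a, IsRegularSubspaceOn (fun x => (F x).base.space a) (Fin (d a)) Z)
    (hline : IsRegularSubspaceOn (fun x => (F x).line) (Fin 1) Z) : IsRegularMapOn F Z Z' :=
  IsRegularMapOn.of_isRegularSubspaceOn hF fun o =>
    match o with
    | none => hline
    | some a => hbase a

end P1Prod

/-- The collection with one more subspace, `X`, which has the index `α`. -/
def appendStep {α : Root n} (hα : α.pos = l) (y : StepGr n l)
    (X : Submodule ℂ (Fin (2 * n) → ℂ)) (hX : Module.finrank ℂ X = α.i) : StepGr n (l + 1) where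
  space β := if h : β.1.pos < l then y.space ⟨β.1, h⟩ else X
  finrank_eq β := by
    by_cases h : β.1.pos < l
    · rw [dif_pos h]
      exact y.finrank_eq ⟨β.1, h⟩
    · have h1 := β.2
      have h2 : β.1 = α := Root.pos_injective (by omega)
      rw [dif_neg h, hX, h2]

theorem stepMap_appendStep {α : Root n} (hα : α.pos = l) (y : StepGr n l)
    (X : Submodule ℂ (Fin (2 * n) → ℂ)) (hX : Module.finrank ℂ X = α.i) :
    stepMap n l (appendStep hα y X hX) = y :=
  MultiGr.ext (funext fun β => dif_pos β.2)

theorem appendStep_space {α : Root n} (hα : α.pos = l) (y : StepGr n l)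
    (X : Submodule ℂ (Fin (2 * n) → ℂ)) (hX : Module.finrank ℂ X = α.i)
    (h : α.pos < l + 1) : (appendStep hα y X hX).space ⟨α, h⟩ = X :=
  dif_neg (by simp only; omega)

theorem StepGr.ext_step {α : Root n} (hα : α.pos = l) {x x' : StepGr n (l + 1)}
    (h : stepMap n l x = stepMap n l x')
    (h' : x.space ⟨α, by omega⟩ = x'.space ⟨α, by omega⟩) : x = x' := by
  refine MultiGr.ext (funext fun β => ?_)
  by_cases hβ : β.1.pos < l
  · exact congrFun (congrArg MultiGr.space h) ⟨β.1, hβ⟩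
  · have h1 := β.2
    have h2 : β = ⟨α, by omega⟩ := Subtype.ext (Root.pos_injective (by simp only; omega))
    rw [h2, h']

theorem extendZero_stepMap (x : StepGr n (l + 1)) {i j : ℕ}
    (h : 1 ≤ i → rootDomain (stepRoot n l) i j) :
    extendZero (stepRoot n (l + 1)) x i j = extendZero (stepRoot n l) (stepMap n l x) i j := by
  cases i with
  | zero => rw [extendZero_zero, extendZero_zero]
  | succ i =>
    obtain ⟨a, hi, hj⟩ := h (by omega)
    rw [extendZero_eq (stepRoot_injective n l) _ hi hj,
      extendZero_eq (stepRoot_injective n (l + 1)) x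
        (a := ⟨a.1, Nat.lt_succ_of_lt a.2⟩) hi hj]
    rfl

theorem rootDomain_left {α : Root n} (hα : α.pos = l) {i : ℕ} (hi : α.i = i + 1) :
    1 ≤ i → rootDomain (stepRoot n l) i α.j := by
  intro h
  have h1 := α.fullDomain
  rw [hi] at h1
  have h2 : fullDomain n i α.j := by unfold fullDomain at *; omega
  rw [rootDomain_stepRoot h2, ← hα]
  have := (mkRoot_left_precedes h1 h2).pos_lt
  rwa [show mkRoot h1 = α from Root.ext_ij hi.symm rfl] at this

theorem rootDomain_up {α : Root n} (hα : α.pos = l) {i : ℕ} (hi : α.i = i + 1) :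
    i + 1 + α.j < 2 * n → rootDomain (stepRoot n l) (i + 1) (α.j + 1) := by
  intro h
  have h1 := α.fullDomain
  rw [hi] at h1
  have h2 : fullDomain n (i + 1) (α.j + 1) := by unfold fullDomain at *; omega
  rw [rootDomain_stepRoot h2, ← hα]
  have := (mkRoot_up_precedes h1 h2).pos_lt
  rwa [show mkRoot h1 = α from Root.ext_ij hi.symm rfl] at this

/-- The fibres of the tower: `V_α` may be any subspace between two subspaces that are determined
by the preceding ones. -/
theorem mem_SpRStep_succ_iff {α : Root n} (hα : α.pos = l) {i : ℕ} (hi : α.i = i + 1)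
    {x : StepGr n (l + 1)} : x ∈ SpRStep n (l + 1) ↔ stepMap n l x ∈ SpRStep n l ∧
      extendZero (stepRoot n l) (stepMap n l x) i α.j ≤ x.space ⟨α, by omega⟩ ∧
      x.space ⟨α, by omega⟩ ≤ towerUpper n i α.j
        (extendZero (stepRoot n l) (stepMap n l x) i α.j)
        (extendZero (stepRoot n l) (stepMap n l x) (i + 1) (α.j + 1)) := by
  have hD := isLowerDomain_stepRoot n l
  have hD' := isLowerDomain_stepRoot n (l + 1)
  have hx : extendZero (stepRoot n (l + 1)) x (i + 1) α.j = x.space ⟨α, by omega⟩ :=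
    extendZero_eq (stepRoot_injective n (l + 1)) x (a := ⟨α, by omega⟩) hi rfl
  have hl := extendZero_stepMap x (rootDomain_left hα hi)
  have hu : i + 1 + α.j < 2 * n → _ := fun h =>
    extendZero_stepMap x (fun _ => rootDomain_up hα hi h)
  constructor
  · intro h
    refine ⟨(isRegularMapOn_stepMap n l).1 h, ?_⟩
    rw [SpRStep_eq_towerSet, mem_towerSet_iff (stepRoot_injective n _) hD'] at h
    have hat := h.at_of i α.j ⟨⟨α, by omega⟩, hi, rfl⟩
    have h1 := hat.lower
    have h2 := hat.upper
    rw [towerUpper_congr hu] at h2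
    rw [hx, hl] at h1 h2
    exact ⟨h1, h2⟩
  · rintro ⟨h, h1, h2⟩
    rw [SpRStep_eq_towerSet, mem_towerSet_iff (stepRoot_injective n _) hD] at h
    rw [SpRStep_eq_towerSet, mem_towerSet_iff (stepRoot_injective n _) hD']
    have hcongr := h.congr hD fun i j hij => extendZero_stepMap x hij
    refine ⟨hcongr.zero, fun i' j' h' => ?_⟩
    obtain ⟨β, hβi, hβj⟩ := h'
    by_cases hβ : β.1.pos < l
    · exact hcongr.at_of i' j' ⟨⟨β.1, hβ⟩, hβi, hβj⟩
    · have hβ' := β.2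
      have h3 : β.1 = α := Root.pos_injective (by omega)
      have h4 : i' = i := by
        have : β.1.i = i' + 1 := hβi
        rw [h3] at this
        omega
      have h5 : j' = α.j := by rw [← hβj, ← h3]
      subst h4 h5
      refine ⟨?_, ?_, ?_⟩
      · rw [hx, x.finrank_eq ⟨α, by omega⟩]
        exact hi
      · rw [hx, hl]
        exact h1
      · rw [towerUpper_congr hu, hx, hl]
        exact h2

section Regular

variable {ι : Type}

theorem isOpen_isGraphOver_extendZero (r : ι → Root n) (i j : ℕ) (S : Finset (Fin (2 * n))) :
    IsOpen {y : FamGr r | IsGraphOver (extendZero r y i j) S} := by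
  by_cases h : rootDomain r i j
  · simp only [extendZero, dif_pos h]
    exact isOpen_graphLocus (m := fun _ : ι => 2 * n) h.choose S
  · simp only [extendZero, dif_neg h]
    exact isOpen_const

theorem isRegularOn_graphProj_extendZero (r : ι → Root n) (i j : ℕ) (S : Finset (Fin (2 * n)))
    (s t : Fin (2 * n)) : IsRegularOn (fun y : FamGr r => graphProj (extendZero r y i j) S s t)
      {y | IsGraphOver (extendZero r y i j) S} := by
  by_cases h : rootDomain r i j
  · simp only [extendZero, dif_pos h]
    exact isRegularOn_graphProj (m := fun _ : ι => 2 * n) h.choose S s t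
  · simp only [extendZero, dif_neg h]
    exact IsRegularOn.const _ _

end Regular

/-- The locus where `V_{i,j}` and `V_{i+1,j+1}` are graphs over `S` and `T`. -/
def predLocus (n l i j : ℕ) (S T : Finset (Fin (2 * n))) : Set (StepGr n l) :=
  {y | IsGraphOver (extendZero (stepRoot n l) y i j) S} ∩
    {y | i + 1 + j < 2 * n → IsGraphOver (extendZero (stepRoot n l) y (i + 1) (j + 1)) T}

theorem isOpen_predLocus (i j : ℕ) (S T : Finset (Fin (2 * n))) :
    IsOpen (predLocus n l i j S T) := by
  refine (isOpen_isGraphOver_extendZero _ i j S).inter ?_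
  by_cases h : i + 1 + j < 2 * n
  · simp only [h, true_imp_iff]
    exact isOpen_isGraphOver_extendZero _ (i + 1) (j + 1) T
  · simp only [h, false_imp_iff]
    exact isOpen_const

/-- The graph projection of the upper bound for `V_{i+1,j}`. -/
def stepUpperProj (n l i j : ℕ) (S T : Finset (Fin (2 * n))) (y : StepGr n l) :
    Matrix (Fin (2 * n)) (Fin (2 * n)) ℂ :=
  upperProj n i j (graphProj (extendZero (stepRoot n l) y i j) S)
    (graphProj (extendZero (stepRoot n l) y (i + 1) (j + 1)) T)

theorem isRegularOn_stepUpperProj (i j : ℕ) (S T : Finset (Fin (2 * n))) (r c : Fin (2 * n)) :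
    IsRegularOn (fun y => stepUpperProj n l i j S T y r c) (predLocus n l i j S T) := by
  simp only [stepUpperProj, upperProj, Matrix.of_apply]
  by_cases h : 2 * n ≤ i + 1 + j
  · simp only [if_pos h]
    exact (IsRegularOn.const _ _).sub ((IsRegularOn.const _ _).mul
      ((isRegularOn_graphProj_extendZero _ i j S _ _).mono Set.inter_subset_left))
  · simp only [if_neg h]
    refine (IsRegularOn.mono (isRegularOn_graphProj_extendZero _ (i + 1) (j + 1) T _ _) ?_).add
      (IsRegularOn.const _ _)
    exact fun y hy => hy.2 (by omega)

/-- Local triviality data for one step of the tower. -/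
theorem exists_local_pencil {α : Root n} (hα : α.pos = l) {i : ℕ} (hi : α.i = i + 1)
    {b : StepGr n l} (hb : b ∈ SpRStep n l) :
    ∃ (S T : Finset (Fin (2 * n))) (p q : Fin (2 * n)), S.card = i ∧
      b ∈ predLocus n l i α.j S T ∧ ∀ y ∈ SpRStep n l ∩ predLocus n l i α.j S T,
        IsPencil (graphProj (extendZero (stepRoot n l) y i α.j) S)
          (stepUpperProj n l i α.j S T y) (extendZero (stepRoot n l) y i α.j)
          (towerUpper n i α.j (extendZero (stepRoot n l) y i α.j)
            (extendZero (stepRoot n l) y (i + 1) (α.j + 1))) S p q := by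
  have hD := isLowerDomain_stepRoot n l
  rw [SpRStep_eq_towerSet]
  rw [SpRStep_eq_towerSet, mem_towerSet_iff (stepRoot_injective n _) hD] at hb
  obtain ⟨S, hS, hbS⟩ := hb.exists_chartOn hD
  have hl := rootDomain_left hα hi
  have hu := rootDomain_up hα hi
  have hα' := α.fullDomain
  unfold fullDomain at hα'
  rw [hi] at hα'
  have hsub := hS.lower_subset_upper hD hα'.2.1 hα'.2.2 hl hu
  have hcard := hS.card_upperCoords hα'.2.1 hα'.2.2 hl hu
  have hcard' := hS.card_lower hl
  obtain ⟨p, q, hpq, hdiff⟩ := Finset.card_eq_two.1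
    (show (upperCoords n i α.j (S i α.j) (S (i + 1) (α.j + 1)) \ S i α.j).card = 2 by
      rw [Finset.card_sdiff_of_subset hsub, hcard, hcard']
      omega)
  have hins : upperCoords n i α.j (S i α.j) (S (i + 1) (α.j + 1)) =
      insert p (insert q (S i α.j)) := by
    rw [← Finset.sdiff_union_of_subset hsub, hdiff, Finset.insert_union, Finset.singleton_union]
  have hp : p ∉ S i α.j := (Finset.mem_sdiff.1 (hdiff ▸ Finset.mem_insert_self p _)).2
  have hq : q ∉ S i α.j := (Finset.mem_sdiff.1
    (hdiff ▸ Finset.mem_insert_of_mem (Finset.mem_singleton_self q))).2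
  refine ⟨S i α.j, S (i + 1) (α.j + 1), p, q, hcard',
    ⟨hbS i α.j hl, fun h => hbS _ _ fun _ => hu h⟩, ?_⟩
  rintro y ⟨hy, hyU⟩
  rw [mem_towerSet_iff (stepRoot_injective n _) hD] at hy
  refine ⟨IsGraphOver.isGraphProj hyU.1, ?_, hy.lower_le_upper hD hα'.2.1 hα'.2.2 hl hu, hpq,
    hp, hq⟩
  rw [← hins]
  exact hy.isGraphProj_upperProj hα'.2.1 hα'.2.2 hl hu (IsGraphOver.isGraphProj hyU.1)
    fun h => IsGraphOver.isGraphProj (hyU.2 h)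

/-- The subspace with index `α`, for the last root `α` of a step of the tower. -/
def lastSpace {α : Root n} (hα : α.pos = l) (x : StepGr n (l + 1)) :
    Submodule ℂ (Fin (2 * n) → ℂ) := x.space ⟨α, by omega⟩

theorem finrank_lastSpace {α : Root n} (hα : α.pos = l) (x : StepGr n (l + 1)) :
    Module.finrank ℂ (lastSpace hα x) = α.i := x.finrank_eq ⟨α, by omega⟩

theorem finrank_span_fst : Module.finrank ℂ (Submodule.span ℂ {(![1, 0] : Fin 2 → ℂ)}) = 1 :=
  finrank_span_singleton fun h => one_ne_zero (congrFun h 0)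

/-- The product of `ℙ¹` with the Grassmannians containing the first `l` subspaces. -/
abbrev StepP1 (n l : ℕ) : Type :=
  P1Prod (fun _ : {β : Root n // β.pos < l} => 2 * n) (fun β => β.1.i)

/-- The local trivialization of a step of the tower, for a family of maps `L y` from `ℂ²` to
`ℂ ^ (2 n)`. -/
def trivialize {α : Root n} (hα : α.pos = l)
    (L : StepGr n l → (Fin 2 → ℂ) →ₗ[ℂ] (Fin (2 * n) → ℂ)) (x : StepGr n (l + 1)) :
    StepP1 n l :=
  P1Prod.mk (stepMap n l x)
    (withFinrank 1 ((lastSpace hα x).comap (L (stepMap n l x))) (Submodule.span ℂ {![1, 0]}))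
    (finrank_withFinrank finrank_span_fst)

/-- The inverse of the local trivialization, for a family `A y` of subspaces; `X` is a junk
value. -/
def untrivialize {α : Root n} (hα : α.pos = l)
    (L : StepGr n l → (Fin 2 → ℂ) →ₗ[ℂ] (Fin (2 * n) → ℂ))
    (A : StepGr n l → Submodule ℂ (Fin (2 * n) → ℂ)) {X : Submodule ℂ (Fin (2 * n) → ℂ)}
    (hX : Module.finrank ℂ X = α.i)
    (y : StepP1 n l) :
    StepGr n (l + 1) :=
  appendStep hα y.base (withFinrank α.i (A y.base ⊔ y.line.map (L y.base)) X)
    (finrank_withFinrank hX)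

theorem IsPencil.finrank_lower {k : ℕ} {P R : Matrix (Fin k) (Fin k) ℂ}
    {A B : Submodule ℂ (Fin k → ℂ)} {S : Finset (Fin k)} {p q : Fin k}
    (h : IsPencil P R A B S p q) : Module.finrank ℂ A = S.card :=
  h.lower.isGraphOver.1.symm

/-- Over `Z`, the set `E` consists of the collections in which the subspace with the last index
`α` lies between `A` and `B`; there are graph projections of `A` and of `B` that depend regularly
on the point of `Z`. -/
structure IsLocalStep {α : Root n} (hα : α.pos = l) (S : Finset (Fin (2 * n)))
    (p q : Fin (2 * n)) (P R : StepGr n l → Matrix (Fin (2 * n)) (Fin (2 * n)) ℂ)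
    (A B : StepGr n l → Submodule ℂ (Fin (2 * n) → ℂ))
    (E : Set (StepGr n (l + 1))) (Z : Set (StepGr n l)) : Prop where
  pencil : ∀ y ∈ Z, IsPencil (P y) (R y) (A y) (B y) S p q
  mem_iff : ∀ x, x ∈ E ↔ stepMap n l x ∈ Z ∧ A (stepMap n l x) ≤ lastSpace hα x ∧
    lastSpace hα x ≤ B (stepMap n l x)
  card_eq : S.card + 1 = α.i
  regular_lower : ∀ r c, IsRegularOn (fun y => P y r c) Z
  regular_upper : ∀ r c, IsRegularOn (fun y => R y r c) Z

namespace IsLocalStep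

variable {α : Root n} {hα : α.pos = l} {S : Finset (Fin (2 * n))}
  {p q : Fin (2 * n)} {P R : StepGr n l → Matrix (Fin (2 * n)) (Fin (2 * n)) ℂ}
  {A B : StepGr n l → Submodule ℂ (Fin (2 * n) → ℂ)}
  {E : Set (StepGr n (l + 1))} {Z : Set (StepGr n l)} {X : Submodule ℂ (Fin (2 * n) → ℂ)}

theorem finrank_lastSpace_eq (h : IsLocalStep hα S p q P R A B E Z) {x : StepGr n (l + 1)}
    (hx : x ∈ E) : Module.finrank ℂ (lastSpace hα x) =
      Module.finrank ℂ (A (stepMap n l x)) + 1 := by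
  rw [finrank_lastSpace, (h.pencil _ ((h.mem_iff x).1 hx).1).finrank_lower, h.card_eq]

theorem line_trivialize (h : IsLocalStep hα S p q P R A B E Z) {x : StepGr n (l + 1)}
    (hx : x ∈ E) : (trivialize hα (fun y => pencilMap (R y) p q) x).line =
      (lastSpace hα x).comap (pencilMap (R (stepMap n l x)) p q) := by
  obtain ⟨h1, h2, h3⟩ := (h.mem_iff x).1 hx
  exact withFinrank_eq ((h.pencil _ h1).finrank_comap h2 h3 (h.finrank_lastSpace_eq hx))

theorem lastSpace_untrivialize (h : IsLocalStep hα S p q P R A B E Z)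
    (hX : Module.finrank ℂ X = α.i)
    {y : StepP1 n l} (hy : y.base ∈ Z) :
    lastSpace hα (untrivialize hα (fun y => pencilMap (R y) p q) A hX y) =
      A y.base ⊔ y.line.map (pencilMap (R y.base) p q) := by
  refine (appendStep_space _ _ _ _ _).trans (withFinrank_eq ?_)
  rw [(h.pencil _ hy).finrank_sup_map, (h.pencil _ hy).finrank_lower, y.finrank_line, h.card_eq]

theorem stepMap_untrivialize (hX : Module.finrank ℂ X = α.i)
    (y : StepP1 n l) :
    stepMap n l (untrivialize hα (fun y => pencilMap (R y) p q) A hX y) = y.base :=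
  stepMap_appendStep _ _ _ _

theorem untrivialize_mem (h : IsLocalStep hα S p q P R A B E Z)
    (hX : Module.finrank ℂ X = α.i)
    {y : StepP1 n l} (hy : y.base ∈ Z) :
    untrivialize hα (fun y => pencilMap (R y) p q) A hX y ∈ E := by
  rw [h.mem_iff, stepMap_untrivialize, h.lastSpace_untrivialize hX hy]
  exact ⟨hy, le_sup_left, (h.pencil _ hy).sup_map_le _⟩

theorem isRegularMapOn_trivialize (h : IsLocalStep hα S p q P R A B E Z) :
    IsRegularMapOn (trivialize hα fun y => pencilMap (R y) p q) E {y | P1Prod.base y ∈ Z} := by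
  refine IsRegularMapOn.of_base_line (fun x hx => ((h.mem_iff x).1 hx).1) (fun a => ?_) ?_
  · exact isRegularSubspaceOn_space (m := fun _ : {β : Root n // β.pos < l + 1} => 2 * n)
      ⟨a.1, Nat.lt_succ_of_lt a.2⟩ _
  · intro x hx
    obtain ⟨h1, h2, h3⟩ := (h.mem_iff x).1 hx
    have hp := h.pencil _ h1
    obtain ⟨s, hsT, hsS, hs⟩ := exists_isGraphOver_insert hp.lower.isGraphOver
      hp.upper.isGraphOver h2 h3 (h.finrank_lastSpace_eq hx)
    have hspq : s = p ∨ s = q := by simpa [hsS] using hsT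
    refine ⟨graphLocus (m := fun _ : {β : Root n // β.pos < l + 1} => 2 * n) ⟨α, by omega⟩
      (insert s S), isOpen_graphLocus _ _, hs, fun _ r y =>
        graphProj (lastSpace hα y) (insert s S) (if r = 0 then p else q) s,
      fun _ r => (isRegularOn_graphProj _ _ _ _).mono Set.inter_subset_right, ?_⟩
    rintro y ⟨hy, hys⟩
    obtain ⟨h1, h2, h3⟩ := (h.mem_iff y).1 hy
    have hvec : (fun (_ : Fin 1) (r : Fin 2) =>
        graphProj (lastSpace hα y) (insert s S) (if r = 0 then p else q) s) = fun _ =>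
          ![graphProj (lastSpace hα y) (insert s S) p s,
            graphProj (lastSpace hα y) (insert s S) q s] := by
      ext _ r
      fin_cases r <;> rfl
    rw [hvec, Set.range_const]
    refine Eq.trans ?_ (h.line_trivialize hy).symm
    exact (h.pencil _ h1).span_eq_comap h2 h3 (h.finrank_lastSpace_eq hy) hspq hys

theorem isRegularMapOn_untrivialize (h : IsLocalStep hα S p q P R A B E Z)
    (hX : Module.finrank ℂ X = α.i) :
    IsRegularMapOn (untrivialize hα (fun y => pencilMap (R y) p q) A hX)
      {y | P1Prod.base y ∈ Z} E := by
  refine IsRegularMapOn.of_isRegularSubspaceOn (fun y hy => h.untrivialize_mem hX hy) fun β => ?_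
  by_cases hβ : β.1.pos < l
  · exact (isRegularSubspaceOn_base (m := fun _ : {β : Root n // β.pos < l} => 2 * n)
      ⟨β.1, hβ⟩ _).congr fun y _ => dif_pos hβ
  · have hβ' := β.2
    have hlt : α.pos < l + 1 := by omega
    obtain rfl : β = ⟨α, hlt⟩ := Subtype.ext (Root.pos_injective (by simp only; omega))
    change IsRegularSubspaceOn (fun y => lastSpace hα
      (untrivialize hα (fun y => pencilMap (R y) p q) A hX y)) (Fin α.i) _
    have hcard : Fintype.card (Fin α.i) = Fintype.card (S ⊕ Fin 1) := by
      rw [Fintype.card_fin, Fintype.card_sum, Fintype.card_coe, Fintype.card_fin, h.card_eq]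
    refine IsRegularSubspaceOn.reindex ?_ (Fintype.equivOfCardEq hcard)
    have hreg : ∀ {f : StepGr n l → ℂ} {O : Set (StepP1 n l)}, IsRegularOn f Z →
        IsRegularOn (fun y : StepP1 n l => f (P1Prod.base y))
          ({y | P1Prod.base y ∈ Z} ∩ O) := fun hf =>
      IsRegularOn.comp (F := P1Prod.base) (fun a => isRegularSubspaceOn_base a _) hf
        fun y hy => hy.1
    intro y hy
    obtain ⟨O, hO, hyO, g, hg, hgs⟩ := isRegularSubspaceOn_line
      {y : StepP1 n l | y.base ∈ Z} y hy
    refine ⟨O, hO, hyO, Sum.elim (fun s r y => P (P1Prod.base y) r s)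
      (fun a r y => g a 0 y * R (P1Prod.base y) r p + g a 1 y * R (P1Prod.base y) r q), ?_, ?_⟩
    · rintro (s | a) r
      · exact hreg (h.regular_lower r s)
      · exact ((hg a 0).mul (hreg (h.regular_upper r p))).add
          ((hg a 1).mul (hreg (h.regular_upper r q)))
    · rintro z ⟨hz, hzO⟩
      refine Eq.trans ?_ (h.lastSpace_untrivialize hX hz).symm
      rw [show P1Prod.line z = _ from (hgs z ⟨hz, hzO⟩).symm, Submodule.map_span, ← Set.range_comp,
        ← (h.pencil _ hz).lower.span_col, ← Submodule.span_union, ← Set.Sum.elim_range]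
      congr 2
      ext (s | a) r <;> rfl

theorem isIsoOn (h : IsLocalStep hα S p q P R A B E Z) (hX : Module.finrank ℂ X = α.i) :
    IsIsoOn (trivialize hα fun y => pencilMap (R y) p q)
      (untrivialize hα (fun y => pencilMap (R y) p q) A hX) E {y | P1Prod.base y ∈ Z} := by
  refine ⟨h.isRegularMapOn_trivialize, h.isRegularMapOn_untrivialize hX, fun x hx => ?_,
    fun y hy => ?_⟩
  · obtain ⟨h1, h2, h3⟩ := (h.mem_iff x).1 hx
    refine StepGr.ext_step hα (stepMap_untrivialize hX _) ?_
    refine (h.lastSpace_untrivialize hX (y := trivialize hα _ x) h1).trans ?_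
    rw [h.line_trivialize hx]
    exact (h.pencil _ h1).sup_map_comap h2 h3
  · refine P1Prod.ext_base (stepMap_untrivialize (hα := hα) hX y) ?_
    rw [h.line_trivialize (h.untrivialize_mem hX hy), h.lastSpace_untrivialize hX hy,
      stepMap_untrivialize]
    exact (h.pencil _ hy).comap_sup_map _

end IsLocalStep

/-- The fibre over a point is the projective line of subspaces between the two bounds for the next
subspace, and local graph projections of the bounds identify it with `ℙ¹`. -/
theorem isP1Fibration_stepMap (hl : l < n ^ 2) :
    IsP1Fibration (stepMap n l) (SpRStep n (l + 1)) (SpRStep n l) := by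
  refine ⟨isRegularMapOn_stepMap n l, fun b hb => ?_⟩
  obtain ⟨α, hα⟩ := exists_root_pos_eq hl
  obtain ⟨i, hi⟩ := Nat.exists_eq_add_of_le' α.2.1
  change α.i = i + 1 at hi
  obtain ⟨S, T, p, q, hcard, hbU, hpencil⟩ := exists_local_pencil hα hi hb
  obtain ⟨V, -⟩ := SpR_nonempty n
  have h : IsLocalStep hα S p q
      (fun y => graphProj (extendZero (stepRoot n l) y i α.j) S)
      (stepUpperProj n l i α.j S T) (fun y => extendZero (stepRoot n l) y i α.j)
      (fun y => towerUpper n i α.j (extendZero (stepRoot n l) y i α.j)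
        (extendZero (stepRoot n l) y (i + 1) (α.j + 1)))
      (SpRStep n (l + 1) ∩ stepMap n l ⁻¹' predLocus n l i α.j S T)
      (SpRStep n l ∩ predLocus n l i α.j S T) := by
    refine ⟨hpencil, fun x => ?_, by omega, fun r c => ?_, fun r c => ?_⟩
    · rw [Set.mem_inter_iff, mem_SpRStep_succ_iff hα hi, Set.mem_preimage, Set.mem_inter_iff]
      tauto
    · exact (isRegularOn_graphProj_extendZero _ _ _ _ _ _).mono fun y hy => hy.2.1
    · exact (isRegularOn_stepUpperProj _ _ _ _ _ _).mono Set.inter_subset_right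
  exact ⟨_, isOpen_predLocus _ _ _ _, hbU, _, _, h.isIsoOn (V.finrank_eq α), fun x _ => rfl⟩

end Fibration

/-! ### Affine charts and local rings -/

section AffineChart

variable {ι : Type} {m d : ι → ℕ} {κ : Type}

/-- The open subset `Z ∩ O` of `Z` is isomorphic to the affine space `ℂ ^ κ`: the functions `ψ` are
regular coordinates on it, and the point with coordinates `t` is spanned by a frame whose entries
are the values at `t` of the polynomials `φ`. -/
structure IsAffineChart (Z O : Set (MultiGr m d)) (ψ : κ → MultiGr m d → ℂ)
    (φ : FrameIdx m d → MvPolynomial κ ℂ) : Prop where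
  isOpen : IsOpen O
  regular : ∀ a, IsRegularOn (ψ a) (Z ∩ O)
  exists_frame : ∀ t : κ → ℂ, ∃ A : Frame m d, (A.entry = fun i => MvPolynomial.eval t (φ i)) ∧
    MultiGr.ofFrame A ∈ Z ∩ O ∧ ∀ a, ψ a (MultiGr.ofFrame A) = t a
  injOn : ∀ x ∈ Z ∩ O, ∀ y ∈ Z ∩ O, (∀ a, ψ a x = ψ a y) → x = y

namespace IsAffineChart

variable {Z O : Set (MultiGr m d)} {ψ : κ → MultiGr m d → ℂ}
  {φ : FrameIdx m d → MvPolynomial κ ℂ}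

theorem exists_frame_of_mem (h : IsAffineChart Z O ψ φ) {x : MultiGr m d} (hx : x ∈ Z ∩ O) :
    ∃ A : Frame m d, (A.entry = fun i => MvPolynomial.eval (fun a => ψ a x) (φ i)) ∧
      MultiGr.ofFrame A = x := by
  obtain ⟨A, hA, hAZ, hAψ⟩ := h.exists_frame fun a => ψ a x
  exact ⟨A, hA, h.injOn _ hAZ _ hx hAψ⟩

theorem eval_bind₁ (t : κ → ℂ) (P : MvPolynomial (FrameIdx m d) ℂ) :
    MvPolynomial.eval t (MvPolynomial.bind₁ φ P) =
      MvPolynomial.eval (fun i => MvPolynomial.eval t (φ i)) P := by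
  rw [← MvPolynomial.coe_aeval_eq_eval, RingHom.coe_coe, MvPolynomial.aeval_bind₁]
  rfl

/-- An open subset that meets the chart contains, in the coordinates, the set where some nonzero
polynomial does not vanish. -/
theorem exists_polynomial (h : IsAffineChart Z O ψ φ) {U : Set (MultiGr m d)} (hU : IsOpen U)
    {x : MultiGr m d} (hx : x ∈ Z ∩ O) (hxU : x ∈ U) :
    ∃ p : MvPolynomial κ ℂ, p ≠ 0 ∧ ∀ t, MvPolynomial.eval t p ≠ 0 →
      ∃ y ∈ Z ∩ O, y ∈ U ∧ ∀ a, ψ a y = t a := by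
  obtain ⟨A, hA, rfl⟩ := h.exists_frame_of_mem hx
  obtain ⟨P, hP, hPU⟩ := MultiGr.isOpen_iff.1 hU A hxU
  refine ⟨MvPolynomial.bind₁ φ P, fun h0 => hP ?_, fun t ht => ?_⟩
  · rw [hA, ← eval_bind₁, h0, map_zero]
  · obtain ⟨B, hB, hBZ, hBψ⟩ := h.exists_frame t
    refine ⟨_, hBZ, hPU B ?_, hBψ⟩
    rw [hB, ← eval_bind₁]
    exact ht

theorem isIrreducible (h : IsAffineChart Z O ψ φ) : IsIrreducible (Z ∩ O) := by
  refine ⟨?_, ?_⟩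
  · obtain ⟨A, -, hA, -⟩ := h.exists_frame 0
    exact ⟨_, hA⟩
  · rintro U U' hU hU' ⟨x, hx, hxU⟩ ⟨x', hx', hxU'⟩
    obtain ⟨p, hp, hpU⟩ := h.exists_polynomial hU hx hxU
    obtain ⟨p', hp', hpU'⟩ := h.exists_polynomial hU' hx' hxU'
    obtain ⟨t, ht⟩ : ∃ t, MvPolynomial.eval t (p * p') ≠ 0 := by
      by_contra! hcon
      exact mul_ne_zero hp hp' (MvPolynomial.funext fun t => by rw [hcon t, map_zero])
    rw [map_mul] at ht
    obtain ⟨y, hy, hyU, hyψ⟩ := hpU t (left_ne_zero_of_mul ht)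
    obtain ⟨y', hy', hyU', hyψ'⟩ := hpU' t (right_ne_zero_of_mul ht)
    obtain rfl := h.injOn y hy y' hy' fun a => (hyψ a).trans (hyψ' a).symm
    exact ⟨y, hy, hyU, hyU'⟩

/-- The germs at `x` of the polynomials in the coordinates. -/
def toLocalRing (h : IsAffineChart Z O ψ φ) {x : MultiGr m d} (hx : x ∈ Z ∩ O) :
    MvPolynomial κ ℂ →+* localRingAt Z x :=
  ((Filter.Germ.coeRingHom (𝓝[Z] x)).comp
    (RingHom.pi fun y => MvPolynomial.eval fun a => ψ a y)).codRestrict (localRingAt Z x)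
    fun p => ⟨fun y => MvPolynomial.eval (fun a => ψ a y) p, O, h.isOpen, hx.2,
      IsRegularOn.eval h.regular p, rfl⟩

/-- The local ring at a point of an affine chart is the localization of the polynomial ring at the
maximal ideal of the point. -/
theorem isRegularLocalRing [Finite κ] (h : IsAffineChart Z O ψ φ) {x : MultiGr m d}
    (hx : x ∈ Z ∩ O) : IsRegularLocalRing (localRingAt Z x) := by
  let M : Ideal (MvPolynomial κ ℂ) := RingHom.ker (MvPolynomial.eval fun a => ψ a x)
  have hM : M.IsPrime := RingHom.ker_isPrime _
  algebraize [h.toLocalRing hx]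
  have hmem : ∀ p, p ∈ M.primeCompl ↔ MvPolynomial.eval (fun a => ψ a x) p ≠ 0 := fun p => Iff.rfl
  have hloc : IsLocalization.AtPrime (localRingAt Z x) M := by
    refine ⟨?_, ?_, ?_⟩
    -- a polynomial that does not vanish at the point is invertible near it
    · rintro ⟨p, hp⟩
      have hreg := IsRegularOn.eval h.regular p
      obtain ⟨U, hU, hxU, hne⟩ := hreg.exists_ne_zero hx ((hmem p).1 hp)
      have hsub : Z ∩ (O ∩ U) ⊆ Z ∩ O := fun y hy => ⟨hy.1, hy.2.1⟩
      refine IsUnit.of_mul_eq_one ⟨((fun y => 1 / MvPolynomial.eval (fun a => ψ a y) p :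
        MultiGr m d → ℂ) : Filter.Germ (𝓝[Z] x) ℂ), _, O ∩ U, h.isOpen.inter hU, ⟨hx.2, hxU⟩,
        (IsRegularOn.const 1 _).div (hreg.mono hsub) fun y hy => hne y ⟨hsub hy, hy.2.2⟩, rfl⟩ ?_
      refine Subtype.ext ?_
      refine Filter.Germ.coe_eq.2 ?_
      refine mem_nhdsWithin.2 ⟨O ∩ U, h.isOpen.inter hU, ⟨hx.2, hxU⟩, ?_⟩
      rintro y ⟨hy, hyZ⟩
      exact mul_one_div_cancel (hne y ⟨⟨hyZ, hy.1⟩, hy.2⟩)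
    -- a regular function is a quotient of polynomials in the frame entries, and these are
    -- polynomials in the coordinates
    · rintro ⟨_, f, U, hU, hxU, hf, rfl⟩
      obtain ⟨U', hU', hxU', P, Q, hPQ⟩ := hf x ⟨hx.1, hxU⟩
      have hval : ∀ y ∈ Z ∩ (O ∩ (U ∩ U')),
          MvPolynomial.eval (fun a => ψ a y) (MvPolynomial.bind₁ φ Q) ≠ 0 ∧
          f y = MvPolynomial.eval (fun a => ψ a y) (MvPolynomial.bind₁ φ P) /
            MvPolynomial.eval (fun a => ψ a y) (MvPolynomial.bind₁ φ Q) := by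
        rintro y ⟨hyZ, hyO, hyU, hyU'⟩
        obtain ⟨A, hA, hAy⟩ := h.exists_frame_of_mem ⟨hyZ, hyO⟩
        have := hPQ A (by rw [hAy]; exact ⟨⟨hyZ, hyU⟩, hyU'⟩)
        rwa [hA, hAy, ← eval_bind₁, ← eval_bind₁] at this
      refine ⟨(MvPolynomial.bind₁ φ P, ⟨MvPolynomial.bind₁ φ Q,
        (hmem _).2 (hval x ⟨hx.1, hx.2, hxU, hxU'⟩).1⟩), ?_⟩
      refine Subtype.ext ?_
      refine Filter.Germ.coe_eq.2 ?_
      refine mem_nhdsWithin.2 ⟨O ∩ (U ∩ U'), h.isOpen.inter (hU.inter hU'),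
        ⟨hx.2, hxU, hxU'⟩, ?_⟩
      rintro y ⟨hy, hyZ⟩
      obtain ⟨h1, h2⟩ := hval y ⟨hyZ, hy⟩
      change f y * MvPolynomial.eval _ _ = MvPolynomial.eval _ _
      rw [h2, div_mul_cancel₀ _ h1]
    -- polynomials with the same germ agree where some nonzero polynomial `g` does not vanish
    · intro p p' hpp'
      refine ⟨1, ?_⟩
      have h1 := Filter.Germ.coe_eq.1 (congrArg Subtype.val hpp')
      obtain ⟨U, hU, hxU, hUeq⟩ := mem_nhdsWithin.1 h1
      obtain ⟨g, hg, hgU⟩ := h.exists_polynomial hU hx hxU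
      have h2 : (p - p') * g = 0 := by
        refine MvPolynomial.funext fun t => ?_
        rw [map_mul, map_sub, map_zero]
        by_cases ht : MvPolynomial.eval t g = 0
        · rw [ht, mul_zero]
        · obtain ⟨y, hy, hyU, hyt⟩ := hgU t ht
          have h3 : MvPolynomial.eval (fun a => ψ a y) p = MvPolynomial.eval (fun a => ψ a y) p' :=
            hUeq ⟨hyU, hy.1⟩
          rw [funext hyt] at h3
          rw [h3, sub_self, zero_mul]
      rw [sub_eq_zero.1 ((mul_eq_zero.1 h2).resolve_right hg)]
  have e := IsLocalization.algEquiv M.primeCompl (Localization.AtPrime M) (localRingAt Z x)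
  exact IsRegularLocalRing.of_ringEquiv e.toRingEquiv

end IsAffineChart

/-- Polynomial functions on `ℂ ^ κ`. -/
def IsPolyFun (f : (κ → ℂ) → ℂ) : Prop := ∃ P : MvPolynomial κ ℂ, ∀ t, f t = MvPolynomial.eval t P

namespace IsPolyFun

variable {f g : (κ → ℂ) → ℂ}

theorem const (c : ℂ) : IsPolyFun fun _ : κ → ℂ => c := ⟨MvPolynomial.C c, fun t => by simp⟩

theorem coord (a : κ) : IsPolyFun fun t : κ → ℂ => t a := ⟨MvPolynomial.X a, fun t => by simp⟩

theorem add (hf : IsPolyFun f) (hg : IsPolyFun g) : IsPolyFun fun t => f t + g t := by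
  obtain ⟨P, hP⟩ := hf
  obtain ⟨Q, hQ⟩ := hg
  exact ⟨P + Q, fun t => by simp only [hP, hQ, map_add]⟩

theorem mul (hf : IsPolyFun f) (hg : IsPolyFun g) : IsPolyFun fun t => f t * g t := by
  obtain ⟨P, hP⟩ := hf
  obtain ⟨Q, hQ⟩ := hg
  exact ⟨P * Q, fun t => by simp only [hP, hQ, map_mul]⟩

theorem sub (hf : IsPolyFun f) (hg : IsPolyFun g) : IsPolyFun fun t => f t - g t := by
  obtain ⟨P, hP⟩ := hf
  obtain ⟨Q, hQ⟩ := hg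
  exact ⟨P - Q, fun t => by simp only [hP, hQ, map_sub]⟩

end IsPolyFun

end AffineChart

/-! ### The affine charts of the tower -/

section TowerCharts

variable {n : ℕ} {D : ℕ → ℕ → Prop} {V : ℕ → ℕ → Submodule ℂ (Fin (2 * n) → ℂ)}
  {S : ℕ → ℕ → Finset (Fin (2 * n))}

/-- The sets of coordinates for `V_{i,j}`, for `V_{i+1,j}` and for its upper bound differ by one
element each. -/
theorem ChartOn.exists_insert (hD : IsLowerDomain n D) (hS : ChartOn n D S) {i j : ℕ}
    (hij : i + 1 ≤ j) (hij' : i + 1 + j ≤ 2 * n) (hl : 1 ≤ i → D i j)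
    (hu : i + 1 + j < 2 * n → D (i + 1) (j + 1)) (hat : ChartAt n S i j) :
    ∃ p q, p ≠ q ∧ p ∉ S i j ∧ q ∉ S i j ∧ S (i + 1) j = insert p (S i j) ∧
      upperCoords n i j (S i j) (S (i + 1) (j + 1)) = insert p (insert q (S i j)) := by
  have hsub := hS.lower_subset_upper hD hij hij' hl hu
  have hcard := hS.card_upperCoords hij hij' hl hu
  have hcard' := hS.card_lower hl
  obtain ⟨p, hp⟩ := Finset.card_eq_one.1 (show (S (i + 1) j \ S i j).card = 1 by
    rw [Finset.card_sdiff_of_subset hat.lower, hat.card_eq, hcard']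
    omega)
  obtain ⟨q, hq⟩ := Finset.card_eq_one.1
    (show (upperCoords n i j (S i j) (S (i + 1) (j + 1)) \ S (i + 1) j).card = 1 by
      rw [Finset.card_sdiff_of_subset hat.upper, hat.card_eq, hcard]
      omega)
  have hp' := Finset.mem_sdiff.1 (hp ▸ Finset.mem_singleton_self p)
  have hq' := Finset.mem_sdiff.1 (hq ▸ Finset.mem_singleton_self q)
  have hins : S (i + 1) j = insert p (S i j) := by
    rw [← Finset.sdiff_union_of_subset hat.lower, hp, Finset.singleton_union]
  refine ⟨p, q, fun h => hq'.2 (h ▸ hp'.1), hp'.2, fun h => hq'.2 (hat.lower h), hins, ?_⟩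
  rw [← Finset.sdiff_union_of_subset hat.upper, hq, hins, Finset.singleton_union,
    Finset.insert_comm]

theorem ChartOn.mono (hS : ChartOn n D S) {D' : ℕ → ℕ → Prop}
    (h : ∀ i j, D' (i + 1) j → D (i + 1) j) : ChartOn n D' S :=
  ⟨hS.zero, fun i j hij => hS.at_of i j (h i j hij)⟩

theorem TowerOn.isPencil (hD : IsLowerDomain n D) (hV : TowerOn n D V) {i j : ℕ}
    (hij : i + 1 ≤ j) (hij' : i + 1 + j ≤ 2 * n) (hl : 1 ≤ i → D i j)
    (hu : i + 1 + j < 2 * n → D (i + 1) (j + 1)) {P Q : Matrix (Fin (2 * n)) (Fin (2 * n)) ℂ}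
    {S T : Finset (Fin (2 * n))} (hP : IsGraphProj P (V i j) S)
    (hQ : i + 1 + j < 2 * n → IsGraphProj Q (V (i + 1) (j + 1)) T) {p q : Fin (2 * n)}
    (hpq : p ≠ q) (hp : p ∉ S) (hq : q ∉ S)
    (hins : upperCoords n i j S T = insert p (insert q S)) :
    IsPencil P (upperProj n i j P Q) (V i j)
      (towerUpper n i j (V i j) (V (i + 1) (j + 1))) S p q :=
  ⟨hP, hins ▸ hV.isGraphProj_upperProj hij hij' hl hu hP hQ,
    hV.lower_le_upper hD hij hij' hl hu, hpq, hp, hq⟩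

/-- The graph projection of `A ⊕ ⟨v⟩`, where `v` is the image of `(1, t)` under `pencilMap R p q`
and `P` is the graph projection of `A`. -/
def pencilProj {k : ℕ} (P R : Matrix (Fin k) (Fin k) ℂ) (p q : Fin k) (t : ℂ) :
    Matrix (Fin k) (Fin k) ℂ :=
  Matrix.of fun r c => P r c + (R r p + t * R r q) * ((if p = c then 1 else 0) - P p c)

namespace IsPencil

variable {k : ℕ} {P R : Matrix (Fin k) (Fin k) ℂ} {A B X : Submodule ℂ (Fin k → ℂ)}
  {S : Finset (Fin k)} {p q : Fin k}

theorem isGraphProj_pencilProj (h : IsPencil P R A B S p q) (t : ℂ) :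
    IsGraphProj (pencilProj P R p q t) (A ⊔ Submodule.span ℂ {pencilMap R p q ![1, t]})
      (insert p S) := by
  have := h.lower.addVector (v := pencilMap R p q ![1, t]) (p := p)
    (fun s hs => h.pencilMap_of_mem _ hs) (h.pencilMap_left _)
  convert! this using 1
  ext r c
  simp [pencilProj, pencilMap_apply]

theorem sup_span_le (h : IsPencil P R A B S p q) (z : Fin 2 → ℂ) :
    A ⊔ Submodule.span ℂ {pencilMap R p q z} ≤ B :=
  sup_le h.le ((Submodule.span_singleton_le_iff_mem _ _).2 (h.pencilMap_mem z))

theorem pencilProj_apply (h : IsPencil P R A B S p q) (t : ℂ) : pencilProj P R p q t q p = t := by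
  simp only [pencilProj, Matrix.of_apply]
  rw [h.lower.apply_of_notMem h.left_notMem, h.lower.apply_of_notMem h.left_notMem,
    h.upper.apply_of_mem (by simp), h.upper.apply_of_mem (by simp), if_neg h.ne.symm, if_pos rfl,
    if_true]
  ring

/-- A subspace between `A` and `B` that is a graph over `S ∪ {p}` is determined by one affine
coordinate. -/
theorem graphProj_eq_pencilProj (h : IsPencil P R A B S p q) (hAX : A ≤ X) (hXB : X ≤ B)
    (hX : IsGraphOver X (insert p S)) :
    graphProj X (insert p S) = pencilProj P R p q (graphProj X (insert p S) q p) := by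
  have hcol := hX.isGraphProj.col_mem p
  have hz : pencilMap R p q ![1, graphProj X (insert p S) q p] =
      fun r => graphProj X (insert p S) r p := by
    refine h.eq_pencilMap (hXB hcol) (fun t ht => ?_) ?_ rfl
    · rw [hX.isGraphProj.apply_of_mem (Finset.mem_insert_of_mem ht), if_neg]
      rintro rfl
      exact h.left_notMem ht
    · rw [hX.isGraphProj.apply_of_mem (Finset.mem_insert_self p S), if_pos rfl]
      rfl
  have hproj := h.isGraphProj_pencilProj (graphProj X (insert p S) q p)
  have hle : A ⊔ Submodule.span ℂ {pencilMap R p q ![1, graphProj X (insert p S) q p]} = X := by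
    refine Submodule.eq_of_le_of_finrank_le ?_ ?_
    · rw [hz]
      exact sup_le hAX ((Submodule.span_singleton_le_iff_mem _ _).2 hcol)
    · rw [← hX.1, hproj.isGraphOver.1]
  rw [hle] at hproj
  exact hproj.graphProj_eq

end IsPencil

theorem IsGraphProj.range_eq {k : ℕ} {P : Matrix (Fin k) (Fin k) ℂ}
    {V : Submodule ℂ (Fin k → ℂ)} {S : Finset (Fin k)} (h : IsGraphProj P V S) :
    LinearMap.range P.mulVecLin = V := by
  apply le_antisymm
  · rintro _ ⟨x, rfl⟩
    exact h.mem x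
  · exact fun v hv => ⟨v, h.mulVec_eq_self hv⟩

/-- The points of `SpR_{2n}` in the chart with label `S`. -/
def chartLocus (S : ℕ → ℕ → Finset (Fin (2 * n))) : Set (RootGr n) :=
  {V | ∀ α : Root n, IsGraphOver (V.space α) (S α.i α.j)}

theorem isOpen_chartLocus (S : ℕ → ℕ → Finset (Fin (2 * n))) : IsOpen (chartLocus S) := by
  have : chartLocus S = ⋂ α : Root n, graphLocus (m := fun _ : Root n => 2 * n) α (S α.i α.j) := by
    ext V
    simp [chartLocus, graphLocus]
  rw [this]
  exact isOpen_iInter_of_finite fun α => isOpen_graphLocus _ _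

theorem mem_SpR_iff {V : RootGr n} :
    V ∈ SpR n ↔ TowerOn n (fullDomain n) (extendZero (fun α : Root n => α) V) := by
  rw [SpR_eq_towerSet]
  exact (mem_towerSet_iff (r := fun α : Root n => α) Function.injective_id
    (isLowerDomain_id n)).trans (by rw [rootDomain_id])

theorem extendZero_id_apply (V : RootGr n) (α : Root n) :
    extendZero (fun α : Root n => α) V α.i α.j = V.space α :=
  extendZero_apply Function.injective_id V α

theorem isGraphOver_extendZero (hS : ∀ j, S 0 j = ∅) {V : RootGr n} (hV : V ∈ chartLocus S)
    {i j : ℕ} (h : 1 ≤ i → fullDomain n i j) :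
    IsGraphOver (extendZero (fun α : Root n => α) V i j) (S i j) := by
  cases i with
  | zero =>
    rw [extendZero_zero, hS]
    exact isGraphOver_bot
  | succ i => exact extendZero_id_apply V (mkRoot (h (by omega))) ▸ hV (mkRoot (h (by omega)))

/-- The charts cover `SpR_{2n}`. -/
theorem exists_mem_chartLocus {V : RootGr n} (hV : V ∈ SpR n) :
    ∃ S, ChartOn n (fullDomain n) S ∧ V ∈ chartLocus S := by
  obtain ⟨S, hS, hVS⟩ := (mem_SpR_iff.1 hV).exists_chartOn (isLowerDomain_fullDomain n)
  refine ⟨S, hS, fun α => ?_⟩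
  rw [← extendZero_id_apply V α]
  exact hVS α.i α.j fun _ => α.fullDomain

theorem IsPolyFun.upperProj {κ : Type} {n i j : ℕ}
    {P Q : (κ → ℂ) → Matrix (Fin (2 * n)) (Fin (2 * n)) ℂ}
    (hP : ∀ r c, IsPolyFun fun t => P t r c) (hQ : ∀ r c, IsPolyFun fun t => Q t r c)
    (r c : Fin (2 * n)) : IsPolyFun fun t => upperProj n i j (P t) (Q t) r c := by
  simp only [_root_.upperProj, Matrix.of_apply]
  by_cases h : 2 * n ≤ i + 1 + j
  · simp only [if_pos h]
    exact (IsPolyFun.const _).sub ((IsPolyFun.const _).mul (hP _ _))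
  · simp only [if_neg h]
    exact (hQ _ _).add (IsPolyFun.const _)

/-- The graph projections in a chart are polynomial functions of one affine coordinate for each
root. -/
theorem exists_chart_projections (p q : Root n → Fin (2 * n)) :
    ∃ C : ℕ → ℕ → (Root n → ℂ) → Matrix (Fin (2 * n)) (Fin (2 * n)) ℂ,
      (∀ j t, C 0 j t = 0) ∧
      (∀ i j (h : fullDomain n (i + 1) j) t, C (i + 1) j t =
        pencilProj (C i j t) (upperProj n i j (C i j t) (C (i + 1) (j + 1) t)) (p (mkRoot h))
          (q (mkRoot h)) (t (mkRoot h))) ∧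
      ∀ i j, (1 ≤ i → fullDomain n i j) → ∀ r c, IsPolyFun fun t => C i j t r c := by
  classical
  obtain ⟨C, hC0, hC⟩ := exists_tower_family (2 * n)
    (fun _ => 0 : (Root n → ℂ) → Matrix (Fin (2 * n)) (Fin (2 * n)) ℂ)
    fun i j a b x => ((∀ r c, IsPolyFun fun t => a t r c) →
      (i + 1 + j < 2 * n → ∀ r c, IsPolyFun fun t => b t r c) →
        ∀ r c, IsPolyFun fun t => x t r c) ∧
      ∀ (h : fullDomain n (i + 1) j) t, x t = pencilProj (a t) (upperProj n i j (a t) (b t))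
        (p (mkRoot h)) (q (mkRoot h)) (t (mkRoot h))
  have hex : ∀ i j (a b : (Root n → ℂ) → Matrix (Fin (2 * n)) (Fin (2 * n)) ℂ),
      fullDomain n (i + 1) j →
      ∃ x : (Root n → ℂ) → Matrix (Fin (2 * n)) (Fin (2 * n)) ℂ,
        ((∀ r c, IsPolyFun fun t => a t r c) →
          (i + 1 + j < 2 * n → ∀ r c, IsPolyFun fun t => b t r c) →
            ∀ r c, IsPolyFun fun t => x t r c) ∧
        ∀ (h : fullDomain n (i + 1) j) t, x t = pencilProj (a t) (upperProj n i j (a t) (b t))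
          (p (mkRoot h)) (q (mkRoot h)) (t (mkRoot h)) := by
    intro i j a b h
    refine ⟨fun t => pencilProj (a t) (upperProj n i j (a t) (b t))
      (p (mkRoot h)) (q (mkRoot h)) (t (mkRoot h)), fun ha hb r c => ?_, fun _ _ => rfl⟩
    have hR : ∀ r c, IsPolyFun fun t => upperProj n i j (a t) (b t) r c := by
      intro r c
      by_cases hlt : i + 1 + j < 2 * n
      · exact IsPolyFun.upperProj ha (hb hlt) r c
      · have : ∀ t, upperProj n i j (a t) (b t) r c = upperProj n i j (a t) (0 : _) r c := by
          intro t
          simp only [upperProj, Matrix.of_apply]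
          simp only [if_pos (show 2 * n ≤ i + 1 + j by omega)]
        simp only [this]
        exact IsPolyFun.upperProj ha (fun _ _ => IsPolyFun.const 0) r c
    exact (ha r c).add (((hR r _).add ((IsPolyFun.coord _).mul (hR r _))).mul
      ((IsPolyFun.const _).sub (ha _ c)))
  have hC' : ∀ i j, fullDomain n (i + 1) j → _ := fun i j h =>
    hC i j (by have := h.2.2; omega) (hex i j _ _ h)
  refine ⟨C, fun j t => by rw [hC0], fun i j h t => (hC' i j h).2 h t, fun i j h => ?_⟩
  have h0 : ∀ j r c, IsPolyFun fun t => C 0 j t r c := fun j r c => by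
    rw [hC0]
    exact IsPolyFun.const 0
  have key : ∀ i j, fullDomain n (i + 1) j → ∀ r c, IsPolyFun fun t => C (i + 1) j t r c := by
    refine (isLowerDomain_fullDomain n).induction fun D' hD' hsub ih i j hij hl hu => ?_
    refine (hC' i j hij).1 ?_ fun h => ih i (j + 1) (hu h)
    cases i with
    | zero => exact h0 j
    | succ i => exact ih i j (hl (by omega))
  cases i with
  | zero => exact h0 j
  | succ i => exact key i j (h (by omega))

/-- Every chart of `SpR_{2n}` is an affine space. -/
theorem ChartOn.exists_isAffineChart (hS : ChartOn n (fullDomain n) S) :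
    ∃ (ψ : Root n → RootGr n → ℂ) (φ : _ → MvPolynomial (Root n) ℂ),
      IsAffineChart (SpR n) (chartLocus S) ψ φ := by
  have hD := isLowerDomain_fullDomain n
  have hins : ∀ α : Root n, ∃ p q, ∀ i, α.i = i + 1 → p ≠ q ∧ p ∉ S i α.j ∧ q ∉ S i α.j ∧
      S (i + 1) α.j = insert p (S i α.j) ∧
      upperCoords n i α.j (S i α.j) (S (i + 1) (α.j + 1)) = insert p (insert q (S i α.j)) := by
    intro α
    obtain ⟨i, hi⟩ := Nat.exists_eq_add_of_le' α.2.1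
    change α.i = i + 1 at hi
    have hα := α.fullDomain
    rw [hi] at hα
    obtain ⟨p, q, h⟩ := hS.exists_insert hD hα.2.1 hα.2.2
      (fun h => by unfold fullDomain at *; omega) (hD.up i _ hα) (hS.at_of i _ hα)
    refine ⟨p, q, fun i' hi' => ?_⟩
    obtain rfl : i = i' := by omega
    exact h
  choose p q hpq using hins
  obtain ⟨C, hC0, hC, hCpoly⟩ := exists_chart_projections p q
  have hleft : ∀ i j, fullDomain n (i + 1) j → 1 ≤ i → fullDomain n i j := fun i j h h' => by
    unfold fullDomain at *
    omega
  -- the pencil at each step, once the preceding projections are known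
  have hpencil : ∀ (D' : ℕ → ℕ → Prop) (V : ℕ → ℕ → Submodule ℂ (Fin (2 * n) → ℂ)) (t : _),
      IsLowerDomain n D' → TowerOn n D' V →
      (∀ i j, D' (i + 1) j → IsGraphProj (C (i + 1) j t) (V (i + 1) j) (S (i + 1) j)) →
      ∀ i j (h : fullDomain n (i + 1) j), (1 ≤ i → D' i j) →
        (i + 1 + j < 2 * n → D' (i + 1) (j + 1)) →
        IsPencil (C i j t) (upperProj n i j (C i j t) (C (i + 1) (j + 1) t)) (V i j)
          (towerUpper n i j (V i j) (V (i + 1) (j + 1))) (S i j) (p (mkRoot h))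
          (q (mkRoot h)) := by
    intro D' V t hD' hV hCV i j h hl hu
    obtain ⟨h1, h2, h3, h4, h5⟩ := hpq (mkRoot h) i rfl
    refine hV.isPencil hD' h.2.1 h.2.2 hl hu ?_ (fun h => hCV i (j + 1) (hu h)) h1 h2 h3 h5
    cases i with
    | zero =>
      rw [hC0, hV.zero, hS.zero]
      exact ⟨fun x => by simp, by simp, isGraphOver_bot.2⟩
    | succ i => exact hCV i j (hl (by omega))
  -- the point of the chart with coordinates `t`
  let W : (Root n → ℂ) → ℕ → ℕ → Submodule ℂ (Fin (2 * n) → ℂ) := fun t i j =>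
    LinearMap.range (C i j t).mulVecLin
  have hW0 : ∀ t j, W t 0 j = ⊥ := fun t j => by
    simp only [W]
    rw [hC0, Matrix.mulVecLin_zero, LinearMap.range_zero]
  have hW : ∀ t i j, fullDomain n (i + 1) j → TowerAt n (W t) i j ∧
      IsGraphProj (C (i + 1) j t) (W t (i + 1) j) (S (i + 1) j) := by
    intro t
    refine hD.induction fun D' hD' hsub ih i j hij hl hu => ?_
    have h := hpencil D' (W t) t hD' ⟨hW0 t, fun i j h => (ih i j h).1⟩
      (fun i j h => (ih i j h).2) i j hij hl hu
    have hproj := h.isGraphProj_pencilProj (t (mkRoot hij))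
    have hSins : S (i + 1) j = insert (p (mkRoot hij)) (S i j) := (hpq (mkRoot hij) i rfl).2.2.2.1
    rw [← hC i j hij t, ← hSins] at hproj
    have hWe := hproj.range_eq
    change W t (i + 1) j = _ at hWe
    rw [← hWe] at hproj
    refine ⟨⟨?_, ?_, ?_⟩, hproj⟩
    · rw [← hproj.isGraphOver.1, (hS.at_of i j hij).card_eq]
    · rw [hWe]
      exact le_sup_left
    · rw [hWe]
      exact h.sup_span_le _
  have hWT : ∀ t, TowerOn n (rootDomain fun α : Root n => α) (W t) := fun t => by
    rw [rootDomain_id]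
    exact ⟨hW0 t, fun i j h => (hW t i j h).1⟩
  let e : ∀ α : Root n, Fin α.i ≃ S α.i α.j := fun α =>
    (Finset.equivFinOfCardEq (hS.card_lower fun _ => α.fullDomain)).symm
  have hφ : ∀ x : FrameIdx (fun _ : Root n => 2 * n) (fun α => α.i),
      IsPolyFun fun t => C x.1.i x.1.j t x.2.1 (e x.1 x.2.2) := fun x =>
    hCpoly _ _ (fun _ => x.1.fullDomain) _ _
  choose φ hφ using hφ
  have hroot : ∀ α : Root n, ∃ i j, ∃ h : fullDomain n (i + 1) j, α = mkRoot h := by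
    intro α
    obtain ⟨i, hi⟩ := Nat.exists_eq_add_of_le' α.2.1
    change α.i = i + 1 at hi
    exact ⟨i, α.j, hi ▸ α.fullDomain, Root.ext_ij hi rfl⟩
  have hWproj : ∀ (t : _) (α : Root n), IsGraphProj (C α.i α.j t) (W t α.i α.j) (S α.i α.j) := by
    intro t α
    obtain ⟨i, j, h, rfl⟩ := hroot α
    exact (hW t i j h).2
  refine ⟨fun (α : Root n) (V : RootGr n) => graphProj (V.space α) (S α.i α.j) (q α) (p α), φ,
    isOpen_chartLocus S,
    fun α => (isRegularOn_graphProj (m := fun _ : Root n => 2 * n) α _ _ _).mono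
      fun V hV => hV.2 α, fun t => ?_, fun V hV V' hV' hψ => ?_⟩
  · obtain ⟨A, hA, hAW⟩ := (hWT t).toFamGr.exists_frame_of_span
      (fun x => MvPolynomial.eval t (φ x)) (by
        intro α
        refine Eq.trans ?_ (hWproj t α).span_col
        simp only [← hφ]
        exact congrArg (fun s : Set (Fin (2 * n) → ℂ) => Submodule.span ℂ s)
          ((e α).surjective.range_comp fun (s : S α.i α.j) (r : Fin (2 * n)) => C α.i α.j t r s))
    refine ⟨A, hA, ?_⟩
    rw [hAW]
    refine ⟨⟨(hWT t).toFamGr_mem Function.injective_id (isLowerDomain_id n),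
      fun α => (hWproj t α).isGraphOver⟩, fun α => ?_⟩
    change graphProj (W t α.i α.j) _ _ _ = _
    rw [(hWproj t α).graphProj_eq]
    obtain ⟨i, j, h, rfl⟩ := hroot α
    refine (congrFun (congrFun (hC i j h t) _) _).trans ?_
    exact (hpencil (fullDomain n) (W t) t hD (rootDomain_id ▸ hWT t) (fun i j h => (hW t i j h).2)
      i j h (hleft i j h) (hD.up i j h)).pencilProj_apply _
  · -- both collections have the graph projections given by their common coordinates
    have key : ∀ X : RootGr n, X ∈ SpR n ∩ chartLocus S → ∀ t : Root n → ℂ,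
        (∀ α, graphProj (X.space α) (S α.i α.j) (q α) (p α) = t α) →
        ∀ i j, fullDomain n (i + 1) j → IsGraphProj (C (i + 1) j t)
          (extendZero (fun α : Root n => α) X (i + 1) j) (S (i + 1) j) := by
      rintro X ⟨hX, hXS⟩ t ht
      rw [mem_SpR_iff] at hX
      refine hD.induction fun D' hD' hsub ih i j hij hl hu => ?_
      have hX' : TowerOn n D' (extendZero (fun α : Root n => α) X) :=
        ⟨hX.zero, fun i j h => hX.at_of i j (hsub i j h)⟩
      have h := hpencil D' _ t hD' hX' ih i j hij hl hu
      have hat := hX.at_of i j hij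
      have hg := isGraphOver_extendZero hS.zero hXS (i := i + 1) (j := j) fun _ => hij
      have hSins : S (i + 1) j = insert (p (mkRoot hij)) (S i j) :=
        (hpq (mkRoot hij) i rfl).2.2.2.1
      have ht' := ht (mkRoot hij)
      rw [← extendZero_id_apply X] at ht'
      change graphProj (extendZero (fun α : Root n => α) X (i + 1) j) (S (i + 1) j) _ _ = _ at ht'
      have hproj := hg.isGraphProj
      rw [hSins] at hg ht'
      have := h.graphProj_eq_pencilProj hat.lower hat.upper hg
      rw [ht', ← hC i j hij t, ← hSins] at this
      rwa [this] at hproj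
    refine MultiGr.ext (funext fun α => ?_)
    have h1 := fun i j h => (key V hV _ (fun _ => rfl) i j h).range_eq
    have h2 := fun i j h => (key V' hV' _ (fun α => (hψ α).symm) i j h).range_eq
    rw [← extendZero_id_apply V, ← extendZero_id_apply V']
    obtain ⟨i, j, h, rfl⟩ := hroot α
    exact (h1 i j h).symm.trans (h2 i j h)

theorem isSmoothVariety_SpR (n : ℕ) : IsSmoothVariety (SpR n) := by
  intro V hV
  obtain ⟨S, hS, hVS⟩ := exists_mem_chartLocus hV
  obtain ⟨ψ, φ, h⟩ := hS.exists_isAffineChart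
  exact h.isRegularLocalRing ⟨hV, hVS⟩

end TowerCharts

/-! ### Irreducibility -/

/-- On the projective line of subspaces between `A` and `B`, the points of a chart that lie in a
second chart are those outside a proper closed subset. -/
theorem IsPencil.exists_isGraphOver_two {k : ℕ} {P R P' R' : Matrix (Fin k) (Fin k) ℂ}
    {A B : Submodule ℂ (Fin k → ℂ)} {S S' : Finset (Fin k)} {p q p' q' : Fin k}
    (h : IsPencil P R A B S p q) (h' : IsPencil P' R' A B S' p' q') :
    ∃ X, A ≤ X ∧ X ≤ B ∧ IsGraphOver X (insert p S) ∧ IsGraphOver X (insert p' S') := by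
  -- a functional that vanishes on `A`
  let μ : (Fin k → ℂ) →ₗ[ℂ] ℂ :=
    LinearMap.proj p' - (LinearMap.proj p').comp P'.mulVecLin
  have hμ : ∀ x, μ x = x p' - P'.mulVec x p' := fun x => rfl
  have hμA : ∀ a ∈ A, μ a = 0 := fun a ha => by rw [hμ, h'.lower.mulVec_eq_self ha, sub_self]
  have hμS : ∀ x : Fin k → ℂ, (∀ s ∈ S', x s = 0) → μ x = x p' := fun x hx => by
    rw [hμ, h'.lower.eq_of_agree (v := 0) A.zero_mem fun s hs => (hx s hs).symm, Pi.zero_apply,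
      sub_zero]
  obtain ⟨c, hc⟩ : ∃ c : ℂ, μ (pencilMap R p q ![1, c]) ≠ 0 := by
    by_contra! hcon
    have hz : ∀ z, μ (pencilMap R p q z) = 0 := by
      intro z
      have : z = (z 0 - z 1) • ![1, 0] + z 1 • ![1, 1] := by
        ext a
        fin_cases a <;> simp
      rw [this, map_add, map_add, map_smul, map_smul, map_smul, map_smul, hcon, hcon]
      simp
    have hw := h'.pencilMap_mem ![1, 0]
    have h1 : μ (pencilMap R' p' q' ![1, 0]) = 1 := by
      rw [hμS _ fun s hs => h'.pencilMap_of_mem _ hs, h'.pencilMap_left]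
      rfl
    rw [← h.sup_map_comap h.le le_rfl] at hw
    obtain ⟨a, ha, _, ⟨z, -, rfl⟩, haw⟩ := Submodule.mem_sup.1 hw
    rw [← haw, map_add, hμA a ha, hz, add_zero] at h1
    exact zero_ne_one h1
  have hg := (h.isGraphProj_pencilProj c).isGraphOver
  refine ⟨_, le_sup_left, h.sup_span_le ![1, c], hg, ?_, fun x hx hxS => ?_⟩
  · rw [← hg.1, Finset.card_insert_of_notMem h.left_notMem,
      Finset.card_insert_of_notMem h'.left_notMem, h.lower.isGraphOver.1, h'.lower.isGraphOver.1]
  · obtain ⟨a, ha, v, hv, rfl⟩ := Submodule.mem_sup.1 hx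
    obtain ⟨z, rfl⟩ := Submodule.mem_span_singleton.1 hv
    have h1 := hμS _ fun s hs => hxS s (Finset.mem_insert_of_mem hs)
    rw [hxS p' (Finset.mem_insert_self _ _), map_add, map_smul, hμA a ha, zero_add,
      smul_eq_mul] at h1
    rw [(mul_eq_zero.1 h1).resolve_right hc, zero_smul, add_zero] at hxS ⊢
    exact h'.lower.inj a ha fun s hs => hxS s (Finset.mem_insert_of_mem hs)

section Irreducible

variable {n : ℕ} {S S' : ℕ → ℕ → Finset (Fin (2 * n))}

/-- Any two charts of `SpR_{2n}` meet. -/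
theorem ChartOn.exists_mem_inter (hS : ChartOn n (fullDomain n) S)
    (hS' : ChartOn n (fullDomain n) S') : ∃ V ∈ SpR n, V ∈ chartLocus S ∧ V ∈ chartLocus S' := by
  obtain ⟨V, hV, hVS⟩ := exists_towerOn (isLowerDomain_id n)
    (fun i j X => IsGraphOver X (S i j) ∧ IsGraphOver X (S' i j)) (by
      intro D' V hD' hV hsub hΦ i j hij hl hu
      rw [rootDomain_id] at hsub hij
      have hm := hS.mono hsub
      have hm' := hS'.mono hsub
      obtain ⟨p, q, h1, h2, h3, h4, h5⟩ := hm.exists_insert hD' hij.2.1 hij.2.2 hl hu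
        (hS.at_of i j hij)
      obtain ⟨p', q', h1', h2', h3', h4', h5'⟩ := hm'.exists_insert hD' hij.2.1 hij.2.2 hl hu
        (hS'.at_of i j hij)
      have hlow : IsGraphOver (V i j) (S i j) ∧ IsGraphOver (V i j) (S' i j) := by
        cases i with
        | zero =>
          rw [hV.zero, hS.zero, hS'.zero]
          exact ⟨isGraphOver_bot, isGraphOver_bot⟩
        | succ i => exact hΦ i j (hl (by omega))
      have hpen := hV.isPencil hD' hij.2.1 hij.2.2 hl hu hlow.1.isGraphProj
        (fun h => (hΦ i (j + 1) (hu h)).1.isGraphProj) h1 h2 h3 h5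
      have hpen' := hV.isPencil hD' hij.2.1 hij.2.2 hl hu hlow.2.isGraphProj
        (fun h => (hΦ i (j + 1) (hu h)).2.isGraphProj) h1' h2' h3' h5'
      -- the two pencils are between the same subspaces
      obtain ⟨X, hAX, hXB, hX, hX'⟩ := hpen.exists_isGraphOver_two hpen'
      refine ⟨X, ?_, hAX, hXB, h4 ▸ hX, h4' ▸ hX'⟩
      rw [← hX.1, ← h4, (hS.at_of i j hij).card_eq])
  rw [rootDomain_id] at hVS
  have key : ∀ α : Root n, IsGraphOver (V α.i α.j) (S α.i α.j) ∧
      IsGraphOver (V α.i α.j) (S' α.i α.j) := by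
    intro α
    obtain ⟨i, hi⟩ := Nat.exists_eq_add_of_le' α.2.1
    change α.i = i + 1 at hi
    have := hVS i α.j (hi ▸ α.fullDomain)
    rwa [← hi] at this
  exact ⟨hV.toFamGr, hV.toFamGr_mem Function.injective_id (isLowerDomain_id n),
    fun α => (key α).1, fun α => (key α).2⟩

theorem isIrreducible_SpR (n : ℕ) : IsIrreducible (SpR n) := by
  have hirr : ∀ {S}, ChartOn n (fullDomain n) S → IsIrreducible (SpR n ∩ chartLocus S) := by
    intro S hS
    obtain ⟨ψ, φ, h⟩ := hS.exists_isAffineChart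
    exact h.isIrreducible
  refine ⟨SpR_nonempty n, ?_⟩
  rintro O O' hO hO' ⟨V, hV, hVO⟩ ⟨V', hV', hVO'⟩
  obtain ⟨S, hS, hVS⟩ := exists_mem_chartLocus hV
  obtain ⟨S', hS', hVS'⟩ := exists_mem_chartLocus hV'
  obtain ⟨X, hX, hXS, hXS'⟩ := hS.exists_mem_inter hS'
  -- a point of `O` in both charts
  obtain ⟨Y, ⟨hY, -⟩, hYO, hYS'⟩ := (hirr hS).2 O (chartLocus S') hO (isOpen_chartLocus S')
    ⟨V, ⟨hV, hVS⟩, hVO⟩ ⟨X, ⟨hX, hXS⟩, hXS'⟩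
  obtain ⟨Z, ⟨hZ, -⟩, hZO⟩ := (hirr hS').2 O O' hO hO' ⟨Y, ⟨hY, hYS'⟩, hYO⟩
    ⟨V', ⟨hV', hVS'⟩, hVO'⟩
  exact ⟨Z, hZ, hZO⟩

end Irreducible

/-! ### Surjectivity of the map to the degenerate flag variety -/

section LinearAlgebra

theorem finrank_le_finrank_inf_ker_add_one {k : ℕ} (X : Submodule ℂ (Fin k → ℂ))
    (φ : (Fin k → ℂ) →ₗ[ℂ] ℂ) :
    Module.finrank ℂ X ≤ Module.finrank ℂ (X ⊓ LinearMap.ker φ : Submodule ℂ (Fin k → ℂ)) + 1 := by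
  have h1 := (φ.comp X.subtype).finrank_range_add_finrank_ker
  have h2 := Submodule.finrank_le (LinearMap.range (φ.comp X.subtype))
  rw [Module.finrank_self] at h2
  rw [← Submodule.map_comap_subtype, ← LinearMap.ker_comp, Submodule.finrank_map_subtype_eq]
  omega

/-- An isotropic subspace of the symplectic space `W_{i+1,j}`, `(i + 1) + j = 2n`, is contained in
a Lagrangian subspace. -/
theorem exists_isotropic_extension {n i j : ℕ} (hle : i + 1 ≤ j) (hij : i + 1 + j = 2 * n)
    {A : Submodule ℂ (Fin (2 * n) → ℂ)} (hA : IsIsotropic n A)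
    (hAW : A ≤ coordSubspace n (i + 1) j) (hrank : Module.finrank ℂ A ≤ i + 1) :
    ∃ Y, A ≤ Y ∧ Y ≤ coordSubspace n (i + 1) j ∧ IsIsotropic n Y ∧
      Module.finrank ℂ Y = i + 1 := by
  suffices h : ∀ e, Module.finrank ℂ A ≤ e → e ≤ i + 1 → ∃ Y, A ≤ Y ∧
      Y ≤ coordSubspace n (i + 1) j ∧ IsIsotropic n Y ∧ Module.finrank ℂ Y = e from
    h (i + 1) hrank le_rfl
  intro e he
  induction e, he using Nat.le_induction with
  | base => exact fun _ => ⟨A, le_rfl, hAW, hA, rfl⟩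
  | succ e he ih =>
    intro hei
    obtain ⟨Y, hAY, hYW, hY, hYe⟩ := ih (by omega)
    -- the orthogonal complement of `Y` in `W_{i+1,j}` has dimension at least `2 (i + 1) - e`
    obtain ⟨S, hS⟩ := exists_isGraphOver Y
    have hupper := (isGraphProj_upperProj_of_eq (B := ⊥) (Q := 0) (T := ∅) hij hS.isGraphProj
      hYW).isGraphOver
    have hcard : 2 * (i + 1) - e ≤ (upperCoords n i j S ∅).card := by
      have h1 := Finset.le_card_sdiff (S.map Fin.revPerm.toEmbedding)
        ({t | t.1 < i + 1 ∨ j ≤ t.1} : Finset (Fin (2 * n)))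
      rw [card_outer_coords hle hij, Finset.card_map, hS.1, hYe] at h1
      refine h1.trans (Finset.card_le_card fun t ht => ?_)
      rw [Finset.mem_sdiff, Finset.mem_map_equiv, Finset.mem_filter] at ht
      exact mem_upperCoords.2 ⟨ht.1.2, by rw [if_pos hij.ge]; exact ht.2⟩
    rw [hupper.1] at hcard
    obtain ⟨v, ⟨hvW, hv⟩, hvY⟩ := exists_notMem_of_finrank_lt (A := Y)
      (V := towerUpper n i j Y ⊥) (by omega)
    rw [if_pos hij.ge] at hv
    have hrank' := Submodule.finrank_sup_span_singleton hvY
    refine ⟨Y ⊔ Submodule.span ℂ {v}, hAY.trans le_sup_left,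
      sup_le hYW ((Submodule.span_singleton_le_iff_mem _ _).2 hvW),
      isIsotropic_of_le_sympPerp le_sup_left ?_ hrank', by rw [hrank', hYe]⟩
    exact sup_le (fun y hy x hx => hY x hx y hy) ((Submodule.span_singleton_le_iff_mem _ _).2 hv)

end LinearAlgebra

section Forget

variable {n : ℕ}

/-- The projection `pr_{i+1} ∘ ⋯ ∘ pr_j`: it replaces the coefficients of `w_{i+1}, …, w_j`
by `0`. -/
def prRange (n i j : ℕ) : (Fin (2 * n) → ℂ) →ₗ[ℂ] (Fin (2 * n) → ℂ) where
  toFun x t := if i < t.1 + 1 ∧ t.1 + 1 ≤ j then 0 else x t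
  map_add' x y := by
    ext t
    simp only [Pi.add_apply]
    split_ifs <;> simp
  map_smul' c x := by
    ext t
    simp only [Pi.smul_apply, RingHom.id_apply]
    split_ifs <;> simp

theorem prRange_apply (i j : ℕ) (x : Fin (2 * n) → ℂ) (t : Fin (2 * n)) :
    prRange n i j x t = if i < t.1 + 1 ∧ t.1 + 1 ≤ j then 0 else x t := rfl

theorem prOuter_eq_prRange (i : ℕ) : prOuter n i = prRange n i (2 * n - i) := rfl

theorem prRange_self (i : ℕ) : prRange n i i = LinearMap.id := by
  refine LinearMap.ext fun x => funext fun t => ?_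
  rw [prRange_apply, if_neg (by omega), LinearMap.id_apply]

theorem pr_comp_prRange {i j : ℕ} (hij : i ≤ j) :
    (pr n (j + 1)).comp (prRange n i j) = prRange n i (j + 1) := by
  refine LinearMap.ext fun x => funext fun t => ?_
  simp only [LinearMap.comp_apply, pr_apply, prRange_apply]
  split_ifs <;> first | rfl | omega

theorem prRange_comp_pr {i j : ℕ} (hij : i + 1 ≤ j) :
    (prRange n (i + 1) j).comp (pr n (i + 1)) = prRange n i j := by
  refine LinearMap.ext fun x => funext fun t => ?_
  simp only [LinearMap.comp_apply, pr_apply, prRange_apply]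
  split_ifs <;> first | rfl | omega

theorem map_prRange_le_coordSubspace (i j : ℕ) (X : Submodule ℂ (Fin (2 * n) → ℂ)) :
    X.map (prRange n i j) ≤ coordSubspace n i j := by
  rintro _ ⟨x, -, rfl⟩ t h1 h2
  rw [prRange_apply, if_pos ⟨h1, h2⟩]

theorem isIsotropic_mono {A B : Submodule ℂ (Fin (2 * n) → ℂ)} (hB : IsIsotropic n B)
    (h : A ≤ B) : IsIsotropic n A := fun x hx y hy => hB x (h hx) y (h hy)

/-- The subspace `V_{i,i}` of a point of `SpR_{2n}` determines a part of `V_{i,j}`. -/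
theorem map_prRange_le {V : RootGr n} (hV : V ∈ SpR n) {α β : Root n} (hα : α.i = α.j)
    (hβ : β.i = α.i) : (V.space α).map (prRange n β.i β.j) ≤ V.space β := by
  have key : ∀ j, α.i ≤ j → ∀ β : Root n, β.i = α.i → β.j = j →
      (V.space α).map (prRange n β.i β.j) ≤ V.space β := by
    intro j hj
    induction j, hj using Nat.le_induction with
    | base =>
      intro β h1 h2
      obtain rfl : β = α := Root.ext_ij h1 (h2.trans hα)
      rw [← hα, prRange_self, Submodule.map_id]
    | succ j hj ih =>
      intro β h1 h2
      have hβ := β.fullDomain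
      have h0 := α.2.1
      have hdom : fullDomain n α.i j := by
        unfold fullDomain at *
        omega
      refine le_trans ?_ (hV.2.2.1 (mkRoot hdom) β h1 h2)
      rw [h1, h2, ← pr_comp_prRange hj, Submodule.map_comp]
      exact Submodule.map_mono (ih (mkRoot hdom) rfl rfl)
  exact key β.j (hβ ▸ β.2.2.1) β hβ rfl

theorem mapsTo_forget (n : ℕ) : Set.MapsTo (forget n) (SpR n) (SpFlag n) := by
  intro V hV
  refine ⟨fun i => ?_, fun i i' h => ?_⟩
  · have hdom : fullDomain n (i.1 + 1) (2 * n - (i.1 + 1)) := by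
      unfold fullDomain
      omega
    refine isIsotropic_mono (hV.2.2.2 (mkRoot hdom) ?_)
      (map_prRange_le hV (α := diagRoot i) (β := mkRoot hdom) rfl rfl)
    change i.1 + 1 + (2 * n - (i.1 + 1)) = _
    omega
  · have hdom : fullDomain n (i.1 + 1) (i.1 + 2) := by
      unfold fullDomain
      omega
    rw [h]
    exact (hV.2.2.1 (diagRoot i) (mkRoot hdom) rfl rfl).trans
      (hV.2.1 (mkRoot hdom) (diagRoot i')
        (congrArg (· + 1) h) (congrArg (· + 1) h))

/-- The subspaces `X i = V_{i,i+d}`, `2 i + d ≤ 2 n`, satisfy the conditions under which they can be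
completed by subspaces `V_{i,i+d+1}`. -/
structure IsDiagonal (n d : ℕ) (X : ℕ → Submodule ℂ (Fin (2 * n) → ℂ)) : Prop where
  finrank_eq : ∀ i, 1 ≤ i → 2 * i + d ≤ 2 * n → Module.finrank ℂ (X i) = i
  le_coordSubspace : ∀ i, 1 ≤ i → 2 * i + d ≤ 2 * n → X i ≤ coordSubspace n i (i + d)
  map_le : ∀ i, 1 ≤ i → 2 * (i + 1) + d ≤ 2 * n → (X i).map (pr n (i + d + 1)) ≤ X (i + 1)
  isIsotropic : ∀ i, 1 ≤ i → 2 * i + d = 2 * n → IsIsotropic n (X i)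
  isIsotropic_map : ∀ i, 1 ≤ i → 2 * i + d + 1 = 2 * n →
    IsIsotropic n ((X i).map (pr n (i + d + 1)))

theorem IsDiagonal.exists_next {d : ℕ} {X : ℕ → Submodule ℂ (Fin (2 * n) → ℂ)}
    (h : IsDiagonal n d X) : ∃ Y, IsDiagonal n (d + 1) Y ∧
      (∀ i, 1 ≤ i → 2 * i + d + 1 ≤ 2 * n → (X i).map (pr n (i + d + 1)) ≤ Y i) ∧
      (∀ i, 1 ≤ i → 2 * (i + 1) + d ≤ 2 * n → Y i ≤ X (i + 1)) := by
  have hex : ∀ i, ∃ Y : Submodule ℂ (Fin (2 * n) → ℂ), 1 ≤ i → 2 * i + d + 1 ≤ 2 * n →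
      (X i).map (pr n (i + d + 1)) ≤ Y ∧ Y ≤ coordSubspace n i (i + d + 1) ∧
      Module.finrank ℂ Y = i ∧ (2 * (i + 1) + d ≤ 2 * n → Y ≤ X (i + 1)) ∧
      (2 * i + d + 1 = 2 * n → IsIsotropic n Y) := by
    intro i
    by_cases hi : 1 ≤ i ∧ 2 * i + d + 1 ≤ 2 * n
    · obtain ⟨hi, hid⟩ := hi
      have hrank : Module.finrank ℂ ((X i).map (pr n (i + d + 1))) ≤ i :=
        (Submodule.finrank_map_le _ _).trans (h.finrank_eq i hi (by omega)).le
      have hW : (X i).map (pr n (i + d + 1)) ≤ coordSubspace n i (i + d + 1) := by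
        rintro _ ⟨x, hx, rfl⟩ t h1 h2
        rw [pr_apply]
        by_cases ht : t.1 + 1 = i + d + 1
        · rw [if_pos ht]
        · rw [if_neg ht]
          exact h.le_coordSubspace i hi (by omega) hx t h1 (by omega)
      by_cases hid' : 2 * i + d + 1 = 2 * n
      · obtain ⟨i, rfl⟩ := Nat.exists_eq_add_of_le' hi
        obtain ⟨Y, h1, h2, h3, h4⟩ := exists_isotropic_extension (by omega) (by omega)
          (h.isIsotropic_map _ hi hid') hW hrank
        exact ⟨Y, fun _ _ => ⟨h1, h2, h4, fun h => by omega, fun _ => h3⟩⟩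
      · -- the condition for a vector of `V_{i+1,j}` to lie in `W_{i,j}` is one linear equation
        have hker : X (i + 1) ⊓ LinearMap.ker (LinearMap.proj (R := ℂ) (φ := fun _ => ℂ)
            (⟨i, by omega⟩ : Fin (2 * n))) ≤ X (i + 1) ⊓ coordSubspace n i (i + d + 1) := by
          rintro x ⟨hx, hx0⟩
          refine ⟨hx, fun t h1 h2 => ?_⟩
          by_cases ht : t.1 = i
          · rw [show t = ⟨i, by omega⟩ from Fin.ext ht]
            exact hx0
          · exact h.le_coordSubspace (i + 1) (by omega) (by omega) hx t (by omega) (by omega)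
        have h1 := finrank_le_finrank_inf_ker_add_one (X (i + 1))
          (LinearMap.proj (R := ℂ) (φ := fun _ => ℂ) (⟨i, by omega⟩ : Fin (2 * n)))
        rw [h.finrank_eq (i + 1) (by omega) (by omega)] at h1
        have h2 := Submodule.finrank_mono hker
        obtain ⟨Y, hY, hY', hrankY⟩ := exists_intermediate_subspace
          (le_inf (h.map_le i hi (by omega)) hW) hrank (show i ≤ _ by omega)
        exact ⟨Y, fun _ _ => ⟨hY, hY'.trans inf_le_right, hrankY,
          fun _ => hY'.trans inf_le_left, fun h => absurd h hid'⟩⟩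
    · exact ⟨⊥, fun h1 h2 => absurd ⟨h1, h2⟩ hi⟩
  choose Y hY using hex
  refine ⟨Y, ⟨fun i hi hid => (hY i hi (by omega)).2.2.1,
    fun i hi hid => (hY i hi (by omega)).2.1, fun i hi hid => ?_,
    fun i hi hid => (hY i hi (by omega)).2.2.2.2 (by omega), fun i hi hid => ?_⟩,
    fun i hi hid => (hY i hi hid).1, fun i hi hid => (hY i hi (by omega)).2.2.2.1 hid⟩
  · rw [show i + (d + 1) + 1 = i + 1 + d + 1 by omega]
    exact (Submodule.map_mono ((hY i hi (by omega)).2.2.2.1 (by omega))).trans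
      (hY (i + 1) (by omega) (by omega)).1
  · obtain ⟨h1, h2, -, h4, -⟩ := hY i hi (by omega)
    have hiso := isIsotropic_mono (h.isIsotropic (i + 1) (by omega) (by omega)) (h4 (by omega))
    rintro _ ⟨x, hx, rfl⟩ _ ⟨y, hy, rfl⟩
    rw [sympForm_pr (i := i) (by omega) (fun t ht => h2 hx t (by omega) (by omega))
      fun t ht => h2 hy t (by omega) (by omega)]
    exact hiso x hx y hy

/-- The diagonal `j = i` consists of the members of the flag; `V_{n,n}` is isotropic since
`prOuter n n` is the identity. -/
theorem isDiagonal_zero {V : FlagGr n} (hV : V ∈ SpFlag n) :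
    IsDiagonal n 0 fun i => if h : 1 ≤ i ∧ i ≤ n then V.space ⟨i - 1, by omega⟩ else ⊥ where
  finrank_eq i hi hid := by
    rw [dif_pos ⟨hi, by omega⟩, V.finrank_eq]
    exact Nat.sub_add_cancel hi
  le_coordSubspace i hi hid := fun x _ t h1 h2 => by omega
  map_le i hi hid := by
    rw [dif_pos ⟨hi, by omega⟩, dif_pos ⟨by omega, by omega⟩]
    exact hV.2 ⟨i - 1, by omega⟩ ⟨i, by omega⟩ (by simp only; omega)
  isIsotropic i hi hid := by
    rw [dif_pos ⟨hi, by omega⟩]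
    have h := hV.1 ⟨i - 1, by omega⟩
    rwa [prOuter_eq_prRange, show 2 * n - (i - 1 + 1) = i - 1 + 1 by omega, prRange_self,
      Submodule.map_id] at h
  isIsotropic_map i hi hid := by omega

theorem image_forget (n : ℕ) : forget n '' SpR n = SpFlag n := by
  refine Set.Subset.antisymm (mapsTo_forget n).image_subset fun V hV => ?_
  choose! next h1 h2 h3 using fun (d : ℕ) (X : ℕ → Submodule ℂ (Fin (2 * n) → ℂ))
    (h : IsDiagonal n d X) => h.exists_next
  -- `X d i` is the subspace `V_{i,i+d}`
  let X : ℕ → ℕ → Submodule ℂ (Fin (2 * n) → ℂ) := fun d => Nat.rec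
    (fun i => if h : 1 ≤ i ∧ i ≤ n then V.space ⟨i - 1, by omega⟩ else ⊥) next d
  have hX : ∀ d, IsDiagonal n d (X d) := by
    intro d
    induction d with
    | zero => exact isDiagonal_zero hV
    | succ d ih => exact h1 d (X d) ih
  have hsub : ∀ α : Root n, α.i + (α.j - α.i) = α.j ∧ 1 ≤ α.i ∧
      2 * α.i + (α.j - α.i) = α.i + α.j ∧ α.i + α.j ≤ 2 * n := fun α => by
    have := α.fullDomain
    unfold fullDomain at this
    omega
  refine ⟨⟨fun α => X (α.j - α.i) α.i, fun α => ?_⟩, ⟨fun α => ?_, fun α β hi hj => ?_,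
    fun α β hi hj => ?_, fun α hα => ?_⟩, ?_⟩
  · obtain ⟨-, h5, h6, h7⟩ := hsub α
    exact (hX _).finrank_eq _ h5 (by omega)
  · obtain ⟨h4, h5, h6, h7⟩ := hsub α
    have := (hX (α.j - α.i)).le_coordSubspace _ h5 (by omega)
    rwa [h4] at this
  · obtain ⟨h4, h5, h6, h7⟩ := hsub α
    obtain ⟨h4', h5', h6', h7'⟩ := hsub β
    have := h3 (β.j - β.i) _ (hX _) α.i h5 (by omega)
    change X (α.j - α.i) α.i ≤ X (β.j - β.i) β.i
    rw [hi, show α.j - α.i = β.j - (α.i + 1) + 1 by omega]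
    rw [hi] at this
    exact this
  · obtain ⟨h4, h5, h6, h7⟩ := hsub α
    obtain ⟨h4', h5', h6', h7'⟩ := hsub β
    have := h2 (α.j - α.i) _ (hX _) α.i h5 (by omega)
    change (X (α.j - α.i) α.i).map _ ≤ X (β.j - β.i) β.i
    rw [hi, show β.j - α.i = α.j - α.i + 1 by omega]
    rw [h4] at this
    exact this
  · obtain ⟨h4, h5, h6, h7⟩ := hsub α
    exact (hX _).isIsotropic _ h5 (by omega)
  · refine MultiGr.ext (funext fun i => ?_)
    change X ((i.1 + 1) - (i.1 + 1)) (i.1 + 1) = _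
    rw [Nat.sub_self]
    exact dif_pos ⟨by omega, by omega⟩

end Forget

/-! ### The open cell and birationality -/

section BigCell

theorem IsGraphProj.map {k : ℕ} {P : Matrix (Fin k) (Fin k) ℂ} {V : Submodule ℂ (Fin k → ℂ)}
    {S : Finset (Fin k)} (h : IsGraphProj P V S) {f : (Fin k → ℂ) →ₗ[ℂ] (Fin k → ℂ)}
    (hf : ∀ x, ∀ s ∈ S, f x s = x s) : IsGraphProj (LinearMap.toMatrix' f * P) (V.map f) S where
  mem x := by
    rw [← Matrix.mulVec_mulVec, LinearMap.toMatrix'_mulVec]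
    exact Submodule.mem_map_of_mem (h.mem x)
  agree x s hs := by
    rw [← Matrix.mulVec_mulVec, LinearMap.toMatrix'_mulVec, hf _ s hs, h.agree x s hs]
  inj := by
    rintro _ ⟨v, hv, rfl⟩ hS
    rw [h.inj v hv fun s hs => (hf v s hs).symm.trans (hS s hs), map_zero]

theorem IsRegularSubspaceOn.map {ι : Type} {m d : ι → ℕ} {k k' : ℕ}
    {Φ : MultiGr m d → Submodule ℂ (Fin k → ℂ)} {κ : Type} {Z : Set (MultiGr m d)}
    (h : IsRegularSubspaceOn Φ κ Z) (f : (Fin k → ℂ) →ₗ[ℂ] (Fin k' → ℂ)) :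
    IsRegularSubspaceOn (fun x => (Φ x).map f) κ Z := by
  intro x hx
  obtain ⟨U, hU, hxU, g, hg, hs⟩ := h x hx
  refine ⟨U, hU, hxU, fun a r y => f (fun r => g a r y) r,
    fun a r => IsRegularOn.linearMap_apply f (hg a) r, fun y hy => ?_⟩
  change _ = (Φ y).map f
  rw [← hs y hy, Submodule.map_span, ← Set.range_comp]
  rfl

variable {n : ℕ}

/-- The indices of `w_1, …, w_k`. -/
def initialCoords (n k : ℕ) : Finset (Fin (2 * n)) := {t | t.1 < k}

theorem mem_initialCoords {k : ℕ} {t : Fin (2 * n)} : t ∈ initialCoords n k ↔ t.1 < k := by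
  simp [initialCoords]

/-- The collections `(V_1, …, V_n)` in which `V_i` is a graph over `⟨w_1, …, w_i⟩`. -/
def bigCell (n : ℕ) : Set (FlagGr n) :=
  {V | ∀ i : Fin n, IsGraphOver (V.space i) (initialCoords n (i.1 + 1))}

theorem isOpen_bigCell (n : ℕ) : IsOpen (bigCell n) := by
  have : bigCell n = ⋂ i : Fin n,
      graphLocus (m := fun _ : Fin n => 2 * n) i (initialCoords n (i.1 + 1)) := by
    ext V
    simp [bigCell, graphLocus]
  rw [this]
  exact isOpen_iInter_of_finite fun i => isOpen_graphLocus _ _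

theorem isOpen_forget_preimage_bigCell (n : ℕ) : IsOpen (forget n ⁻¹' bigCell n) := by
  have : forget n ⁻¹' bigCell n = ⋂ i : Fin n,
      graphLocus (m := fun _ : Root n => 2 * n) (diagRoot i) (initialCoords n (i.1 + 1)) := by
    ext V
    simp [bigCell, graphLocus, forget]
  rw [this]
  exact isOpen_iInter_of_finite fun i => isOpen_graphLocus _ _

/-- The index of `V_i` in a flag, for a root `α_{i,j}`. -/
def Root.row (α : Root n) : Fin n :=
  ⟨α.i - 1, by have := α.fullDomain; unfold _root_.fullDomain at this; omega⟩

theorem Root.row_add_one (α : Root n) : α.row.1 + 1 = α.i := Nat.sub_add_cancel α.2.1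

/-- The collection with `V_{i,j} = pr_{i+1} ⋯ pr_j V_i`, where this has dimension `i`; it is the
only one over a flag in the open cell. -/
def expand (n : ℕ) (V : FlagGr n) : RootGr n where
  space α := withFinrank α.i ((V.space α.row).map (prRange n α.i α.j)) (V.space α.row)
  finrank_eq α := finrank_withFinrank ((V.finrank_eq _).trans α.row_add_one)

theorem expand_space {V : FlagGr n} (hV : V ∈ bigCell n) (α : Root n) :
    (expand n V).space α = (V.space α.row).map (prRange n α.i α.j) := by
  refine withFinrank_eq ?_
  have h := hV α.row
  rw [α.row_add_one] at h
  have h' := (h.isGraphProj.map (f := prRange n α.i α.j) fun x s hs => by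
    rw [mem_initialCoords] at hs
    rw [prRange_apply, if_neg (by omega)]).isGraphOver
  rw [← h'.1, h.1, V.finrank_eq, α.row_add_one]

theorem forget_expand {V : FlagGr n} (hV : V ∈ bigCell n) : forget n (expand n V) = V := by
  refine MultiGr.ext (funext fun i => (expand_space hV (diagRoot i)).trans ?_)
  change (V.space i).map (prRange n (i.1 + 1) (i.1 + 1)) = V.space i
  rw [prRange_self, Submodule.map_id]

theorem expand_mem_SpR {V : FlagGr n} (hV : V ∈ SpFlag n) (hV' : V ∈ bigCell n) :
    expand n V ∈ SpR n := by
  refine ⟨fun α => ?_, fun α β hi hj => ?_, fun α β hi hj => ?_, fun α hα => ?_⟩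
  · rw [expand_space hV']
    exact map_prRange_le_coordSubspace _ _ _
  · rw [expand_space hV', expand_space hV', hj, hi,
      ← prRange_comp_pr (by have := β.2.2.1; unfold Root.i Root.j at *; omega), Submodule.map_comp]
    have hrow : β.row.1 = α.row.1 + 1 := by
      rw [α.row_add_one, ← Nat.add_sub_cancel α.i 1, ← hi]
      rfl
    have h := hV.2 α.row β.row hrow
    rw [hrow, α.row_add_one] at h
    exact Submodule.map_mono h
  · have hrow : β.row = α.row := Fin.ext (by simp only [Root.row, hi])
    rw [expand_space hV', expand_space hV', hj, hi, hrow, ← pr_comp_prRange α.2.2.1,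
      Submodule.map_comp]
  · rw [expand_space hV']
    have h := hV.1 α.row
    rwa [prOuter_eq_prRange, α.row_add_one, show 2 * n - α.i = α.j by omega] at h

theorem expand_forget {V : RootGr n} (hV : V ∈ SpR n) (hV' : forget n V ∈ bigCell n) :
    expand n (forget n V) = V := by
  refine MultiGr.ext (funext fun α => ?_)
  refine Submodule.eq_of_le_of_finrank_eq ?_ 
    (((expand n (forget n V)).finrank_eq α).trans (V.finrank_eq α).symm)
  rw [expand_space hV']
  exact map_prRange_le hV (α := diagRoot α.row) rfl α.row_add_one.symm

theorem isRegularSubspaceOn_forget (n : ℕ) (i : Fin n) (Z : Set (RootGr n)) :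
    IsRegularSubspaceOn (fun V => (forget n V).space i) (Fin (i.1 + 1)) Z :=
  isRegularSubspaceOn_space (m := fun _ : Root n => 2 * n) (d := fun α : Root n => α.i)
    (diagRoot i) Z

theorem isIrreducible_SpFlag (n : ℕ) : IsIrreducible (SpFlag n) := by
  rw [← image_forget]
  exact (isIrreducible_SpR n).image _
    (continuousOn_of_isRegularSubspaceOn fun i => isRegularSubspaceOn_forget n i _)

theorem isIsoOn_forget (n : ℕ) : IsIsoOn (forget n) (expand n)
    (SpR n ∩ forget n ⁻¹' bigCell n) (SpFlag n ∩ bigCell n) := by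
  refine ⟨IsRegularMapOn.of_isRegularSubspaceOn (fun V hV => ⟨mapsTo_forget n hV.1, hV.2⟩)
    fun i => isRegularSubspaceOn_forget n i _,
    IsRegularMapOn.of_isRegularSubspaceOn (fun V hV => ⟨expand_mem_SpR hV.1 hV.2, ?_⟩)
      fun α => ?_, fun V hV => expand_forget hV.1 hV.2, fun V hV => forget_expand hV.2⟩
  · rw [Set.mem_preimage, forget_expand hV.2]
    exact hV.2
  · refine IsRegularSubspaceOn.congr ?_ fun V hV => expand_space hV.2 α
    refine IsRegularSubspaceOn.map (f := prRange n α.i α.j) ?_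
    exact (isRegularSubspaceOn_space (m := fun _ : Fin n => 2 * n) α.row _).reindex
      (finCongr α.row_add_one.symm)

theorem SpFlag_subset_closure (h : (SpFlag n ∩ bigCell n).Nonempty) :
    SpFlag n ⊆ closure (SpFlag n ∩ bigCell n) :=
  subset_closure_inter_of_isPreirreducible_of_isOpen (isIrreducible_SpFlag n).2
    (isOpen_bigCell n) h

theorem isBirationalOn_forget (h : (SpFlag n ∩ bigCell n).Nonempty) :
    IsBirationalOn (forget n) (SpR n) (SpFlag n) := by
  refine ⟨IsRegularMapOn.of_isRegularSubspaceOn (mapsTo_forget n)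
    fun i => isRegularSubspaceOn_forget n i _, _, _, isOpen_forget_preimage_bigCell n,
    isOpen_bigCell n, subset_closure_inter_of_isPreirreducible_of_isOpen (isIrreducible_SpR n).2
      (isOpen_forget_preimage_bigCell n) ?_, SpFlag_subset_closure h, _, isIsoOn_forget n⟩
  obtain ⟨V, hV, hV'⟩ := h
  rw [← image_forget] at hV
  obtain ⟨X, hX, rfl⟩ := hV
  exact ⟨X, hX, hV'⟩

end BigCell

/-! ### The orbit of the degenerate group -/

section Orbit

variable {n : ℕ}

/-- A matrix that is the identity in the rows of `S` and vanishes in the columns outside `S` is the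
graph projection of its column span. -/
theorem isGraphProj_span {k : ℕ} {P : Matrix (Fin k) (Fin k) ℂ} {S : Finset (Fin k)}
    (h1 : ∀ s ∈ S, ∀ c, P s c = if s = c then 1 else 0) (h2 : ∀ c ∉ S, ∀ r, P r c = 0) :
    IsGraphProj P (Submodule.span ℂ (Set.range fun (s : S) (r : Fin k) => P r s)) S where
  mem x := by
    rw [Matrix.mulVec_eq_sum]
    refine Submodule.sum_mem _ fun c _ => ?_
    rw [op_smul_eq_smul]
    by_cases hc : c ∈ S
    · exact Submodule.smul_mem _ _ (Submodule.subset_span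
        (Set.mem_range_self (f := fun (s : S) (r : Fin k) => P r s) ⟨c, hc⟩))
    · convert! Submodule.zero_mem _
      ext r
      simp [h2 c hc r]
  agree x s hs := by
    simp [Matrix.mulVec, dotProduct, h1 s hs]
  inj v hv hvS := by
    have hfix : Submodule.span ℂ (Set.range fun (s : S) (r : Fin k) => P r s) ≤
        LinearMap.eqLocus P.mulVecLin LinearMap.id := by
      rw [Submodule.span_le]
      rintro _ ⟨s, rfl⟩
      refine funext fun r => ?_
      change ∑ c, P r c * P c s = P r s
      rw [Finset.sum_eq_single s.1]
      · rw [h1 s s.2, if_pos rfl, mul_one]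
      · intro c _ hcs
        by_cases hc : c ∈ S
        · rw [h1 c hc, if_neg hcs, mul_zero]
        · rw [h2 c hc, zero_mul]
      · simp
    have hv' : P.mulVec v = v := hfix hv
    rw [← hv']
    refine funext fun r => ?_
    change ∑ c, P r c * v c = 0
    refine Finset.sum_eq_zero fun c _ => ?_
    by_cases hc : c ∈ S
    · rw [hvS c hc, mul_zero]
    · rw [h2 c hc, zero_mul]

/-- The projection onto `⟨w_t + ∑_{s > k} γ_{s,t} w_s : t ≤ k⟩` along `⟨w_{k+1}, …, w_{2n}⟩`. -/
def orbitProj (n k : ℕ) (γ : Matrix (Fin (2 * n)) (Fin (2 * n)) ℂ) :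
    Matrix (Fin (2 * n)) (Fin (2 * n)) ℂ :=
  Matrix.of fun s t =>
    if t.1 < k then if s.1 < k then (if s = t then 1 else 0) else γ s t else 0

theorem isGraphProj_orbitProj (k : ℕ) (γ : Matrix (Fin (2 * n)) (Fin (2 * n)) ℂ) :
    IsGraphProj (orbitProj n k γ) (Submodule.span ℂ {v | ∃ t : Fin (2 * n), t.1 < k ∧
      v = fun s : Fin (2 * n) => if s.1 < k then (if s = t then 1 else 0) else γ s t})
      (initialCoords n k) := by
  convert isGraphProj_span (P := orbitProj n k γ) (S := initialCoords n k) ?_ ?_ using 2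
  · ext v
    constructor
    · rintro ⟨t, ht, rfl⟩
      refine ⟨⟨t, mem_initialCoords.2 ht⟩, funext fun s => ?_⟩
      simp only [orbitProj, Matrix.of_apply, if_pos ht]
    · rintro ⟨⟨t, ht⟩, rfl⟩
      rw [mem_initialCoords] at ht
      refine ⟨t, ht, funext fun s => ?_⟩
      simp only [orbitProj, Matrix.of_apply, if_pos ht]
  · intro s hs c
    rw [mem_initialCoords] at hs
    simp only [orbitProj, Matrix.of_apply, if_pos hs]
    by_cases hc : c.1 < k
    · rw [if_pos hc]
    · rw [if_neg hc, if_neg]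
      rintro rfl
      exact hc hs
  · intro c hc r
    rw [mem_initialCoords] at hc
    simp only [orbitProj, Matrix.of_apply, if_neg hc]

theorem sympForm_mulVec (γ : Matrix (Fin (2 * n)) (Fin (2 * n)) ℂ) (x y : Fin (2 * n) → ℂ) :
    sympForm n x (γ.mulVec y) = ∑ s, ∑ t, sympSign n s * γ s.rev t * x s * y t := by
  rw [sympForm_eq]
  refine Finset.sum_congr rfl fun s _ => ?_
  rw [Matrix.mulVec, dotProduct, Finset.mul_sum, Finset.mul_sum]
  exact Finset.sum_congr rfl fun t _ => by ring

/-- A matrix lies in `sp_{2n}` iff the bilinear form `⟨x, γ y⟩` is symmetric. -/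
theorem mem_sp_iff {γ : Matrix (Fin (2 * n)) (Fin (2 * n)) ℂ} :
    (∀ x y, sympForm n (γ.mulVec x) y + sympForm n x (γ.mulVec y) = 0) ↔
      ∀ s t, sympSign n s * γ s.rev t = sympSign n t * γ t.rev s := by
  constructor
  · intro h s t
    have hst : ∀ s t : Fin (2 * n), sympForm n (Pi.single s 1) (γ.mulVec (Pi.single t 1)) =
        sympSign n s * γ s.rev t := fun s t => by
      rw [sympForm_mulVec]
      simp [Pi.single_apply]
    have h1 := h (Pi.single s 1) (Pi.single t 1)
    rw [sympForm_swap, hst, hst] at h1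
    linear_combination h1
  · intro h x y
    rw [sympForm_swap, sympForm_mulVec, sympForm_mulVec, Finset.sum_comm, ← sub_eq_neg_add,
      sub_eq_zero]
    refine Finset.sum_congr rfl fun s _ => Finset.sum_congr rfl fun t _ => ?_
    rw [h s t]
    ring

/-- The condition `pr_{k+1} V ⊆ V'` in terms of graph projections. -/
theorem map_pr_le_iff {k : ℕ} {V V' : Submodule ℂ (Fin (2 * n) → ℂ)}
    {P P' : Matrix (Fin (2 * n)) (Fin (2 * n)) ℂ} (hP : IsGraphProj P V (initialCoords n k))
    (hP' : IsGraphProj P' V' (initialCoords n (k + 1))) :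
    V.map (pr n (k + 1)) ≤ V' ↔
      ∀ s t : Fin (2 * n), t.1 < k → k < s.1 → P s t = P' s t := by
  constructor
  · intro h s t ht hs
    have h1 := hP'.eq_of_agree (x := Pi.single t 1)
      (h (Submodule.mem_map_of_mem (hP.col_mem t))) fun r hr => by
        rw [mem_initialCoords] at hr
        rw [pr_apply, Pi.single_apply]
        by_cases hrk : r.1 + 1 = k + 1
        · rw [if_pos hrk, if_neg]
          rintro rfl
          omega
        · rw [if_neg hrk, hP.apply_of_mem (mem_initialCoords.2 (by omega))]
    have h2 := congrFun h1 s
    rw [Matrix.mulVec_single_one, pr_apply, if_neg (by omega)] at h2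
    exact h2.symm
  · intro h
    rw [← hP.span_col, Submodule.map_span_le]
    rintro _ ⟨⟨t, ht⟩, rfl⟩
    have ht' := mem_initialCoords.1 ht
    change pr n (k + 1) (fun s => P s t) ∈ V'
    convert hP'.col_mem t using 1
    ext s
    rw [pr_apply]
    by_cases hs : s.1 < k + 1
    · rw [hP'.apply_of_mem (mem_initialCoords.2 hs)]
      by_cases hsk : s.1 + 1 = k + 1
      · rw [if_pos hsk, if_neg]
        rintro rfl
        omega
      · rw [if_neg hsk, hP.apply_of_mem (mem_initialCoords.2 (by omega))]
    · rw [if_neg (by omega)]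
      exact h s t ht' (by omega)

theorem sympForm_prOuter_col {k : ℕ} (hk : k ≤ n) {V : Submodule ℂ (Fin (2 * n) → ℂ)}
    {P : Matrix (Fin (2 * n)) (Fin (2 * n)) ℂ} (hP : IsGraphProj P V (initialCoords n k))
    {t t' : Fin (2 * n)} (ht : t.1 < k) (ht' : t'.1 < k) :
    sympForm n (prOuter n k fun s => P s t) (prOuter n k fun s => P s t') =
      P t.rev t' - P t'.rev t := by
  have hterm : ∀ s : Fin (2 * n), sympSign n s *
      (prOuter n k (fun s => P s t) s * prOuter n k (fun s => P s t') s.rev) =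
      (if s = t then P t.rev t' else 0) - if s = t'.rev then P t'.rev t else 0 := by
    intro s
    have h1 := Fin.val_rev s
    have h2 := Fin.val_rev t'
    rw [prOuter_apply, prOuter_apply]
    by_cases hs : s.1 < k
    · have hne : s ≠ t'.rev := fun h => by rw [h] at hs; omega
      rw [if_neg (by omega), if_neg (by omega), if_neg hne,
        hP.apply_of_mem (s := s) (mem_initialCoords.2 hs), sympSign, if_pos (by omega)]
      by_cases hst : s = t
      · rw [if_pos hst, if_pos hst, hst]
        ring
      · rw [if_neg hst, if_neg hst]
        ring
    · have hne : s ≠ t := fun h => hs (h ▸ ht)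
      by_cases hs' : s.1 + 1 ≤ 2 * n - k
      · have hne' : s ≠ t'.rev := fun h => by rw [h] at hs'; omega
        rw [if_pos ⟨by omega, hs'⟩, if_neg hne, if_neg hne']
        ring
      · rw [if_neg (by omega), if_neg (by omega), if_neg hne,
          hP.apply_of_mem (s := s.rev) (mem_initialCoords.2 (by omega)), sympSign,
          if_neg (by omega)]
        by_cases hst : s = t'.rev
        · rw [if_pos hst, if_pos (by rw [hst, Fin.rev_rev]), hst]
          ring
        · rw [if_neg hst, if_neg fun h => hst (by rw [← h, Fin.rev_rev])]
          ring
  rw [sympForm_eq, Finset.sum_congr rfl fun s _ => hterm s, Finset.sum_sub_distrib]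
  simp

/-- The isotropy condition in terms of graph projections. -/
theorem isIsotropic_map_prOuter_iff {k : ℕ} (hk : k ≤ n) {V : Submodule ℂ (Fin (2 * n) → ℂ)}
    {P : Matrix (Fin (2 * n)) (Fin (2 * n)) ℂ} (hP : IsGraphProj P V (initialCoords n k)) :
    IsIsotropic n (V.map (prOuter n k)) ↔
      ∀ t t' : Fin (2 * n), t.1 < k → t'.1 < k → P t.rev t' = P t'.rev t := by
  constructor
  · intro h t t' ht ht'
    rw [← sub_eq_zero, ← sympForm_prOuter_col hk hP ht ht']
    exact h _ (Submodule.mem_map_of_mem (hP.col_mem t)) _ (Submodule.mem_map_of_mem (hP.col_mem t'))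
  · intro h
    let B := (sympBilin n).compl₁₂ (prOuter n k) (prOuter n k)
    have h1 : ∀ t : Fin (2 * n), t.1 < k → V ≤ LinearMap.ker (B fun s => P s t) := by
      intro t ht
      rw [← hP.span_col, Submodule.span_le]
      rintro _ ⟨⟨t', ht'⟩, rfl⟩
      rw [mem_initialCoords] at ht'
      exact (sympForm_prOuter_col hk hP ht ht').trans (sub_eq_zero.2 (h t t' ht ht'))
    have h2 : ∀ y ∈ V, V ≤ LinearMap.ker (B.flip y) := by
      intro y hy
      rw [← hP.span_col, Submodule.span_le]
      rintro _ ⟨⟨t, ht⟩, rfl⟩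
      exact h1 t (mem_initialCoords.1 ht) hy
    rintro _ ⟨x, hx, rfl⟩ _ ⟨y, hy, rfl⟩
    exact h2 y hy hx

theorem degenerateOrbit_subset (n : ℕ) : degenerateOrbit n ⊆ SpFlag n ∩ bigCell n := by
  rintro V ⟨γ, -, hγ, hV⟩
  rw [mem_sp_iff] at hγ
  have hP : ∀ i : Fin n,
      IsGraphProj (orbitProj n (i.1 + 1) γ) (V.space i) (initialCoords n (i.1 + 1)) := fun i => by
    rw [hV i]
    exact isGraphProj_orbitProj _ γ
  refine ⟨⟨fun i => ?_, fun i i' h => ?_⟩, fun i => (hP i).isGraphOver⟩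
  · rw [isIsotropic_map_prOuter_iff (by omega) (hP i)]
    intro t t' ht ht'
    have h1 := Fin.val_rev t
    have h2 := Fin.val_rev t'
    have h3 := hγ t t'
    rw [sympSign, sympSign, if_pos (by omega), if_pos (by omega), one_mul, one_mul] at h3
    simp only [orbitProj, Matrix.of_apply]
    rw [if_pos ht', if_neg (by omega), if_pos ht, if_neg (by omega), h3]
  · have hP' := hP i'
    rw [h] at hP' ⊢
    rw [map_pr_le_iff (hP i) hP']
    intro s t ht hs
    simp only [orbitProj, Matrix.of_apply]
    rw [if_pos ht, if_neg (by omega), if_pos (by omega), if_neg (by omega)]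

theorem SpFlag_inter_bigCell_subset (n : ℕ) : SpFlag n ∩ bigCell n ⊆ degenerateOrbit n := by
  rintro V ⟨hV, hV'⟩
  let P : Fin n → Matrix (Fin (2 * n)) (Fin (2 * n)) ℂ := fun i =>
    graphProj (V.space i) (initialCoords n (i.1 + 1))
  have hP : ∀ i, IsGraphProj (P i) (V.space i) (initialCoords n (i.1 + 1)) := fun i =>
    (hV' i).isGraphProj
  -- the column `t` of the projections does not depend on the flag index, below the leading rows
  have hcol : ∀ (s t : Fin (2 * n)) (i : ℕ) (hti : t.1 ≤ i) (hi : i < n), i < s.1 →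
      P ⟨i, hi⟩ s t = P ⟨t.1, by omega⟩ s t := by
    intro s t i hti
    induction i, hti using Nat.le_induction with
    | base => exact fun _ _ => rfl
    | succ i hti ih =>
      intro hi hs
      rw [← ih (by omega) (by omega)]
      exact ((map_pr_le_iff (hP ⟨i, by omega⟩) (hP ⟨i + 1, hi⟩)).1
        (hV.2 ⟨i, by omega⟩ ⟨i + 1, hi⟩ rfl) s t (by simp only; omega) hs).symm
  let g : Fin (2 * n) → Fin (2 * n) → ℂ := fun s t => if h : t.1 < n then P ⟨t.1, h⟩ s t else 0
  have hg : ∀ (s t : Fin (2 * n)) (i : Fin n), t.1 ≤ i.1 → i.1 < s.1 → P i s t = g s t := by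
    intro s t i ht hs
    simp only [g]
    rw [dif_pos (by omega)]
    exact hcol s t i.1 ht i.2 hs
  have hsymm : ∀ s t : Fin (2 * n), s.1 < n → t.1 < n → g s.rev t = g t.rev s := by
    intro s t hs ht
    have h1 := Fin.val_rev s
    have h2 := Fin.val_rev t
    rw [← hg s.rev t ⟨n - 1, by omega⟩ (by simp only; omega) (by simp only; omega),
      ← hg t.rev s ⟨n - 1, by omega⟩ (by simp only; omega) (by simp only; omega)]
    exact (isIsotropic_map_prOuter_iff (by simp only; omega) (hP ⟨n - 1, by omega⟩)).1 (hV.1 _) s t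
      (by simp only; omega) (by simp only; omega)
  -- the last `n` columns are determined by the first `n` through the equations of `sp_{2n}`
  refine ⟨Matrix.of fun s t => if s ≤ t then 0 else if t.1 < n then g s t else -g t.rev s.rev,
    fun s t hst => if_pos hst, mem_sp_iff.2 fun s t => ?_, fun i => ?_⟩
  · have h1 := Fin.val_rev s
    have h2 := Fin.val_rev t
    simp only [Matrix.of_apply, Fin.le_def, Fin.rev_rev, sympSign]
    have hle : t.rev.1 ≤ s.1 ↔ s.rev.1 ≤ t.1 := by omega
    simp only [hle]
    by_cases hst : s.rev.1 ≤ t.1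
    · simp only [if_pos hst, mul_zero]
    · simp only [if_neg hst]
      by_cases hs : s.1 < n
      · by_cases ht : t.1 < n
        · simp only [if_pos hs, if_pos ht, hsymm s t hs ht]
        · simp only [if_pos hs, if_neg ht]
          ring
      · simp only [if_neg hs, if_pos (show t.1 < n by omega)]
        ring
  · refine (hP i).span_col.symm.trans (congrArg _ ?_)
    have hval : ∀ t : Fin (2 * n), t.1 < i.1 + 1 → (fun s => P i s t) = fun s : Fin (2 * n) =>
        if s.1 < i.1 + 1 then (if s = t then 1 else 0) else
          Matrix.of (fun s t : Fin (2 * n) => if s ≤ t then (0 : ℂ) else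
            if t.1 < n then g s t else -g t.rev s.rev) s t := by
      intro t ht
      ext s
      by_cases hs : s.1 < i.1 + 1
      · rw [if_pos hs, (hP i).apply_of_mem (mem_initialCoords.2 hs)]
      · rw [if_neg hs, Matrix.of_apply, if_neg (by rw [Fin.le_def]; omega), if_pos (by omega),
          hg s t i (by omega) (by omega)]
    ext v
    constructor
    · rintro ⟨⟨t, ht⟩, rfl⟩
      exact ⟨t, mem_initialCoords.1 ht, hval t (mem_initialCoords.1 ht)⟩
    · rintro ⟨t, ht, rfl⟩
      exact ⟨⟨t, mem_initialCoords.2 ht⟩, hval t ht⟩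

/-- The orbit of the highest weight point is the open cell of the degenerate flag variety. -/
theorem degenerateOrbit_eq (n : ℕ) : degenerateOrbit n = SpFlag n ∩ bigCell n :=
  (degenerateOrbit_subset n).antisymm (SpFlag_inter_bigCell_subset n)

/-- The highest weight point lies in the orbit. -/
theorem degenerateOrbit_nonempty (n : ℕ) : (degenerateOrbit n).Nonempty := by
  have hP := fun i : Fin n => isGraphProj_orbitProj (n := n) (i.1 + 1) 0
  refine ⟨⟨_, fun i => (hP i).isGraphOver.1.symm.trans ?_⟩, 0, fun _ _ _ => rfl,
    mem_sp_iff.2 fun s t => by simp, fun i => rfl⟩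
  rw [initialCoords, Fin.card_filter_val_lt]
  omega

theorem closure_degenerateOrbit (n : ℕ) : closure (degenerateOrbit n) = SpFlag n := by
  rw [degenerateOrbit_eq]
  exact (closure_minimal Set.inter_subset_left (isClosed_SpFlag n)).antisymm
    (SpFlag_subset_closure (degenerateOrbit_eq n ▸ degenerateOrbit_nonempty n))

end Orbit

end

theorem mainTheorem5 (n : ℕ) (hn : 1 ≤ n) :
    -- the objects are projective varieties
    (IsClosed (SpR n) ∧ (∀ l ≤ n ^ 2, IsClosed (SpRStep n l)) ∧ IsClosed (SpFlag n)) ∧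
    -- the tower of `ℙ¹`-fibrations from a point to `SpR_{2n}`
    ((∃ P, SpRStep n 0 = {P}) ∧
      (∀ l < n ^ 2, IsP1Fibration (stepMap n l) (SpRStep n (l + 1)) (SpRStep n l)) ∧
      (∃ G, IsIsoOn (toStep n (n ^ 2)) G (SpR n) (SpRStep n (n ^ 2)))) ∧
    -- smoothness
    IsSmoothVariety (SpR n) ∧
    -- the forgetful map is surjective and birational
    (forget n '' SpR n = SpFlag n ∧ IsBirationalOn (forget n) (SpR n) (SpFlag n)) ∧
    -- irreducibility, and the description as an orbit closure
    (IsIrreducible (SpFlag n) ∧ closure (degenerateOrbit n) = SpFlag n) :=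
  ⟨⟨isClosed_SpR n, fun l _ => isClosed_SpRStep n l, isClosed_SpFlag n⟩,
    ⟨SpRStep_zero n, fun _ hl => isP1Fibration_stepMap hl, exists_isIsoOn_toStep n⟩,
    isSmoothVariety_SpR n,
    ⟨image_forget n, isBirationalOn_forget (degenerateOrbit_eq n ▸ degenerateOrbit_nonempty n)⟩,
    isIrreducible_SpFlag n, closure_degenerateOrbit n⟩
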